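/- Let $M$ be a graph of type $A_n$ $(n\ge 1)$, $D_n$ $(n\ge 4)$, $E_6$, $E_7$ or $E_8$, with Coxeter group $W=W(M)=\langle r_i\rangle$, simple roots $\alpha_i$, root system $\Phi$ (with $(\alpha,\alpha)=2$) and positive roots $\Phi^+$; $r_\beta\in W$ is the reflection with root $\beta$, and $i\sim j$ denotes adjacency of nodes. *The Brauer monoid.* ${\rm BrM}(M)$ is the monoid generated by $r_i,e_i$ ($i$ a node of $M$) and $\delta,\delta^{-1}$ subject to: $\delta$ is central and $\delta\delta^{-1}=1$; $r_i^2=1$, $e_ir_i=r_ie_i=e_i$, $e_i^2=\delta e_i$; for $i\not\sim j$: $r_ir_j=r_jr_i$, $e_ir_j=r_je_i$, $e_ie_j=e_je_i$; for $i\sim j$: $r_ir_jr_i=r_jr_ir_j$, $r_je_ir_j=r_ie_jr_i$, $r_jr_ie_j=e_ie_j$. Put ${\rm Br}(M)=\mathbb Z[{\rm BrM}(M)]$. *Admissible sets.* A set $B$ of mutually orthogonal positive roots is admissible if, whenever $\beta_1,\beta_2,\beta_3\in B$ are distinct and $\alpha\in\Phi$ satisfies $|(\alpha,\beta_k)|=1$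 for $k=1,2,3$, one of $\pm r_\alpha r_{\beta_1}r_{\beta_2}r_{\beta_3}\alpha$ lies in $B$. Let $\mathcal A$ be the collection of admissible sets, on which $W$ acts by $wB=\{\pm w\beta\mid\beta\in B\}\cap\Phi^+$. The admissible closure $X^{\rm cl}$ of a set $X$ of mutually orthogonal positive roots is the intersection of all admissible sets containing $X$. Let $\mathcal F(\mathcal A)$ be the monoid of all maps $\mathcal A\to\mathcal A$. *Highest elements.* For a $W$-orbit $\mathcal B\subseteq\mathcal A$, say that $r_k$ raises $B\in\mathcal B$ if there is $\beta\in B$ with $(\alpha_k,\beta)=-1$ such that ${\rm ht}(\beta)<{\rm ht}(\gamma)$ for all $\gamma\in B$ with $(\alpha_k,\gamma)=1$. Order $\mathcal B$ by the reflexive transitive closure of the relations $B<r_kB$ with $r_k$ raising $B$. For an element $B_0$ of $\mathcal B$ let $C$ be the set of nodes $i$ with $\alpha_i\perp B_0$, and $W(C)=\langle r_i\mid i\in C\rangle$. **Theorem.** (i) There is a unique monoid homomorphism $\sigma:{\rm BrM}(M)\to\mathcal F(\mathcal A)$ such that $\delta$ acts trivially, each $r_i$ acts as in the action of $W$, and $$e_iB=\begin{cases}B&\text{if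 }\alpha_i\in B,\\ (B\cup\{\alpha_i\})^{\rm cl}&\text{if }\alpha_i\perp B,\\ r_\beta r_iB&\text{for every }\beta\in B\text{ with }(\alpha_i,\beta)\neq0.\end{cases}$$ If $Y,X\in\mathcal A$ and $a\in{\rm BrM}(M)$ satisfy $Y\subseteq X$, then $aY\subseteq aX$. (ii) Let $\mathcal B$ be a $W$-orbit in $\mathcal A$. Then $\mathcal B$ has a unique highest element $B_0$. Let $C_{\mathcal B}=C$ be formed with this $B_0$. There is a unique family of elements $h_{B,i}\in W(C_{\mathcal B})$ ($B\in\mathcal B$, $i$ a node) such that $h_{B,i}=1$ if $\alpha_i\not\perp B$; $h_{B_0,i}=r_i$ for $i\in C_{\mathcal B}$; and, whenever $\alpha_i\perp B$ and $r_k$ raises $B$, $h_{B,i}=h_{r_kB,i}$ if $k\not\sim i$ and $h_{B,i}=h_{r_ir_kB,k}$ if $k\sim i$. Let $V_{\mathcal B}$ be the free right $\mathbb Z[\delta^{\pm1}][W(C_{\mathcal B})]$-module with basis $\xi_B$, $B\in\mathcal B$. There is a unique linear representation $\rho_{\mathcal B}:W\to{\rm GL}(V_{\mathcal B})$ with $r_i\xi_B=\xi_{r_iB}h_{B,i}$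 for all $B$ and $i$, and there is a unique linear representation of ${\rm Br}(M)$ on $V_{\mathcal B}$ that extends $\rho_{\mathcal B}$, in which $\delta$ acts by the homothety $v\mapsto v\delta$ and $$e_i\xi_B=\begin{cases}\xi_B\delta&\text{if }\alpha_i\in B,\\ 0&\text{if }\alpha_i\perp B,\\ r_\beta r_i\xi_B&\text{for every }\beta\in B\text{ with }|(\alpha_i,\beta)|=1.\end{cases}$$ -/

import Mathlib

namespace BrauerADE

open scoped LaurentPolynomial RightActions

noncomputable section

/-! ### Graphs of type ADE -/

/-- The Dynkin graph of a simply laced Cartan matrix: distinct nodes are adjacent when the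
corresponding entry is nonzero. -/
def dynkinGraph {n : ℕ} (A : Matrix (Fin n) (Fin n) ℤ) : SimpleGraph (Fin n) :=
  SimpleGraph.fromRel fun i j => A i j ≠ 0

/-- `M` is one of the graphs `A_n` (`n ≥ 1`), `D_n` (`n ≥ 4`), `E_6`, `E_7`, `E_8`. -/
def IsADE {I : Type*} (M : SimpleGraph I) : Prop :=
  (∃ n : ℕ, 1 ≤ n ∧ Nonempty (M ≃g dynkinGraph (CartanMatrix.A n))) ∨
  (∃ n : ℕ, 4 ≤ n ∧ Nonempty (M ≃g dynkinGraph (CartanMatrix.D n))) ∨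
  Nonempty (M ≃g dynkinGraph CartanMatrix.E₆) ∨
  Nonempty (M ≃g dynkinGraph CartanMatrix.E₇) ∨
  Nonempty (M ≃g dynkinGraph CartanMatrix.E₈)

/-! ### The Brauer monoid and the Brauer algebra -/

/-- The generators `r_i`, `e_i`, `δ`, `δ⁻¹` of the Brauer monoid. -/
inductive Gen (I : Type*) : Type _
  | r (i : I) : Gen I
  | e (i : I) : Gen I
  | delta : Gen I
  | deltaInv : Gen I

/-- The defining relations of the Brauer monoid of type `M`, as a relation on words. -/
inductive BrauerRel {I : Type*} (M : SimpleGraph I) :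
    FreeMonoid (Gen I) → FreeMonoid (Gen I) → Prop
  | delta_central (x : Gen I) :
      BrauerRel M (.of .delta * .of x) (.of x * .of .delta)
  | delta_inv : BrauerRel M (.of .delta * .of .deltaInv) 1
  | RSrr (i : I) : BrauerRel M (.of (.r i) * .of (.r i)) 1
  | RSer (i : I) : BrauerRel M (.of (.e i) * .of (.r i)) (.of (.e i))
  | RSre (i : I) : BrauerRel M (.of (.r i) * .of (.e i)) (.of (.e i))
  | HSee (i : I) : BrauerRel M (.of (.e i) * .of (.e i)) (.of .delta * .of (.e i))
  | HCrr (i j : I) : ¬ M.Adj i j →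
      BrauerRel M (.of (.r i) * .of (.r j)) (.of (.r j) * .of (.r i))
  | HCer (i j : I) : ¬ M.Adj i j →
      BrauerRel M (.of (.e i) * .of (.r j)) (.of (.r j) * .of (.e i))
  | HCee (i j : I) : ¬ M.Adj i j →
      BrauerRel M (.of (.e i) * .of (.e j)) (.of (.e j) * .of (.e i))
  | HNrrr (i j : I) : M.Adj i j →
      BrauerRel M (.of (.r i) * .of (.r j) * .of (.r i)) (.of (.r j) * .of (.r i) * .of (.r j))
  | HNrer (i j : I) : M.Adj i j →
      BrauerRel M (.of (.r j) * .of (.e i) * .of (.r j)) (.of (.r i) * .of (.e j) * .of (.r i))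
  | RNrre (i j : I) : M.Adj i j →
      BrauerRel M (.of (.r j) * .of (.r i) * .of (.e j)) (.of (.e i) * .of (.e j))

/-- The Brauer monoid `BrM(M)`. -/
abbrev BrM {I : Type*} (M : SimpleGraph I) : Type _ := PresentedMonoid (BrauerRel M)

/-- A generator, as an element of the Brauer monoid. -/
def gen {I : Type*} (M : SimpleGraph I) (x : Gen I) : BrM M := PresentedMonoid.of (BrauerRel M) x

/-- The Brauer algebra `Br(M) = ℤ[BrM(M)]`. -/
abbrev Br {I : Type*} (M : SimpleGraph I) : Type _ := MonoidAlgebra ℤ (BrM M)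

/-! ### The Coxeter group -/

open Classical in
/-- The simply laced Coxeter matrix of `M`. -/
def coxeterMatrix {I : Type*} (M : SimpleGraph I) : CoxeterMatrix I where
  M := Matrix.of fun i j => if i = j then 1 else if M.Adj i j then 3 else 2
  isSymm := by
    ext i j
    simp only [Matrix.transpose_apply, Matrix.of_apply, M.adj_comm j i, eq_comm (a := j)]
  diagonal i := by simp
  off_diagonal i j h := by
    simp only [Matrix.of_apply, if_neg h]
    split_ifs <;> decide

/-- The Coxeter group `W(M)`. -/
abbrev W {I : Type*} (M : SimpleGraph I) : Type _ := (coxeterMatrix M).Group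

/-- The simple reflection `r_i` of `W(M)`. -/
def s {I : Type*} (M : SimpleGraph I) (i : I) : W M := (coxeterMatrix M).toCoxeterSystem.simple i

lemma isLiftable_gen {I : Type*} (M : SimpleGraph I) :
    (coxeterMatrix M).IsLiftable fun i => gen M (.r i) := by
  have rel {a b : FreeMonoid (Gen I)} (h : BrauerRel M a b) :
      PresentedMonoid.mk (BrauerRel M) a = PresentedMonoid.mk (BrauerRel M) b :=
    PresentedMonoid.mk_eq_mk_of_rel h
  have sq (i : I) : gen M (.r i) * gen M (.r i) = 1 := rel (.RSrr i)
  intro i j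
  simp only [coxeterMatrix, Matrix.of_apply]
  split_ifs with h1 h2
  · subst h1
    simpa using sq i
  · have h : gen M (.r i) * gen M (.r j) * gen M (.r i)
        = gen M (.r j) * gen M (.r i) * gen M (.r j) := rel (.HNrrr i j h2)
    calc (gen M (.r i) * gen M (.r j)) ^ 3
        = (gen M (.r i) * gen M (.r j) * gen M (.r i)) *
          (gen M (.r j) * gen M (.r i) * gen M (.r j)) := by simp only [pow_succ, pow_zero,
            one_mul, mul_assoc]
      _ = gen M (.r i) * gen M (.r j) * (gen M (.r i) *
          gen M (.r i)) * gen M (.r j) * gen M (.r i) := by rw [← h]; simp only [mul_assoc]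
      _ = gen M (.r i) * (gen M (.r j) * gen M (.r j)) * gen M (.r i) := by
          rw [sq, mul_one]; simp only [mul_assoc]
      _ = 1 := by rw [sq, mul_one, sq]
  · have h : gen M (.r i) * gen M (.r j) = gen M (.r j) * gen M (.r i) := rel (.HCrr i j h2)
    calc (gen M (.r i) * gen M (.r j)) ^ 2
        = (gen M (.r i) * gen M (.r j)) * (gen M (.r i) * gen M (.r j)) := pow_two _
      _ = gen M (.r i) * (gen M (.r j) * gen M (.r j)) * gen M (.r i) := by
          nth_rewrite 2 [h]; simp only [mul_assoc]
      _ = 1 := by rw [sq, mul_one, sq]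

/-- The natural homomorphism `W(M) → BrM(M)`, sending the simple reflections to the `r_i`. -/
def ofW {I : Type*} (M : SimpleGraph I) : W M →* BrM M :=
  (coxeterMatrix M).toCoxeterSystem.lift ⟨fun i => gen M (.r i), isLiftable_gen M⟩

/-! ### Roots -/

/-- The root lattice; coordinates are taken with respect to the simple roots. -/
abbrev Lat (I : Type*) : Type _ := I → ℤ

open Classical in
/-- The Cartan matrix of `M`. -/
def cartan {I : Type*} (M : SimpleGraph I) : Matrix I I ℤ :=
  Matrix.of fun i j => if i = j then 2 else if M.Adj i j then -1 else 0

/-- The symmetric bilinear form on the root lattice, normalized by `(α, α) = 2` for roots. -/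
def form {I : Type*} [Fintype I] (M : SimpleGraph I) (x y : Lat I) : ℤ :=
  ∑ i, ∑ j, x i * cartan M i j * y j

open Classical in
/-- The simple root `α_i`. -/
def simpleRoot {I : Type*} (i : I) : Lat I := Pi.single i 1

/-- The linear map `x ↦ x - (x, β) β`; it is the reflection `r_β` if `β` is a root. -/
def refl {I : Type*} [Fintype I] (M : SimpleGraph I) (β : Lat I) : Module.End ℤ (Lat I) where
  toFun x := x - form M x β • β
  map_add' x y := by
    simp only [form, Pi.add_apply, add_mul, Finset.sum_add_distrib, add_smul]
    abel
  map_smul' c x := by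
    simp only [form, Pi.smul_apply, smul_eq_mul, mul_assoc, ← Finset.mul_sum, RingHom.id_apply,
      smul_sub, mul_smul]

lemma form_simpleRoot {I : Type*} [Fintype I] (M : SimpleGraph I) (i j : I) :
    form M (simpleRoot i) (simpleRoot j) = cartan M i j := by
  classical
  simp [form, simpleRoot, Pi.single_apply]

lemma refl_simpleRoot {I : Type*} [Fintype I] (M : SimpleGraph I) (i j : I) :
    refl M (simpleRoot i) (simpleRoot j) = simpleRoot j - cartan M j i • simpleRoot i := by
  rw [← form_simpleRoot]; rfl

lemma isLiftable_refl {I : Type*} [Fintype I] (M : SimpleGraph I) :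
    (coxeterMatrix M).IsLiftable fun i => refl M (simpleRoot i) := by
  classical
  have hd (i : I) : cartan M i i = 2 := by simp [cartan]
  have key (i : I) (x : Lat I) :
      refl M (simpleRoot i) x = x - form M x (simpleRoot i) • simpleRoot i := rfl
  intro i j
  refine LinearMap.ext fun x => ?_
  simp only [coxeterMatrix, Matrix.of_apply]
  split_ifs with h1 h2
  · subst h1
    simp only [pow_one, Module.End.mul_apply, key _ x, map_sub, map_smul, refl_simpleRoot, hd,
      Module.End.one_apply]
    module
  · have h3 : cartan M i j = -1 := by simp [cartan, h1, h2]
    have h4 : cartan M j i = -1 := by simp [cartan, Ne.symm h1, h2.symm]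
    simp only [pow_succ, pow_zero, one_mul, Module.End.mul_apply, key _ x, map_sub, map_smul,
      refl_simpleRoot, hd, h3, h4, Module.End.one_apply]
    module
  · have h3 : cartan M i j = 0 := by simp [cartan, h1, h2]
    have h4 : cartan M j i = 0 := by simp [cartan, Ne.symm h1, mt SimpleGraph.Adj.symm h2]
    simp only [pow_succ, pow_zero, one_mul, Module.End.mul_apply, key _ x, map_sub, map_smul,
      refl_simpleRoot, hd, h3, h4, Module.End.one_apply]
    module

/-- The reflection representation of `W(M)` on the root lattice. -/
def geom {I : Type*} [Fintype I] (M : SimpleGraph I) : W M →* Module.End ℤ (Lat I) :=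
  (coxeterMatrix M).toCoxeterSystem.lift ⟨fun i => refl M (simpleRoot i), isLiftable_refl M⟩

/-- Roots are the images of the simple roots under the Coxeter group. -/
def IsRoot {I : Type*} [Fintype I] (M : SimpleGraph I) (β : Lat I) : Prop :=
  ∃ (w : W M) (i : I), β = geom M w (simpleRoot i)

/-- Positive roots. -/
def IsPosRoot {I : Type*} [Fintype I] (M : SimpleGraph I) (β : Lat I) : Prop :=
  IsRoot M β ∧ 0 ≤ β

/-- The height of a root. -/
def height {I : Type*} [Fintype I] (β : Lat I) : ℤ := ∑ i, β i

/-- `t ∈ W(M)` is the reflection `r_β` with root `β`. -/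
def IsReflection {I : Type*} [Fintype I] (M : SimpleGraph I) (t : W M) (β : Lat I) : Prop :=
  ∃ (w : W M) (i : I), β = geom M w (simpleRoot i) ∧ t = w * s M i * w⁻¹

/-- `x` is orthogonal to all members of `B`. -/
def Perp {I : Type*} [Fintype I] (M : SimpleGraph I) (x : Lat I) (B : Set (Lat I)) : Prop :=
  ∀ β ∈ B, form M x β = 0

/-! ### Admissible sets -/

/-- Admissible sets of mutually orthogonal positive roots. -/
structure IsAdmissible {I : Type*} [Fintype I] (M : SimpleGraph I) (B : Set (Lat I)) : Prop where
  pos : ∀ β ∈ B, IsPosRoot M β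
  orth : ∀ β ∈ B, ∀ γ ∈ B, β ≠ γ → form M β γ = 0
  fourth : ∀ β₁ ∈ B, ∀ β₂ ∈ B, ∀ β₃ ∈ B, β₁ ≠ β₂ → β₁ ≠ β₃ → β₂ ≠ β₃ →
    ∀ α, IsRoot M α → |form M α β₁| = 1 → |form M α β₂| = 1 → |form M α β₃| = 1 →
      refl M α (refl M β₁ (refl M β₂ (refl M β₃ α))) ∈ B ∨
      -refl M α (refl M β₁ (refl M β₂ (refl M β₃ α))) ∈ B

/-- The collection `𝒜` of admissible sets. -/
abbrev Adm {I : Type*} [Fintype I] (M : SimpleGraph I) : Type _ :=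
  {B : Set (Lat I) // IsAdmissible M B}

/-- The admissible closure: the intersection of all admissible sets containing `X`. -/
def admClosure {I : Type*} [Fintype I] (M : SimpleGraph I) (X : Set (Lat I)) : Set (Lat I) :=
  {γ | ∀ Y, IsAdmissible M Y → X ⊆ Y → γ ∈ Y}

/-- The set `w B` of positive roots: the positive roots among the `± w β` with `β ∈ B`. -/
def act {I : Type*} [Fintype I] (M : SimpleGraph I) (w : W M) (B : Set (Lat I)) :
    Set (Lat I) :=
  {γ | IsPosRoot M γ ∧ ∃ β ∈ B, γ = geom M w β ∨ γ = -geom M w β}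

/-! ### The action on admissible sets -/

/-- `σ : BrM(M) → ℱ(𝒜)` is given on generators by the prescribed rules: `δ` acts trivially, `r_i`
acts as in the action of `W`, and `e_i B` is `B` if `α_i ∈ B`, the admissible closure of
`B ∪ {α_i}` if `α_i ⊥ B`, and `r_β r_i B` for every `β ∈ B` not orthogonal to `α_i`. -/
structure IsSigma {I : Type*} [Fintype I] (M : SimpleGraph I)
    (σ : BrM M →* Function.End (Adm M)) : Prop where
  delta : ∀ B : Adm M, σ (gen M .delta) B = B
  r : ∀ (i : I) (B : Adm M), (σ (gen M (.r i)) B).1 = act M (s M i) B.1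
  e_mem : ∀ (i : I) (B : Adm M), simpleRoot i ∈ B.1 → σ (gen M (.e i)) B = B
  e_perp : ∀ (i : I) (B : Adm M), Perp M (simpleRoot i) B.1 →
    (σ (gen M (.e i)) B).1 = admClosure M (B.1 ∪ {simpleRoot i})
  e_adj : ∀ (i : I) (B : Adm M), ∀ β ∈ B.1, form M (simpleRoot i) β ≠ 0 →
    ∀ t : W M, IsReflection M t β → (σ (gen M (.e i)) B).1 = act M (t * s M i) B.1

/-! ### Orbits and their highest elements -/

/-- The `W`-orbit of `X` in `𝒜`. -/
abbrev Orbit {I : Type*} [Fintype I] (M : SimpleGraph I) (X : Adm M) : Type _ :=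
  {B : Adm M // ∃ w : W M, B.1 = act M w X.1}

/-- `r_i` raises `B`: among the roots of `B` moved by `r_i`, one of minimal height is raised by
`r_i` (to `β + α_i`), and none of that height is lowered. -/
def Raises {I : Type*} [Fintype I] (M : SimpleGraph I) (i : I) (B : Set (Lat I)) : Prop :=
  ∃ β ∈ B, form M (simpleRoot i) β = -1 ∧
    ∀ γ ∈ B, form M (simpleRoot i) γ = 1 → height β < height γ

/-- The partial order on an orbit: it is generated by `B < r_i B` whenever `r_i` raises `B`. -/
def OrbitLE {I : Type*} [Fintype I] (M : SimpleGraph I) : Set (Lat I) → Set (Lat I) → Prop :=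
  Relation.ReflTransGen fun B B' => ∃ i : I, Raises M i B ∧ B' = act M (s M i) B

/-- `B₀` is the highest element of the orbit. -/
def IsHighest {I : Type*} [Fintype I] {M : SimpleGraph I} {X : Adm M} (B₀ : Orbit M X) : Prop :=
  ∀ B : Orbit M X, OrbitLE M B.1.1 B₀.1.1

/-- The subgroup `W(C)` of `W(M)` generated by the `r_i` with `i ∈ C`, where `C` is the set of nodes
`i` with `α_i ⊥ B₀`. -/
def WC {I : Type*} [Fintype I] (M : SimpleGraph I) (B₀ : Set (Lat I)) : Subgroup (W M) :=
  Subgroup.closure {x | ∃ i : I, Perp M (simpleRoot i) B₀ ∧ x = s M i}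

/-- The family `h_{B,i}` of elements of `W(C)`: it equals `1` if `α_i` is not orthogonal to `B`; if
`α_i ⊥ B` it is `r_i` for `B = B₀` and is determined downwards from `B₀` by
`h_{B,i} = h_{r_k B, i}` if `r_k B > B`, `k ≁ i` and `h_{B,i} = h_{r_i r_k B, k}` if `r_k B > B`,
`k ∼ i`. -/
structure IsH {I : Type*} [Fintype I] (M : SimpleGraph I) {X : Adm M} (B₀ : Orbit M X)
    (h : Orbit M X → I → WC M B₀.1.1) : Prop where
  top : ∀ i : I, Perp M (simpleRoot i) B₀.1.1 → (h B₀ i : W M) = s M i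
  not_perp : ∀ (B : Orbit M X) (i : I), ¬ Perp M (simpleRoot i) B.1.1 → h B i = 1
  not_adj : ∀ (B B' : Orbit M X) (i k : I), Perp M (simpleRoot i) B.1.1 → Raises M k B.1.1 →
    ¬ M.Adj k i → B'.1.1 = act M (s M k) B.1.1 → h B i = h B' i
  adj : ∀ (B B' : Orbit M X) (i k : I), Perp M (simpleRoot i) B.1.1 → Raises M k B.1.1 →
    M.Adj k i → B'.1.1 = act M (s M i * s M k) B.1.1 → h B i = h B' k

/-! ### The linear representations -/

/-- The coefficient ring `ℤ[δ^{±1}][W(C)]`. -/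
abbrev Coeff {I : Type*} [Fintype I] (M : SimpleGraph I) (B₀ : Set (Lat I)) : Type _ :=
  MonoidAlgebra ℤ[T;T⁻¹] (WC M B₀)

/-- The free right `ℤ[δ^{±1}][W(C)]`-module with basis indexed by the orbit. -/
abbrev V {I : Type*} [Fintype I] (M : SimpleGraph I) {X : Adm M} (B₀ : Orbit M X) : Type _ :=
  Orbit M X →₀ Coeff M B₀.1.1

/-- The basis vector `ξ_B`. -/
def xi {I : Type*} [Fintype I] (M : SimpleGraph I) {X : Adm M} (B₀ : Orbit M X) (B : Orbit M X) :
    V M B₀ := Finsupp.single B 1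

/-- An element of `W(C)` as a coefficient. -/
def coeffW {I : Type*} [Fintype I] (M : SimpleGraph I) (B₀ : Set (Lat I)) (w : WC M B₀) :
    Coeff M B₀ := MonoidAlgebra.of ℤ[T;T⁻¹] (WC M B₀) w

/-- The indeterminate `δ` as a coefficient. -/
def coeffDelta {I : Type*} [Fintype I] (M : SimpleGraph I) (B₀ : Set (Lat I)) : Coeff M B₀ :=
  MonoidAlgebra.single 1 (LaurentPolynomial.T 1)

/-- The algebra of endomorphisms of the right module `V`. -/
abbrev EndV {I : Type*} [Fintype I] (M : SimpleGraph I) {X : Adm M} (B₀ : Orbit M X) : Type _ :=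
  Module.End (Coeff M B₀.1.1)ᵐᵒᵖ (V M B₀)

/-- The linear representation `W → GL(V)` is given on the generators by
`r_i ξ_B = ξ_{r_i B} h_{B,i}`. -/
def IsWRep {I : Type*} [Fintype I] (M : SimpleGraph I) {X : Adm M} (B₀ : Orbit M X)
    (h : Orbit M X → I → WC M B₀.1.1)
    (ρW : W M →* LinearMap.GeneralLinearGroup (Coeff M B₀.1.1)ᵐᵒᵖ (V M B₀)) : Prop :=
  ∀ (B : Orbit M X) (i : I), ∃ B' : Orbit M X, B'.1.1 = act M (s M i) B.1.1 ∧
    (ρW (s M i) : EndV M B₀) (xi M B₀ B) = xi M B₀ B' <• coeffW M B₀.1.1 (h B i)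

/-- The representation `ρ` of the Brauer algebra extends `ρW`, the element `δ` acts by homothety,
and `e_i ξ_B` is `ξ_B δ` if `α_i ∈ B`, is `0` if `α_i ⊥ B`, and is `r_β r_i ξ_B` for every `β ∈ B`
with `|(α_i, β)| = 1`. -/
structure IsBrRep {I : Type*} [Fintype I] (M : SimpleGraph I) {X : Adm M} (B₀ : Orbit M X)
    (ρW : W M →* LinearMap.GeneralLinearGroup (Coeff M B₀.1.1)ᵐᵒᵖ (V M B₀))
    (ρ : Br M →+* EndV M B₀) : Prop where
  extends_W : ∀ w : W M, ρ (MonoidAlgebra.of ℤ (BrM M) (ofW M w)) = (ρW w : EndV M B₀)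
  delta : ∀ v : V M B₀,
    ρ (MonoidAlgebra.of ℤ (BrM M) (gen M .delta)) v = v <• coeffDelta M B₀.1.1
  e_mem : ∀ (i : I) (B : Orbit M X), simpleRoot i ∈ B.1.1 →
    ρ (MonoidAlgebra.of ℤ (BrM M) (gen M (.e i))) (xi M B₀ B) = xi M B₀ B <• coeffDelta M B₀.1.1
  e_perp : ∀ (i : I) (B : Orbit M X), Perp M (simpleRoot i) B.1.1 →
    ρ (MonoidAlgebra.of ℤ (BrM M) (gen M (.e i))) (xi M B₀ B) = 0
  e_adj : ∀ (i : I) (B : Orbit M X), ∀ β ∈ B.1.1, |form M (simpleRoot i) β| = 1 →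
    ∀ t : W M, IsReflection M t β →
      ρ (MonoidAlgebra.of ℤ (BrM M) (gen M (.e i))) (xi M B₀ B) =
        (ρW (t * s M i) : EndV M B₀) (xi M B₀ B)

end

end BrauerADE

namespace BrauerADE

open scoped LaurentPolynomial RightActions

noncomputable section

set_option linter.unusedSectionVars false

/-! ### The bilinear form -/

section Form

variable {I : Type*} [Fintype I] {M : SimpleGraph I}

/-! Type ADE enters only through positive definiteness of the form (`IsADE.posDef`). The roots are
then exactly the vectors of norm 2 in the root lattice Q, and they are finite in number.

Admissible sets are encoded by lattices. To B is attached L = ℤB + 2Q (`span2`), on which the form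
takes even values. A Bessel-type estimate shows that the roots of L are exactly ±B when B is
admissible (`IsAdmissible.pm_of_mem_span2`); conversely the positive roots of any lattice that
contains 2Q and has even products form an admissible set (`isAdmissible_rootsIn`). Modulo 2 the form
is alternating, L becomes an isotropic subspace, and e_i becomes L ↦ (L ∩ α_i^⊥) + ⟨α_i⟩ (`eLat`).
The three cases in the definition of e_i B are instances of this one formula. It is monotone and
W-equivariant, and the relations of the monoid become short lattice computations; this is part (i).

For the highest element, sets are compared at the lowest height where they differ (`Below`). Raising
is strictly increasing, hence terminates, and it is locally confluent (`step_confluent`): two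
raising nodes close up in a braid hexagon, in a commuting square, or have the same effect. Newman's
argument gives a unique terminal set above each B. A node either fixes B or joins B and r_k B by a
raising step, so this terminal set is constant on the orbit. The height comparisons rest on one
fact: if r_k raises β and lowers γ, both in B, then γ - β - α_k is a root (`form_gap`).

Following the recursion for h_{B,i} upwards turns the node i into a node j of C, and h_{B,i} = r_j
(`TopNode`). Diamonds of raising steps show that j does not depend on the path (`topVia_unique`) and
that adjacency of nodes is preserved (`TopNode.adj_iff`). This yields the cocycle identities
`hElt_mul_self`, `hElt_comm` and `hElt_braid`, which say that r_i ξ_B = ξ_{r_i B} h_{B,i} respects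
the Coxeter relations.

The crux for the Brauer algebra is that r_β r_i ξ_B is independent of β (`wRep_reflW_mul_xi_eq`). An
element w acts by ξ_B ↦ ξ_{wB} without scalar if it keeps positive all positive roots orthogonal to
B (`wRep_xi_of_preservesPos`). The element that compares two choices of β moves the roots orthogonal
to B by multiples of a vector v of norm 4 that it negates; some conjugate of v has coordinates of
both signs, and the corresponding conjugate of the element then preserves positivity. With
contractions defined for all roots, W-equivariance gives most relations formally; e_i e_j = e_j e_i
needs a parity argument (`eOp_simpleRoot_comm`). -/

lemma cartan_comm (i j : I) : cartan M i j = cartan M j i := by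
  rcases eq_or_ne i j with rfl | h
  · rfl
  · by_cases h' : M.Adj i j
    · simp [cartan, h, h.symm, h', h'.symm]
    · simp [cartan, h, h.symm, h', mt SimpleGraph.Adj.symm h']

lemma cartan_self (i : I) : cartan M i i = 2 := by simp [cartan]

lemma cartan_of_adj {i j : I} (h : M.Adj i j) : cartan M i j = -1 := by simp [cartan, h, h.ne]

lemma cartan_of_not_adj {i j : I} (hij : i ≠ j) (h : ¬ M.Adj i j) : cartan M i j = 0 := by
  simp [cartan, h, hij]

lemma cartan_nonpos {i j : I} (h : i ≠ j) : cartan M i j ≤ 0 := by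
  simp only [cartan, Matrix.of_apply, if_neg h]
  split_ifs <;> simp

lemma form_comm (x y : Lat I) : form M x y = form M y x := by
  unfold form
  rw [Finset.sum_comm]
  refine Finset.sum_congr rfl fun i _ => Finset.sum_congr rfl fun j _ => ?_
  rw [cartan_comm]; ring

lemma form_add_left (x y z : Lat I) : form M (x + y) z = form M x z + form M y z := by
  simp only [form, Pi.add_apply, add_mul, Finset.sum_add_distrib]

lemma form_add_right (x y z : Lat I) : form M x (y + z) = form M x y + form M x z := by
  simp only [form_comm x, form_add_left]

lemma form_smul_left (c : ℤ) (x y : Lat I) : form M (c • x) y = c * form M x y := by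
  simp only [form, Pi.smul_apply, smul_eq_mul, mul_assoc, ← Finset.mul_sum]

lemma form_smul_right (c : ℤ) (x y : Lat I) : form M x (c • y) = c * form M x y := by
  simp only [form_comm x, form_smul_left]

lemma form_neg_left (x y : Lat I) : form M (-x) y = -form M x y := by
  simpa using form_smul_left (M := M) (-1) x y

lemma form_neg_right (x y : Lat I) : form M x (-y) = -form M x y := by
  simp only [form_comm x, form_neg_left]

lemma form_sub_left (x y z : Lat I) : form M (x - y) z = form M x z - form M y z := by
  simp only [sub_eq_add_neg, form_add_left, form_neg_left]

lemma form_sub_right (x y z : Lat I) : form M x (y - z) = form M x y - form M x z := by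
  simp only [form_comm x, form_sub_left]

lemma form_zero_left (x : Lat I) : form M 0 x = 0 := by
  simpa using form_smul_left (M := M) 0 x x

lemma form_sum_left {ι : Type*} (s : Finset ι) (f : ι → Lat I) (y : Lat I) :
    form M (∑ i ∈ s, f i) y = ∑ i ∈ s, form M (f i) y := by
  classical
  induction s using Finset.induction_on with
  | empty => simp [form_zero_left]
  | insert a s ha ih => rw [Finset.sum_insert ha, Finset.sum_insert ha, form_add_left, ih]

lemma lat_eq_sum (x : Lat I) : x = ∑ i, x i • simpleRoot i := by
  classical
  ext j
  simp [Finset.sum_apply, simpleRoot, Pi.single_apply]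

/-- Cross terms occur twice and each simple root has norm 2. Evenness makes 2 the least norm of a
nonzero vector once the form is positive definite. -/
lemma even_form_self (x : Lat I) : Even (form M x x) := by
  rw [lat_eq_sum x]
  refine Finset.sum_induction _ (fun y => Even (form M y y)) (fun y z hy hz => ?_) ?_ fun i _ => ?_
  · simp only [form_add_left, form_add_right, form_comm z y]
    obtain ⟨a, ha⟩ := hy
    obtain ⟨b, hb⟩ := hz
    exact ⟨a + b + form M y z, by rw [ha, hb]; ring⟩
  · simp [form_zero_left]
  · rw [form_smul_left, form_smul_right, form_simpleRoot, cartan_self]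
    exact ⟨x i * x i, by ring⟩

lemma height_add (x y : Lat I) : height (x + y) = height x + height y := by
  simp [height, Finset.sum_add_distrib]

lemma height_neg (x : Lat I) : height (-x) = -height x := by simp [height]

lemma height_sub (x y : Lat I) : height (x - y) = height x - height y := by
  simp [height, Finset.sum_sub_distrib]

lemma height_smul (c : ℤ) (x : Lat I) : height (c • x) = c * height x := by
  simp [height, Finset.mul_sum]

lemma height_simpleRoot (i : I) : height (simpleRoot i) = 1 := by
  classical
  simp [height, simpleRoot, Pi.single_apply]

lemma simpleRoot_nonneg (i : I) : 0 ≤ simpleRoot i := by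
  classical
  intro j
  simp only [simpleRoot, Pi.single_apply]
  split_ifs <;> simp

lemma simpleRoot_injective : Function.Injective (simpleRoot (I := I)) := by
  classical
  intro i j h
  by_contra hij
  have := congrFun h i
  simp [simpleRoot, hij] at this

lemma simpleRoot_le {x : Lat I} (hx : 0 ≤ x) {i : I} (h : 0 < x i) : simpleRoot i ≤ x := by
  classical
  intro j
  rcases eq_or_ne j i with rfl | hj
  · simpa [simpleRoot] using Int.add_one_le_iff.mpr h
  · simpa [simpleRoot, Pi.single_apply, hj] using hx j

lemma height_nonneg {x : Lat I} (hx : 0 ≤ x) : 0 ≤ height x := Finset.sum_nonneg fun i _ => hx i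

lemma eq_zero_of_height_eq_zero {x : Lat I} (hx : 0 ≤ x) (h : height x = 0) : x = 0 := by
  ext i
  exact (Finset.sum_eq_zero_iff_of_nonneg fun i _ => hx i).mp h i (Finset.mem_univ i)

lemma form_self_eq_sum (x : Lat I) : form M x x = ∑ i, x i * form M (simpleRoot i) x := by
  conv_lhs => arg 2; rw [lat_eq_sum x]
  rw [form_sum_left]
  simp only [form_smul_left]

/-! ### The reflection representation -/

lemma refl_apply (β x : Lat I) : refl M β x = x - form M x β • β := rfl

lemma form_refl_refl {β : Lat I} (hβ : form M β β = 2) (x y : Lat I) :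
    form M (refl M β x) (refl M β y) = form M x y := by
  simp only [refl_apply, form_sub_left, form_sub_right, form_smul_left, form_smul_right, hβ,
    form_comm β]
  ring

lemma form_simpleRoot_self (i : I) : form M (simpleRoot i) (simpleRoot i) = 2 := by
  rw [form_simpleRoot, cartan_self]

lemma geom_s (i : I) : geom M (s M i) = refl M (simpleRoot i) :=
  (coxeterMatrix M).toCoxeterSystem.lift_apply_simple (isLiftable_refl M) i

lemma geom_s_apply (i : I) (x : Lat I) :
    geom M (s M i) x = x - form M x (simpleRoot i) • simpleRoot i := by
  rw [geom_s, refl_apply]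

lemma s_mul_s (i : I) : s M i * s M i = 1 :=
  (coxeterMatrix M).toCoxeterSystem.simple_mul_simple_self i

lemma s_inv (i : I) : (s M i)⁻¹ = s M i := inv_eq_of_mul_eq_one_right (s_mul_s i)

lemma s_mul_s_mul (i : I) (w : W M) : s M i * (s M i * w) = w := by
  rw [← mul_assoc, s_mul_s, one_mul]

lemma s_pow (i j : I) : (s M i * s M j) ^ (coxeterMatrix M i j) = 1 :=
  (coxeterMatrix M).toCoxeterSystem.simple_mul_simple_pow i j

lemma s_comm {i j : I} (h : ¬ M.Adj i j) : s M i * s M j = s M j * s M i := by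
  rcases eq_or_ne i j with rfl | hij
  · rfl
  have h2 := s_pow (M := M) i j
  have : coxeterMatrix M i j = 2 := by simp [coxeterMatrix, hij, h]
  rw [this, pow_two] at h2
  calc s M i * s M j = (s M i * s M j * (s M i * s M j)) * (s M j * s M i) := by
        simp only [mul_assoc, s_mul_s_mul, s_mul_s, mul_one]
    _ = _ := by rw [h2, one_mul]

lemma s_braid {i j : I} (h : M.Adj i j) :
    s M i * (s M j * s M i) = s M j * (s M i * s M j) := by
  have h2 := s_pow (M := M) i j
  have : coxeterMatrix M i j = 3 := by simp [coxeterMatrix, h, h.ne]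
  rw [this, pow_succ, pow_two] at h2
  calc s M i * (s M j * s M i)
      = (s M i * s M j * (s M i * s M j) * (s M i * s M j)) * (s M j * (s M i * s M j)) := by
        simp only [mul_assoc, s_mul_s_mul, s_mul_s, mul_one]
    _ = _ := by rw [h2, one_mul]

@[elab_as_elim]
lemma W_induction {p : W M → Prop} (w : W M) (one : p 1) (mul : ∀ w i, p w → p (s M i * w)) :
    p w :=
  (coxeterMatrix M).toCoxeterSystem.simple_induction_left w one fun w i h => mul w i h

lemma geom_mul_apply (w w' : W M) (x : Lat I) : geom M (w * w') x = geom M w (geom M w' x) := by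
  rw [map_mul]; rfl

lemma geom_one_apply (x : Lat I) : geom M 1 x = x := by rw [map_one]; rfl

lemma geom_inv_geom (w : W M) (x : Lat I) : geom M w⁻¹ (geom M w x) = x := by
  rw [← geom_mul_apply, inv_mul_cancel, geom_one_apply]

lemma geom_geom_inv (w : W M) (x : Lat I) : geom M w (geom M w⁻¹ x) = x := by
  rw [← geom_mul_apply, mul_inv_cancel, geom_one_apply]

lemma form_geom (w : W M) (x y : Lat I) : form M (geom M w x) (geom M w y) = form M x y := by
  induction w using W_induction with
  | one => simp
  | mul w i ih =>
    rw [geom_mul_apply, geom_mul_apply, geom_s, form_refl_refl (form_simpleRoot_self i), ih]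

lemma form_geom_left (w : W M) (x y : Lat I) : form M (geom M w x) y = form M x (geom M w⁻¹ y) := by
  rw [← form_geom w x, geom_geom_inv]

end Form

/-! ### Positive definiteness and roots -/

/-- The form of `M` is positive definite. -/
class PosDef {I : Type*} [Fintype I] (M : SimpleGraph I) : Prop where
  pos : ∀ x : Lat I, x ≠ 0 → 0 < form M x x

section Roots

variable {I : Type*} [Fintype I] {M : SimpleGraph I}

lemma IsRoot.form_self {β : Lat I} (h : IsRoot M β) : form M β β = 2 := by
  obtain ⟨w, i, rfl⟩ := h
  rw [form_geom, form_simpleRoot_self]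

lemma isRoot_simpleRoot (i : I) : IsRoot M (simpleRoot i) := ⟨1, i, by rw [geom_one_apply]⟩

lemma IsRoot.geom {β : Lat I} (h : IsRoot M β) (w : W M) : IsRoot M (geom M w β) := by
  obtain ⟨w', i, rfl⟩ := h
  exact ⟨w * w', i, by rw [geom_mul_apply]⟩

variable [PosDef M]

lemma form_self_nonneg (x : Lat I) : 0 ≤ form M x x := by
  rcases eq_or_ne x 0 with rfl | h
  · simp [form_zero_left]
  · exact (PosDef.pos x h).le

lemma eq_zero_of_form_self {x : Lat I} (h : form M x x = 0) : x = 0 := by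
  by_contra hx
  exact (PosDef.pos x hx).ne' h

lemma two_le_form_self {x : Lat I} (hx : x ≠ 0) : 2 ≤ form M x x := by
  obtain ⟨a, ha⟩ := even_form_self (M := M) x
  have := PosDef.pos (M := M) x hx
  omega

/-- A vector of norm `2` is nonnegative or nonpositive. -/
lemma nonneg_or_nonpos {x : Lat I} (hx : form M x x = 2) : 0 ≤ x ∨ x ≤ 0 := by
  -- Positive and negative parts have disjoint supports and off-diagonal Cartan entries are
  -- nonpositive, so (p, q) ≤ 0. If both parts were nonzero, the norm of p - q would be at least 2 +
  -- 2.
  set p : Lat I := fun i => max (x i) 0 with hp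
  set q : Lat I := fun i => max (-x i) 0 with hq
  have hpq : x = p - q := by
    ext i
    simp only [hp, hq, Pi.sub_apply]
    omega
  have h1 : form M p q ≤ 0 := by
    refine Finset.sum_nonpos fun i _ => Finset.sum_nonpos fun j _ => ?_
    have hpi : 0 ≤ p i := le_max_right _ _
    have hqj : 0 ≤ q j := le_max_right _ _
    rcases eq_or_ne i j with rfl | hij
    · have : p i = 0 ∨ q i = 0 := by
        simp only [hp, hq]
        omega
      rcases this with h | h <;> simp [h]
    · have := cartan_nonpos (M := M) hij
      exact mul_nonpos_of_nonpos_of_nonneg (mul_nonpos_of_nonneg_of_nonpos hpi this) hqj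
  by_cases hp0 : p = 0
  · right
    rw [hpq, hp0, zero_sub, neg_nonpos]
    exact fun i => le_max_right _ _
  by_cases hq0 : q = 0
  · left
    rw [hpq, hq0, sub_zero]
    exact fun i => le_max_right _ _
  have h2 := two_le_form_self (M := M) hp0
  have h3 := two_le_form_self (M := M) hq0
  rw [hpq] at hx
  simp only [form_sub_left, form_sub_right, form_comm q p] at hx
  omega

lemma height_pos {x : Lat I} (hx : form M x x = 2) (h : 0 ≤ x) : 0 < height x := by
  refine lt_of_le_of_ne (height_nonneg h) fun h0 => ?_
  rw [eq_zero_of_height_eq_zero h h0.symm, form_zero_left] at hx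
  omega

lemma nonneg_iff_height_pos {x : Lat I} (hx : form M x x = 2) : 0 ≤ x ↔ 0 < height x := by
  refine ⟨height_pos hx, fun h => ?_⟩
  rcases nonneg_or_nonpos hx with h' | h'
  · exact h'
  · have := height_nonneg (neg_nonneg.mpr h')
    rw [height_neg] at this
    omega

lemma height_ne_zero {x : Lat I} (hx : form M x x = 2) : height x ≠ 0 := by
  rcases nonneg_or_nonpos hx with h | h
  · exact (height_pos hx h).ne'
  · have h1 : form M (-x) (-x) = 2 := by rw [form_neg_left, form_neg_right, neg_neg, hx]
    have := height_pos h1 (neg_nonneg.mpr h)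
    rw [height_neg] at this
    omega

lemma form_le_two {x y : Lat I} (hx : form M x x = 2) (hy : form M y y = 2) : form M x y ≤ 2 := by
  have := form_self_nonneg (M := M) (x - y)
  simp only [form_sub_left, form_sub_right, form_comm y x] at this
  omega

lemma neg_two_le_form {x y : Lat I} (hx : form M x x = 2) (hy : form M y y = 2) :
    -2 ≤ form M x y := by
  have := form_self_nonneg (M := M) (x + y)
  simp only [form_add_left, form_add_right, form_comm y x] at this
  omega

lemma eq_of_form_eq_two {x y : Lat I} (hx : form M x x = 2) (hy : form M y y = 2)
    (h : form M x y = 2) : x = y := by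
  refine sub_eq_zero.mp (eq_zero_of_form_self (M := M) ?_)
  simp only [form_sub_left, form_sub_right, form_comm y x]
  omega

lemma eq_neg_of_form_eq_neg_two {x y : Lat I} (hx : form M x x = 2) (hy : form M y y = 2)
    (h : form M x y = -2) : x = -y := by
  refine eq_neg_of_add_eq_zero_left (eq_zero_of_form_self (M := M) ?_)
  simp only [form_add_left, form_add_right, form_comm y x]
  omega

/-- A nonnegative vector of norm `2` is simple or can be lowered by a simple root. -/
lemma exists_form_pos {x : Lat I} (hx : form M x x = 2) (h : 0 ≤ x) :
    ∃ i, 0 < x i ∧ (x = simpleRoot i ∨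
      form M (simpleRoot i) x = 1 ∧ form M (x - simpleRoot i) (x - simpleRoot i) = 2 ∧
        0 ≤ x - simpleRoot i) := by
  have : ∃ i, 0 < x i * form M (simpleRoot i) x := by
    by_contra! hn
    have := form_self_eq_sum (M := M) x
    have h2 : ∑ i, x i * form M (simpleRoot i) x ≤ 0 := Finset.sum_nonpos fun i _ => hn i
    omega
  obtain ⟨i, hi⟩ := this
  have hxi : 0 < x i := by
    refine lt_of_le_of_ne (h i) fun h0 => ?_
    rw [← h0] at hi
    simp at hi
  have hf : 0 < form M (simpleRoot i) x := by
    by_contra! hn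
    exact absurd (mul_nonpos_of_nonneg_of_nonpos hxi.le hn) (not_le.mpr hi)
  refine ⟨i, hxi, ?_⟩
  have := form_le_two (M := M) (form_simpleRoot_self i) hx
  rcases (show form M (simpleRoot i) x = 2 ∨ form M (simpleRoot i) x = 1 by omega) with h2 | h1
  · exact Or.inl (eq_of_form_eq_two (form_simpleRoot_self i) hx h2).symm
  · refine Or.inr ⟨h1, ?_, sub_nonneg.mpr (simpleRoot_le h hxi)⟩
    simp only [form_sub_left, form_sub_right, form_comm x, h1, hx, form_simpleRoot_self]
    norm_num

/-- Descent on height: a vector that is not simple has product 1 with some simple root, and the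
corresponding simple reflection lowers it. -/
lemma isRoot_of_nonneg (n : ℕ) : ∀ {x : Lat I}, form M x x = 2 → 0 ≤ x → height x ≤ n →
    IsRoot M x := by
  induction n with
  | zero =>
    intro x hx h hn
    have := height_pos hx h
    simp only [Nat.cast_zero] at hn
    omega
  | succ n ih =>
    intro x hx h hn
    obtain ⟨i, -, rfl | ⟨h1, h2, h3⟩⟩ := exists_form_pos hx h
    · exact isRoot_simpleRoot i
    · have := (ih h2 h3 (by rw [height_sub, height_simpleRoot]; push_cast at hn; omega)).geom
        (s M i)
      rwa [geom_s_apply, form_sub_left, form_simpleRoot_self, form_comm, h1,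
        show (1 : ℤ) - 2 = -1 by norm_num, neg_one_smul, sub_neg_eq_add, sub_add_cancel] at this

lemma isRoot_neg_simpleRoot (i : I) : IsRoot M (-simpleRoot i) :=
  ⟨s M i, i, by rw [geom_s_apply, form_simpleRoot_self]; module⟩

lemma IsRoot.neg {x : Lat I} (h : IsRoot M x) : IsRoot M (-x) := by
  obtain ⟨w, i, rfl⟩ := h
  rw [← map_neg]
  exact (isRoot_neg_simpleRoot i).geom w

/-- The roots are the vectors of norm `2`. -/
lemma isRoot_iff {x : Lat I} : IsRoot M x ↔ form M x x = 2 := by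
  refine ⟨IsRoot.form_self, fun hx => ?_⟩
  rcases nonneg_or_nonpos hx with h | h
  · exact isRoot_of_nonneg (height x).toNat hx h (Int.self_le_toNat _)
  · rw [← neg_neg x]
    refine (isRoot_of_nonneg (height (-x)).toNat ?_ (neg_nonneg.mpr h) (Int.self_le_toNat _)).neg
    rw [form_neg_left, form_neg_right, neg_neg, hx]

lemma isPosRoot_iff {x : Lat I} : IsPosRoot M x ↔ form M x x = 2 ∧ 0 ≤ x := by
  rw [IsPosRoot, isRoot_iff]

lemma IsPosRoot.form_self {x : Lat I} (h : IsPosRoot M x) : form M x x = 2 := h.1.form_self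

lemma isPosRoot_simpleRoot (i : I) : IsPosRoot M (simpleRoot i) :=
  ⟨isRoot_simpleRoot i, simpleRoot_nonneg i⟩

lemma IsPosRoot.height_pos {x : Lat I} (h : IsPosRoot M x) : 0 < height x :=
  BrauerADE.height_pos h.form_self h.2

lemma isPosRoot_or_neg {x : Lat I} (hx : IsRoot M x) : IsPosRoot M x ∨ IsPosRoot M (-x) := by
  rcases nonneg_or_nonpos hx.form_self with h | h
  · exact Or.inl ⟨hx, h⟩
  · exact Or.inr ⟨hx.neg, neg_nonneg.mpr h⟩

lemma IsPosRoot.not_neg {x : Lat I} (h : IsPosRoot M x) : ¬ IsPosRoot M (-x) := fun h' => by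
  have h1 := h.height_pos
  have h2 := h'.height_pos
  rw [height_neg] at h2
  omega

/-- Distinct positive roots whose inner product is even are orthogonal. -/
lemma IsPosRoot.form_eq_zero {x y : Lat I} (hx : IsPosRoot M x) (hy : IsPosRoot M y) (hxy : x ≠ y)
    (h : Even (form M x y)) : form M x y = 0 := by
  have h1 := form_le_two hx.form_self hy.form_self
  have h2 := neg_two_le_form hx.form_self hy.form_self
  obtain ⟨a, ha⟩ := h
  rcases (show form M x y = 2 ∨ form M x y = -2 ∨ form M x y = 0 by omega) with h | h | h
  · exact absurd (eq_of_form_eq_two hx.form_self hy.form_self h) hxy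
  · refine absurd hx ?_
    rw [eq_neg_of_form_eq_neg_two hx.form_self hy.form_self h]
    exact hy.not_neg
  · exact h

/-- A root of height one is simple. -/
lemma exists_eq_simpleRoot {x : Lat I} (hx : form M x x = 2) (h : height x = 1) :
    ∃ i, x = simpleRoot i := by
  have h0 : 0 ≤ x := (nonneg_iff_height_pos hx).mpr (by omega)
  obtain ⟨i, -, h' | ⟨-, h2, h3⟩⟩ := exists_form_pos hx h0
  · exact ⟨i, h'⟩
  · have := BrauerADE.height_pos h2 h3
    rw [height_sub, height_simpleRoot] at this
    omega

lemma form_simpleRoot_mem {i j : I} : form M (simpleRoot i) (simpleRoot j) = 2 ∧ i = j ∨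
    form M (simpleRoot i) (simpleRoot j) = 0 ∨ form M (simpleRoot i) (simpleRoot j) = -1 := by
  rw [form_simpleRoot]
  rcases eq_or_ne i j with rfl | h
  · exact Or.inl ⟨cartan_self i, rfl⟩
  · right
    simp only [cartan, Matrix.of_apply, if_neg h]
    split_ifs <;> simp

/-- Simple reflections preserve positivity of the roots other than their own. -/
lemma IsPosRoot.geom_s {x : Lat I} (hx : IsPosRoot M x) {i : I} (hi : x ≠ simpleRoot i) :
    IsPosRoot M (BrauerADE.geom M (s M i) x) := by
  refine (isPosRoot_or_neg (hx.1.geom (s M i))).resolve_right fun h => hi ?_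
  classical
  have h1 : ∀ j, j ≠ i → x j = 0 := fun j hj => by
    have h2 := h.2 j
    rw [geom_s_apply] at h2
    simp only [Pi.zero_apply, Pi.neg_apply, Pi.sub_apply, Pi.smul_apply, simpleRoot,
      Pi.single_apply, if_neg hj, smul_eq_mul, mul_zero, sub_zero] at h2
    have h3 := hx.2 j
    simp only [Pi.zero_apply] at h3
    omega
  have h4 : x = x i • simpleRoot i := by
    ext j
    rcases eq_or_ne j i with rfl | hj
    · simp [simpleRoot]
    · simp [simpleRoot, hj, h1 j hj]
  have h5 := hx.form_self
  rw [h4, form_smul_left, form_smul_right, form_simpleRoot_self] at h5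
  have h6 : 0 ≤ x i := hx.2 i
  have h7 : x i * x i = 1 := by linarith
  have h8 : x i = 1 := by nlinarith
  rw [h4, h8, one_smul]

/-- There are finitely many roots. -/
lemma finite_setOf_isRoot : {x : Lat I | IsRoot M x}.Finite := by
  classical
  -- Reduction modulo 2 is at most two-to-one on roots. If x = y + 2z, equality of norms gives (z,
  -- y) = -(z, z), so (x, y) = 2 - 2(z, z) is congruent to 2 modulo 4, hence ±2, and x = ±y.
  let f : Lat I → (I → ZMod 2) := fun x i => (x i : ZMod 2)
  refine Set.Finite.of_finite_fibers f (Set.toFinite _) fun v _ => ?_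
  rcases Set.eq_empty_or_nonempty ({x : Lat I | IsRoot M x} ∩ f ⁻¹' {v}) with h | ⟨y, hy, hyv⟩
  · rw [h]; exact Set.finite_empty
  · refine (Set.toFinite {y, -y}).subset ?_
    rintro x ⟨hx, hxv⟩
    have h2 : ∀ i, ∃ z, x i - y i = 2 * z := fun i => by
      have : ((x i - y i : ℤ) : ZMod 2) = 0 := by
        have := congrFun (hxv.trans hyv.symm : f x = f y) i
        push_cast
        exact sub_eq_zero.mpr this
      exact (ZMod.intCast_zmod_eq_zero_iff_dvd _ 2).mp this
    choose z hz using h2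
    have hxy : x = y + (2 : ℤ) • (z : Lat I) := by
      ext i
      have := hz i
      simp only [Pi.add_apply, Pi.smul_apply, smul_eq_mul]
      omega
    have h3 := hx.form_self
    have h4 := hy.form_self
    have h5 := even_form_self (M := M) z
    have h6 := form_le_two h3 h4
    have h7 := neg_two_le_form h3 h4
    have h8 : form M x y = 2 + 2 * form M z y := by
      rw [hxy, form_add_left, form_smul_left, h4]
    have h9 : form M x x = 2 + 4 * form M z y + 4 * form M z z := by
      rw [hxy]
      simp only [form_add_left, form_add_right, form_smul_left, form_smul_right, h4, form_comm y z]
      ring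
    obtain ⟨a, ha⟩ := h5
    rcases (show form M x y = 2 ∨ form M x y = -2 by omega) with h | h
    · exact Or.inl (eq_of_form_eq_two h3 h4 h)
    · exact Or.inr (eq_neg_of_form_eq_neg_two h3 h4 h)

end Roots

/-! ### Positive definiteness in types ADE -/

section ADE

variable {I : Type*} [Fintype I] {M : SimpleGraph I}

/-- Put x_i = u_i y_i. Since off-diagonal entries are nonpositive, 2 y_i y_j ≤ y_i² + y_j² bounds
the form below by the diagonal form Σ u_i (Cu)_i y_i², whose coefficients are positive. -/
lemma posDef_of_weights (u : I → ℤ) (hu : ∀ i, 0 < u i) (h : ∀ i, 0 < ∑ j, cartan M i j * u j) :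
    PosDef M := by
  refine ⟨fun x hx => ?_⟩
  have hu' : ∀ i, (0 : ℚ) < u i := fun i => by exact_mod_cast hu i
  set y : I → ℚ := fun i => x i / u i with hy
  have hxy : ∀ i, (x i : ℚ) = u i * y i := fun i => by
    simp only [hy]; rw [mul_div_cancel₀ _ (hu' i).ne']
  have key : ∀ i j, (cartan M i j : ℚ) * u i * u j * (y i ^ 2 + y j ^ 2) / 2
      ≤ x i * cartan M i j * x j := fun i j => by
    rw [hxy i, hxy j]
    rcases eq_or_ne i j with rfl | hij
    · exact le_of_eq (by ring)
    · have h1 : (cartan M i j : ℚ) ≤ 0 := by exact_mod_cast cartan_nonpos hij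
      have h2 : 0 ≤ -(cartan M i j : ℚ) * (u i * u j * (y i - y j) ^ 2) :=
        mul_nonneg (neg_nonneg.mpr h1)
          (mul_nonneg (mul_pos (hu' i) (hu' j)).le (sq_nonneg _))
      linarith
  have e1 : ∑ i, ∑ j, (cartan M i j : ℚ) * u i * u j * (y i ^ 2 + y j ^ 2) / 2
      = ∑ i, u i * y i ^ 2 * ∑ j, (cartan M i j : ℚ) * u j := by
    have e2 : ∑ i, ∑ j, (cartan M i j : ℚ) * u i * u j * y j ^ 2
        = ∑ i, ∑ j, (cartan M i j : ℚ) * u i * u j * y i ^ 2 := by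
      rw [Finset.sum_comm]
      refine Finset.sum_congr rfl fun i _ => Finset.sum_congr rfl fun j _ => ?_
      rw [cartan_comm]; ring
    have e3 : ∑ i, ∑ j, (cartan M i j : ℚ) * u i * u j * (y i ^ 2 + y j ^ 2) / 2
        = (∑ i, ∑ j, (cartan M i j : ℚ) * u i * u j * y i ^ 2) / 2
          + (∑ i, ∑ j, (cartan M i j : ℚ) * u i * u j * y j ^ 2) / 2 := by
      simp only [Finset.sum_div, ← Finset.sum_add_distrib]
      refine Finset.sum_congr rfl fun i _ => Finset.sum_congr rfl fun j _ => ?_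
      ring
    rw [e3, e2, add_halves]
    refine Finset.sum_congr rfl fun i _ => ?_
    rw [Finset.mul_sum]
    exact Finset.sum_congr rfl fun j _ => by ring
  have pos : 0 < ∑ i, (u i : ℚ) * y i ^ 2 * ∑ j, (cartan M i j : ℚ) * u j := by
    have h' : ∀ i, (0 : ℚ) < ∑ j, (cartan M i j : ℚ) * u j := fun i => by exact_mod_cast h i
    obtain ⟨i, hi⟩ := Function.ne_iff.mp hx
    refine Finset.sum_pos' (fun j _ => ?_) ⟨i, Finset.mem_univ i, ?_⟩
    · exact mul_nonneg (mul_nonneg (hu' j).le (sq_nonneg _)) (h' j).le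
    · have : y i ≠ 0 := div_ne_zero (by exact_mod_cast hi) (hu' i).ne'
      exact mul_pos (mul_pos (hu' i) (by positivity)) (h' i)
  have : (0 : ℚ) < ((form M x x : ℤ) : ℚ) := by
    refine pos.trans_le ?_
    rw [← e1]
    simp only [form]
    push_cast
    exact Finset.sum_le_sum fun i _ => Finset.sum_le_sum fun j _ => key i j
  exact_mod_cast this

open Classical in
/-- The nodes carry positive weights that are strictly superharmonic. -/
def HasWeights (M : SimpleGraph I) : Prop :=
  ∃ u : I → ℤ, (∀ i, 0 < u i) ∧ ∀ i, ∑ j, (if M.Adj i j then u j else 0) < 2 * u i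

lemma HasWeights.posDef (h : HasWeights M) : PosDef M := by
  classical
  obtain ⟨u, hu, h⟩ := h
  refine posDef_of_weights u hu fun i => ?_
  have : ∀ j, cartan M i j * u j
      = (if i = j then 2 * u j else 0) - if M.Adj i j then u j else 0 := fun j => by
    rcases eq_or_ne i j with rfl | hij
    · simp [cartan]
    · simp only [cartan, Matrix.of_apply, if_neg hij]
      split_ifs <;> ring
  simp only [this, Finset.sum_sub_distrib, Finset.sum_ite_eq, Finset.mem_univ, if_true]
  have := h i
  convert sub_pos.mpr this

lemma HasWeights.of_iso {J : Type*} [Fintype J] {N : SimpleGraph J} (e : M ≃g N)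
    (h : HasWeights N) : HasWeights M := by
  classical
  obtain ⟨u, hu, h⟩ := h
  refine ⟨fun i => u (e i), fun i => hu _, fun i => ?_⟩
  refine lt_of_eq_of_lt ?_ (h (e i))
  refine Fintype.sum_equiv e.toEquiv _ _ fun j => ?_
  have : M.Adj i j ↔ N.Adj (e i) (e j) := e.map_adj_iff.symm
  simp [this]

lemma hasWeights_dynkinGraph {n : ℕ} {A : Matrix (Fin n) (Fin n) ℤ} (u : Fin n → ℤ)
    (hu : ∀ i, 0 < u i)
    (h : ∀ i, ∑ j, (if i ≠ j ∧ (A i j ≠ 0 ∨ A j i ≠ 0) then u j else 0) < 2 * u i) :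
    HasWeights (dynkinGraph A) := by
  classical
  refine ⟨u, hu, fun i => ?_⟩
  convert h i using 4
  simp [dynkinGraph, SimpleGraph.fromRel_adj]

/-- For the infinite families the weights are a function U on ℤ. The set S may contain integers that
are not nodes, such as -1 or n; it is enough that U is nonnegative there. -/
lemma sum_neighbours_le {n : ℕ} (p : Fin n → Prop) [DecidablePred p] (U : ℤ → ℤ) (S : Finset ℤ)
    (hS : ∀ j, p j → ((j : ℕ) : ℤ) ∈ S) (hU : ∀ k ∈ S, 0 ≤ U k) :
    ∑ j, (if p j then U (j : ℕ) else 0) ≤ ∑ k ∈ S, U k := by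
  rw [← Finset.sum_filter]
  have hinj : Set.InjOn (fun j : Fin n => ((j : ℕ) : ℤ))
      (Finset.univ.filter p : Finset (Fin n)) := fun a _ b _ hab => by
    simpa [Fin.ext_iff] using hab
  rw [← Finset.sum_image (f := U) hinj]
  refine Finset.sum_le_sum_of_subset_of_nonneg (fun k hk => ?_) fun k hk _ => hU k hk
  obtain ⟨j, hj, rfl⟩ := Finset.mem_image.mp hk
  exact hS j (Finset.mem_filter.mp hj).2

/-- The weights are the coefficients of the sum of the positive roots. They are a concave quadratic
vanishing at -1 and n, so the missing neighbours of the end nodes contribute nothing. -/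
lemma hasWeights_A (n : ℕ) : HasWeights (dynkinGraph (CartanMatrix.A n)) := by
  refine hasWeights_dynkinGraph (fun i => ((i : ℕ) + 1) * (n - (i : ℕ))) (fun i => ?_)
    fun i => ?_
  · have := i.2
    exact mul_pos (by omega) (by omega)
  · refine (sum_neighbours_le _ (fun k => (k + 1) * (n - k)) {((i : ℕ) : ℤ) - 1, ((i : ℕ) : ℤ) + 1}
      (fun j hj => ?_) fun k hk => ?_).trans_lt ?_
    · obtain ⟨hij, h⟩ := hj
      have : (i : ℕ) + 1 = j ∨ (j : ℕ) + 1 = i := by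
        by_contra hn
        simp [CartanMatrix.A, hij, hij.symm] at h
        omega
      simp only [Finset.mem_insert, Finset.mem_singleton]
      omega
    · have := i.2
      simp only [Finset.mem_insert, Finset.mem_singleton] at hk
      exact mul_nonneg (by omega) (by omega)
    · rw [Finset.sum_pair (by omega)]
      linarith

lemma hasWeights_D {n : ℕ} (hn : 4 ≤ n) : HasWeights (dynkinGraph (CartanMatrix.D n)) := by
  -- Twice the coefficients of the sum of the positive roots of D_n. The last two nodes are the
  -- short ends of the fork and are attached to the node n - 3.
  set U : ℤ → ℤ := fun k => if k + 2 < n then 2 * ((k + 1) * (2 * n - k - 2)) else n * (n - 1)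
    with hU
  have hU0 : ∀ k : ℤ, -1 ≤ k → 0 ≤ U k := fun k hk => by
    simp only [hU]
    split_ifs with h
    · exact mul_nonneg (by norm_num) (mul_nonneg (by omega) (by omega))
    · exact mul_nonneg (by omega) (by omega)
  refine hasWeights_dynkinGraph (fun i => U (i : ℕ)) (fun i => ?_) fun i => ?_
  · simp only [hU]
    have := i.2
    split_ifs with h
    · exact mul_pos (by norm_num) (mul_pos (by omega) (by omega))
    · exact mul_pos (by omega) (by omega)
  have hi := i.2
  have adj : ∀ j : Fin n, i ≠ j ∧ (CartanMatrix.D n i j ≠ 0 ∨ CartanMatrix.D n j i ≠ 0) →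
      ((i : ℕ) + 1 = j ∧ (j : ℕ) + 2 < n) ∨ ((j : ℕ) + 1 = i ∧ (i : ℕ) + 2 < n) ∨
      ((i : ℕ) + 3 = n ∧ ((j : ℕ) + 2 = n ∨ (j : ℕ) + 1 = n)) ∨
      ((j : ℕ) + 3 = n ∧ ((i : ℕ) + 2 = n ∨ (i : ℕ) + 1 = n)) := fun j ⟨hij, h⟩ => by
    simp only [CartanMatrix.D, Matrix.of_apply, if_neg hij, if_neg hij.symm] at h
    split_ifs at h <;> omega
  rcases lt_trichotomy ((i : ℕ) + 3) n with h3 | h3 | h3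
  · refine (sum_neighbours_le _ U {((i : ℕ) : ℤ) - 1, ((i : ℕ) : ℤ) + 1}
      (fun j hj => ?_) fun k hk => ?_).trans_lt ?_
    · have := adj j hj
      simp only [Finset.mem_insert, Finset.mem_singleton]
      omega
    · simp only [Finset.mem_insert, Finset.mem_singleton] at hk
      exact hU0 k (by omega)
    · rw [Finset.sum_pair (by omega)]
      simp only [hU]
      rw [if_pos (by omega), if_pos (by omega), if_pos (by omega)]
      linarith
  · refine (sum_neighbours_le _ U {((i : ℕ) : ℤ) - 1, ((i : ℕ) : ℤ) + 1, ((i : ℕ) : ℤ) + 2}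
      (fun j hj => ?_) fun k hk => ?_).trans_lt ?_
    · have := adj j hj
      simp only [Finset.mem_insert, Finset.mem_singleton]
      omega
    · simp only [Finset.mem_insert, Finset.mem_singleton] at hk
      exact hU0 k (by omega)
    · have e : (n : ℤ) = (i : ℕ) + 3 := by omega
      rw [Finset.sum_insert (by simp; omega), Finset.sum_pair (by omega)]
      simp only [hU]
      rw [if_pos (by omega), if_neg (by omega), if_neg (by omega), if_pos (by omega), e]
      linarith
  · refine (sum_neighbours_le _ U {(n : ℤ) - 3}
      (fun j hj => ?_) fun k hk => ?_).trans_lt ?_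
    · have := adj j hj
      simp only [Finset.mem_singleton]
      omega
    · simp only [Finset.mem_singleton] at hk
      exact hU0 k (by omega)
    · rw [Finset.sum_singleton]
      simp only [hU]
      rw [if_pos (by omega), if_neg (by omega)]
      linarith

lemma IsADE.posDef (h : IsADE M) : PosDef M := by
  rcases h with ⟨n, -, ⟨e⟩⟩ | ⟨n, hn, ⟨e⟩⟩ | ⟨⟨e⟩⟩ | ⟨⟨e⟩⟩ | ⟨⟨e⟩⟩
  · exact ((hasWeights_A n).of_iso e).posDef
  · exact ((hasWeights_D hn).of_iso e).posDef
  -- In the exceptional types the weights are again the coefficients of the sum of the positive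
  -- roots, so Cu is constantly 2.
  · exact ((hasWeights_dynkinGraph ![16, 22, 30, 42, 30, 16] (by decide) (by decide)).of_iso
      e).posDef
  · exact ((hasWeights_dynkinGraph ![34, 49, 66, 96, 75, 52, 27] (by decide)
      (by decide)).of_iso e).posDef
  · exact ((hasWeights_dynkinGraph ![92, 136, 182, 270, 220, 168, 114, 58] (by decide)
      (by decide)).of_iso e).posDef

end ADE

/-! ### The reflection with a given root -/

section Reflections

variable {I : Type*} [Fintype I] {M : SimpleGraph I}

/-- The reflections of the positive roots, obtained by climbing from the simple roots. -/
inductive Climb (M : SimpleGraph I) : Lat I → W M → Prop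
  | base (i : I) : Climb M (simpleRoot i) (s M i)
  | step (k : I) (β : Lat I) (t : W M) : Climb M β t → form M (simpleRoot k) β = -1 →
      Climb M (β + simpleRoot k) (s M k * (t * s M k))

variable [PosDef M]

lemma Climb.isPosRoot {β : Lat I} {t : W M} (h : Climb M β t) : IsPosRoot M β := by
  induction h with
  | base i => exact isPosRoot_simpleRoot i
  | step k β t _ hk ih =>
    refine isPosRoot_iff.mpr ⟨?_, add_nonneg ih.2 (simpleRoot_nonneg k)⟩
    simp only [form_add_left, form_add_right, form_comm β, hk, form_simpleRoot_self, ih.form_self]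
    norm_num

lemma isPosRoot_sub {β : Lat I} (hβ : IsPosRoot M β) {k : I} (hk : form M (simpleRoot k) β = 1) :
    IsPosRoot M (β - simpleRoot k) := by
  have h := hβ.geom_s (i := k) (by rintro rfl; rw [form_simpleRoot_self] at hk; omega)
  rwa [geom_s_apply, form_comm, hk, one_smul] at h

lemma exists_lower {β : Lat I} (hβ : IsPosRoot M β) :
    (∃ i, β = simpleRoot i) ∨ ∃ k, form M (simpleRoot k) β = 1 := by
  obtain ⟨i, -, h | ⟨h, -⟩⟩ := exists_form_pos hβ.form_self hβ.2
  exacts [Or.inl ⟨i, h⟩, Or.inr ⟨i, h⟩]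

lemma Climb.step' {β : Lat I} {k : I} {t : W M} (h : Climb M (β - simpleRoot k) t)
    (hk : form M (simpleRoot k) β = 1) : Climb M β (s M k * (t * s M k)) := by
  have := Climb.step k _ t h (by rw [form_sub_right, form_simpleRoot_self, hk]; norm_num)
  rwa [sub_add_cancel] at this

lemma exists_climb_aux (n : ℕ) : ∀ β : Lat I, IsPosRoot M β → height β ≤ n → ∃ t, Climb M β t := by
  induction n with
  | zero =>
    intro β hβ hn
    have := hβ.height_pos
    simp only [Nat.cast_zero] at hn
    omega
  | succ n ih =>
    intro β hβ hn
    rcases exists_lower hβ with ⟨i, rfl⟩ | ⟨k, hk⟩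
    · exact ⟨_, .base i⟩
    · obtain ⟨t, ht⟩ := ih _ (isPosRoot_sub hβ hk)
        (by rw [height_sub, height_simpleRoot]; push_cast at hn; omega)
      exact ⟨_, ht.step' hk⟩

lemma exists_climb {β : Lat I} (hβ : IsPosRoot M β) : ∃ t, Climb M β t :=
  exists_climb_aux (height β).toNat β hβ (Int.self_le_toNat _)

lemma Climb.cases' {β : Lat I} {t : W M} (h : Climb M β t) :
    (∃ i, β = simpleRoot i ∧ t = s M i) ∨
      ∃ k t', form M (simpleRoot k) β = 1 ∧ Climb M (β - simpleRoot k) t' ∧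
        t = s M k * (t' * s M k) := by
  cases h with
  | base i => exact Or.inl ⟨i, rfl, rfl⟩
  | step k β t h hk =>
    refine Or.inr ⟨k, t, ?_, ?_, rfl⟩
    · rw [form_add_right, form_simpleRoot_self, hk]; norm_num
    · rwa [add_sub_cancel_right]

lemma Climb.of_simpleRoot {i : I} {t : W M} (h : Climb M (simpleRoot i) t) : t = s M i := by
  rcases h.cases' with ⟨j, hj, rfl⟩ | ⟨k, t', hk, -⟩
  · rw [simpleRoot_injective hj]
  · rcases form_simpleRoot_mem (M := M) (i := k) (j := i) with h | h | h <;> omega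

/-- This makes r_β well defined in the abstract Coxeter group without appeal to faithfulness of the
reflection representation. Two descents k and l from β are compared by induction on height: if k ∼ l
then β = α_k + α_l and the braid relation applies; otherwise both pass through β - α_k - α_l. -/
lemma climb_unique_aux (n : ℕ) : ∀ (β : Lat I) (t t' : W M), height β ≤ n → Climb M β t →
    Climb M β t' → t = t' := by
  induction n with
  | zero =>
    intro β t t' hn ht
    have := ht.isPosRoot.height_pos
    simp only [Nat.cast_zero] at hn
    omega
  | succ n ih =>
    intro β t t' hn ht ht'
    rcases ht.cases' with ⟨i, rfl, rfl⟩ | ⟨k, t1, hk, h1, rfl⟩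
    · exact ht'.of_simpleRoot.symm
    rcases ht'.cases' with ⟨i, rfl, rfl⟩ | ⟨l, t2, hl, h2, rfl⟩
    · exact ht.of_simpleRoot
    have hn' : ∀ j, height (β - simpleRoot j) ≤ n := fun j => by
      rw [height_sub, height_simpleRoot]; push_cast at hn; omega
    rcases eq_or_ne k l with rfl | hkl
    · rw [ih _ _ _ (hn' k) h1 h2]
    by_cases hadj : M.Adj k l
    · have hc : form M (simpleRoot k) (simpleRoot l) = -1 := by
        rw [form_simpleRoot, cartan_of_adj hadj]
      have e : β - simpleRoot k = simpleRoot l := by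
        refine eq_of_form_eq_two h1.isPosRoot.form_self (form_simpleRoot_self l) ?_
        rw [form_sub_left, form_comm, hl, hc]; norm_num
      have e' : β - simpleRoot l = simpleRoot k := by rw [← e]; abel
      rw [e] at h1
      rw [e'] at h2
      rw [h1.of_simpleRoot, h2.of_simpleRoot, s_braid hadj]
    · have hc : form M (simpleRoot k) (simpleRoot l) = 0 := by
        rw [form_simpleRoot, cartan_of_not_adj hkl hadj]
      have hl' : form M (simpleRoot l) (β - simpleRoot k) = 1 := by
        rw [form_sub_right, hl, form_comm, hc]; norm_num
      have hk' : form M (simpleRoot k) (β - simpleRoot l) = 1 := by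
        rw [form_sub_right, hk, hc]; norm_num
      obtain ⟨t3, h3⟩ := exists_climb (isPosRoot_sub h1.isPosRoot hl')
      have e1 := ih _ _ _ (hn' k) h1 (h3.step' hl')
      have h3' : Climb M (β - simpleRoot l - simpleRoot k) t3 := by rwa [sub_right_comm]
      have e2 := ih _ _ _ (hn' l) h2 (h3'.step' hk')
      have hcomm := s_comm (M := M) hadj
      calc s M k * (t1 * s M k) = s M k * s M l * (t3 * (s M l * s M k)) := by
            rw [e1]; simp only [mul_assoc]
        _ = s M l * s M k * (t3 * (s M k * s M l)) := by rw [hcomm]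
        _ = _ := by rw [e2]; simp only [mul_assoc]

lemma Climb.unique {β : Lat I} {t t' : W M} (h : Climb M β t) (h' : Climb M β t') : t = t' :=
  climb_unique_aux (height β).toNat β t t' (Int.self_le_toNat _) h h'

/-- Descend along l. If k ≁ l, then α_k stays orthogonal to β - α_l. If k ∼ l, one descends further
to β - α_l - α_k, which is orthogonal to α_l, and the braid relation turns commutation with r_l
there into commutation with r_k at β. -/
lemma climb_comm_aux (n : ℕ) : ∀ (β : Lat I) (t : W M) (k : I), height β ≤ n → Climb M β t →
    form M (simpleRoot k) β = 0 → s M k * (t * s M k) = t := by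
  induction n with
  | zero =>
    intro β t k hn ht
    have := ht.isPosRoot.height_pos
    simp only [Nat.cast_zero] at hn
    omega
  | succ n ih =>
    intro β t k hn ht hk
    rcases ht.cases' with ⟨i, rfl, rfl⟩ | ⟨l, t1, hl, h1, rfl⟩
    · have hki : ¬ M.Adj k i := fun h => by
        rw [form_simpleRoot, cartan_of_adj h] at hk; omega
      rw [← s_comm hki, s_mul_s_mul]
    have hn' : height (β - simpleRoot l) ≤ n := by
      rw [height_sub, height_simpleRoot]; push_cast at hn; omega
    have hkl : k ≠ l := by rintro rfl; omega
    by_cases hadj : M.Adj k l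
    · have hc : form M (simpleRoot k) (simpleRoot l) = -1 := by
        rw [form_simpleRoot, cartan_of_adj hadj]
      have hk' : form M (simpleRoot k) (β - simpleRoot l) = 1 := by
        rw [form_sub_right, hk, hc]; norm_num
      have hp := isPosRoot_sub h1.isPosRoot hk'
      obtain ⟨t2, h2⟩ := exists_climb hp
      have hl' : form M (simpleRoot l) (β - simpleRoot l - simpleRoot k) = 0 := by
        rw [form_sub_right, form_sub_right, hl, form_comm (simpleRoot l) (simpleRoot k), hc,
          form_simpleRoot_self]; norm_num
      have e := ih _ _ l (by rw [height_sub, height_simpleRoot]; omega) h2 hl'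
      have e1 := h1.unique (h2.step' hk')
      have hb := s_braid hadj
      calc s M k * (s M l * (t1 * s M l) * s M k)
          = s M k * (s M l * s M k) * (t2 * (s M k * (s M l * s M k))) := by
            rw [e1]; simp only [mul_assoc]
        _ = s M l * (s M k * (s M l * (t2 * s M l) * (s M k * s M l))) := by
            rw [hb]; simp only [mul_assoc]
        _ = _ := by rw [e, e1]; simp only [mul_assoc]
    · have hc : form M (simpleRoot k) (simpleRoot l) = 0 := by
        rw [form_simpleRoot, cartan_of_not_adj hkl hadj]
      have hk' : form M (simpleRoot k) (β - simpleRoot l) = 0 := by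
        rw [form_sub_right, hk, hc]; norm_num
      have e := ih _ _ k hn' h1 hk'
      have hcomm := s_comm (M := M) hadj
      calc s M k * (s M l * (t1 * s M l) * s M k)
          = (s M k * s M l) * (t1 * (s M l * s M k)) := by simp only [mul_assoc]
        _ = (s M l * s M k) * (t1 * (s M k * s M l)) := by rw [hcomm]
        _ = s M l * ((s M k * (t1 * s M k)) * s M l) := by simp only [mul_assoc]
        _ = _ := by rw [e]

lemma Climb.geom_s {β : Lat I} {t : W M} (h : Climb M β t) {k : I} (hk : β ≠ simpleRoot k) :
    Climb M (geom M (s M k) β) (s M k * (t * s M k)) := by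
  have hβ := h.isPosRoot
  rw [geom_s_apply, form_comm]
  have h1 := form_le_two (form_simpleRoot_self (M := M) k) hβ.form_self
  have h2 := neg_two_le_form (form_simpleRoot_self (M := M) k) hβ.form_self
  have h3 : form M (simpleRoot k) β ≠ 2 := fun h =>
    hk (eq_of_form_eq_two (form_simpleRoot_self k) hβ.form_self h).symm
  have h4 : form M (simpleRoot k) β ≠ -2 := fun h => by
    have := eq_neg_of_form_eq_neg_two (form_simpleRoot_self k) hβ.form_self h
    exact hβ.not_neg (this ▸ isPosRoot_simpleRoot k)
  rcases (show form M (simpleRoot k) β = 1 ∨ form M (simpleRoot k) β = 0 ∨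
    form M (simpleRoot k) β = -1 by omega) with h5 | h5 | h5
  · rw [h5, one_smul]
    obtain ⟨t', ht'⟩ := exists_climb (isPosRoot_sub hβ h5)
    rw [h.unique (ht'.step' h5)]
    simpa only [mul_assoc, s_mul_s_mul, s_mul_s, mul_one] using ht'
  · rw [h5, zero_smul, sub_zero,
      climb_comm_aux (height β).toNat β t k (Int.self_le_toNat _) h h5]
    exact h
  · rw [h5, neg_one_smul, sub_neg_eq_add]
    exact .step k β t h h5

/-- Links the two notions of reflection: a conjugate of a simple reflection is the element reached
by climbing to whichever of ± its root is positive. Uniqueness of climbing thus passes to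
`IsReflection`. -/
lemma climb_or_neg (w : W M) (i : I) :
    Climb M (geom M w (simpleRoot i)) (w * s M i * w⁻¹) ∨
      Climb M (-geom M w (simpleRoot i)) (w * s M i * w⁻¹) := by
  induction w using W_induction with
  | one => left; simpa [geom_one_apply] using Climb.base i
  | mul w k ih =>
    have e : s M k * w * s M i * (s M k * w)⁻¹ = s M k * (w * s M i * w⁻¹ * s M k) := by
      rw [mul_inv_rev, s_inv]; simp only [mul_assoc]
    rw [geom_mul_apply, e]
    rcases ih with ih | ih
    · by_cases hk : geom M w (simpleRoot i) = simpleRoot k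
      · right
        rw [hk] at ih ⊢
        rw [ih.of_simpleRoot, geom_s_apply, form_simpleRoot_self, ← mul_assoc, s_mul_s, one_mul]
        convert Climb.base (M := M) k using 1
        module
      · exact Or.inl (ih.geom_s hk)
    · by_cases hk : -geom M w (simpleRoot i) = simpleRoot k
      · left
        rw [hk] at ih
        rw [← neg_eq_iff_eq_neg.mpr hk.symm, ih.of_simpleRoot, map_neg, geom_s_apply,
          form_simpleRoot_self, ← mul_assoc, s_mul_s, one_mul]
        convert Climb.base (M := M) k using 1
        module
      · right
        rw [← map_neg]
        exact ih.geom_s hk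

lemma IsReflection.climb {t : W M} {β : Lat I} (h : IsReflection M t β) :
    Climb M β t ∨ Climb M (-β) t := by
  obtain ⟨w, i, rfl, rfl⟩ := h
  exact climb_or_neg w i

lemma Climb.unique_or {t t' : W M} {β : Lat I} (h : Climb M β t ∨ Climb M (-β) t)
    (h' : Climb M β t' ∨ Climb M (-β) t') : t = t' := by
  rcases h with h | h <;> rcases h' with h' | h'
  · exact h.unique h'
  · exact absurd h'.isPosRoot h.isPosRoot.not_neg
  · exact absurd h.isPosRoot h'.isPosRoot.not_neg
  · exact h.unique h'

lemma IsReflection.unique {t t' : W M} {β : Lat I} (h : IsReflection M t β)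
    (h' : IsReflection M t' β) : t = t' := Climb.unique_or h.climb h'.climb

open Classical in
/-- The reflection with root `β`. -/
def reflW (M : SimpleGraph I) (β : Lat I) : W M :=
  if h : ∃ t, IsReflection M t β then h.choose else 1

lemma isReflection_reflW {β : Lat I} (h : IsRoot M β) : IsReflection M (reflW M β) β := by
  obtain ⟨w, i, hw⟩ := h
  have h : ∃ t, IsReflection M t β := ⟨_, w, i, hw, rfl⟩
  rw [reflW, dif_pos h]
  exact h.choose_spec

lemma IsReflection.eq_reflW {t : W M} {β : Lat I} (h : IsReflection M t β) : t = reflW M β :=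
  h.unique (isReflection_reflW (by obtain ⟨w, i, h, -⟩ := h; exact ⟨w, i, h⟩))

lemma reflW_neg {β : Lat I} (h : IsRoot M β) : reflW M (-β) = reflW M β := by
  refine Climb.unique_or (β := -β) (isReflection_reflW h.neg).climb ?_
  rw [neg_neg]
  exact (isReflection_reflW h).climb.symm

lemma reflW_geom {β : Lat I} (h : IsRoot M β) (w : W M) :
    reflW M (geom M w β) = w * reflW M β * w⁻¹ := by
  obtain ⟨w', i, h1, h2⟩ := isReflection_reflW h
  refine (IsReflection.eq_reflW ⟨w * w', i, ?_, ?_⟩).symm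
  · conv_lhs => rw [h1]
    rw [geom_mul_apply]
  · rw [h2]; simp only [mul_assoc, mul_inv_rev]

lemma reflW_simpleRoot (i : I) : reflW M (simpleRoot i) = s M i :=
  (IsReflection.eq_reflW ⟨1, i, by rw [geom_one_apply], by simp⟩).symm

lemma reflW_mul_self {β : Lat I} (h : IsRoot M β) : reflW M β * reflW M β = 1 := by
  obtain ⟨w', i, -, h2⟩ := isReflection_reflW h
  rw [h2]
  calc w' * s M i * w'⁻¹ * (w' * s M i * w'⁻¹) = w' * (s M i * s M i) * w'⁻¹ := by group
    _ = 1 := by rw [s_mul_s]; group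

lemma reflW_inv {β : Lat I} (h : IsRoot M β) : (reflW M β)⁻¹ = reflW M β :=
  inv_eq_of_mul_eq_one_right (reflW_mul_self h)

lemma geom_reflW {β : Lat I} (h : IsRoot M β) (x : Lat I) :
    geom M (reflW M β) x = x - form M x β • β := by
  obtain ⟨w', i, h1, h2⟩ := isReflection_reflW h
  rw [h2, geom_mul_apply, geom_mul_apply, geom_s_apply, map_sub, map_smul, geom_geom_inv, ← h1,
    form_geom_left, inv_inv, ← h1]

end Reflections

/-! ### Admissible sets and their lattices -/

section Lattices

variable {I : Type*} [Fintype I] {M : SimpleGraph I}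

lemma form_sum_right {ι : Type*} (s : Finset ι) (f : ι → Lat I) (y : Lat I) :
    form M y (∑ i ∈ s, f i) = ∑ i ∈ s, form M y (f i) := by
  simp only [form_comm y, form_sum_left]

lemma form_multiset_sum_left (s : Multiset (Lat I)) (y : Lat I) :
    form M s.sum y = (s.map fun x => form M x y).sum := by
  induction s using Multiset.induction_on with
  | empty => simp [form_zero_left]
  | cons a s ih => simp [form_add_left, ih]

/-- `x` belongs to `B` up to sign. -/
def Pm (B : Set (Lat I)) (x : Lat I) : Prop := x ∈ B ∨ -x ∈ B

lemma Pm.neg {B : Set (Lat I)} {x : Lat I} (h : Pm B x) : Pm B (-x) := by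
  rcases h with h | h
  · exact Or.inr (by rwa [neg_neg])
  · exact Or.inl h

lemma mem_act {w : W M} {B : Set (Lat I)} {γ : Lat I} :
    γ ∈ act M w B ↔ IsPosRoot M γ ∧ Pm B (geom M w⁻¹ γ) := by
  refine and_congr_right fun _ => ⟨?_, ?_⟩
  · rintro ⟨β, hβ, rfl | rfl⟩
    · left; rwa [geom_inv_geom]
    · right; rwa [map_neg, neg_neg, geom_inv_geom]
  · rintro (h | h)
    · exact ⟨_, h, Or.inl (geom_geom_inv w γ).symm⟩
    · exact ⟨_, h, Or.inr (by rw [map_neg, neg_neg, geom_geom_inv])⟩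

/-- The expanded form of the fourth root lies visibly in the lattice spanned by the β's and 2Q,
which is what ties admissibility to lattices. -/
lemma refl_fourth {α β₁ β₂ β₃ : Lat I} (h12 : form M β₁ β₂ = 0) (h13 : form M β₁ β₃ = 0)
    (h23 : form M β₂ β₃ = 0) (hα : form M α α = 2) (c1 : |form M α β₁| = 1)
    (c2 : |form M α β₂| = 1) (c3 : |form M α β₃| = 1) :
    refl M α (refl M β₁ (refl M β₂ (refl M β₃ α))) =
      (2 : ℤ) • α - form M α β₁ • β₁ - form M α β₂ • β₂ - form M α β₃ • β₃ := by
  have sq {a : ℤ} (h : |a| = 1) : a * a = 1 := by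
    rcases abs_eq (by norm_num) |>.mp h with rfl | rfl <;> norm_num
  have e : refl M β₁ (refl M β₂ (refl M β₃ α)) =
      α - form M α β₁ • β₁ - form M α β₂ • β₂ - form M α β₃ • β₃ := by
    simp only [refl_apply, form_sub_left, form_smul_left, form_comm β₂ β₁, form_comm β₃ β₁,
      form_comm β₃ β₂, h12, h13, h23, mul_zero, sub_zero]
    abel
  have e2 : form M (α - form M α β₁ • β₁ - form M α β₂ • β₂ - form M α β₃ • β₃) α = -1 := by
    simp only [form_sub_left, form_smul_left, hα, form_comm β₁ α, form_comm β₂ α, form_comm β₃ α,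
      sq c1, sq c2, sq c3]
    norm_num
  rw [e, refl_apply, e2]
  module

/-- The lattice generated by `B` and twice the root lattice. -/
def span2 (B : Set (Lat I)) : Submodule ℤ (Lat I) :=
  Submodule.span ℤ (B ∪ Set.range fun x : Lat I => (2 : ℤ) • x)

lemma subset_span2 (B : Set (Lat I)) : B ⊆ span2 B :=
  Set.subset_union_left.trans Submodule.subset_span

lemma two_smul_mem_span2 (B : Set (Lat I)) (x : Lat I) : (2 : ℤ) • x ∈ span2 B :=
  Submodule.subset_span (Or.inr ⟨x, rfl⟩)

lemma span2_le {B : Set (Lat I)} {L : Submodule ℤ (Lat I)} :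
    span2 B ≤ L ↔ B ⊆ L ∧ ∀ x : Lat I, (2 : ℤ) • x ∈ L := by
  rw [span2, Submodule.span_le, Set.union_subset_iff, Set.range_subset_iff]
  rfl

lemma pm_mem_span2 {B : Set (Lat I)} {x : Lat I} (h : Pm B x) : x ∈ span2 B := by
  rcases h with h | h
  · exact subset_span2 B h
  · rw [← neg_neg x]
    exact neg_mem (subset_span2 B h)

lemma even_smul_mem {L : Submodule ℤ (Lat I)} (h2 : ∀ x : Lat I, (2 : ℤ) • x ∈ L) {c : ℤ}
    (hc : Even c) (x : Lat I) : c • x ∈ L := by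
  obtain ⟨a, rfl⟩ := hc
  rw [← two_mul, mul_smul]
  exact h2 _

/-- All inner products of `L` are even. -/
def EvenOn (M : SimpleGraph I) (L : Submodule ℤ (Lat I)) : Prop :=
  ∀ x ∈ L, ∀ y ∈ L, Even (form M x y)

/-- The vectors with even inner product with `α`. -/
def evenSub (M : SimpleGraph I) (α : Lat I) : Submodule ℤ (Lat I) where
  carrier := {x | Even (form M x α)}
  add_mem' {x y} hx hy := by
    simp only [Set.mem_ofPred_eq, form_add_left] at *
    exact hx.add hy
  zero_mem' := by simp [form_zero_left]
  smul_mem' c x hx := by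
    simp only [Set.mem_ofPred_eq, form_smul_left] at *
    exact hx.mul_left c

lemma mem_evenSub {α x : Lat I} : x ∈ evenSub M α ↔ Even (form M x α) := Iff.rfl

lemma two_smul_mem_evenSub (α x : Lat I) : (2 : ℤ) • x ∈ evenSub M α := by
  rw [mem_evenSub, form_smul_left]
  exact even_two.mul_right _

/-- The positive roots in `L`. -/
def rootsIn (M : SimpleGraph I) (L : Submodule ℤ (Lat I)) : Set (Lat I) :=
  {β | IsPosRoot M β ∧ β ∈ L}

/-! ### The roots in the lattice of an admissible set -/

variable [PosDef M]

/-- Write v as a sum of roots. Two summands with negative product either cancel or merge into one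
root, so the products between distinct entries may be assumed nonnegative. Any summand α then
satisfies (v, α) ≥ (α, α) = 2, and some summand has positive product with γ. -/
lemma exists_root_of_multiset (n : ℕ) : ∀ (s : Multiset (Lat I)) (v γ : Lat I), s.card ≤ n →
    (∀ x ∈ s, form M x x = 2) → s.sum = v → 1 ≤ form M v γ →
    ∃ α, form M α α = 2 ∧ 2 ≤ form M v α ∧ 1 ≤ form M α γ := by
  classical
  induction n with
  | zero =>
    intro s v γ hn _ hs h
    rw [Multiset.card_eq_zero.mp (Nat.le_zero.mp hn), Multiset.sum_zero] at hs
    rw [← hs, form_zero_left] at h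
    omega
  | succ n ih =>
    intro s v γ hn hs hsum h
    by_cases hneg : ∃ a ∈ s, ∃ b ∈ s.erase a, form M a b < 0
    · obtain ⟨a, ha, b, hb, hab⟩ := hneg
      have e1 := Multiset.cons_erase ha
      have e2 := Multiset.cons_erase hb
      have ha2 := hs a ha
      have hb2 := hs b (Multiset.mem_of_mem_erase hb)
      have hrest : ∀ x ∈ (s.erase a).erase b, form M x x = 2 := fun x hx =>
        hs x (Multiset.mem_of_mem_erase (Multiset.mem_of_mem_erase hx))
      have hc : s.card = ((s.erase a).erase b).card + 2 := by
        rw [← e1, ← e2]; simp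
      have hsum' : a + (b + ((s.erase a).erase b).sum) = v := by
        rw [← hsum, ← Multiset.sum_cons, e2, ← Multiset.sum_cons, e1]
      have hge := neg_two_le_form ha2 hb2
      rcases (show form M a b = -2 ∨ form M a b = -1 by omega) with h' | h'
      · refine ih ((s.erase a).erase b) v γ (by omega) hrest ?_ h
        rw [← hsum', eq_neg_of_form_eq_neg_two ha2 hb2 h', neg_add_cancel_left]
      · refine ih ((a + b) ::ₘ (s.erase a).erase b) v γ (by rw [Multiset.card_cons]; omega) ?_ ?_ h
        · intro x hx
          rcases Multiset.mem_cons.mp hx with rfl | hx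
          · simp only [form_add_left, form_add_right, form_comm b a, ha2, hb2, h']
            norm_num
          · exact hrest x hx
        · rw [Multiset.sum_cons, add_assoc, hsum']
    · push Not at hneg
      have : ∃ a ∈ s, 1 ≤ form M a γ := by
        by_contra! hc
        rw [← hsum, form_multiset_sum_left] at h
        have : (s.map fun x => form M x γ).sum ≤ 0 := by
          refine (Multiset.sum_le_card_nsmul _ 0 fun x hx => ?_).trans (by simp)
          obtain ⟨a, ha, rfl⟩ := Multiset.mem_map.mp hx
          have := hc a ha
          omega
        omega
      obtain ⟨a, ha, haγ⟩ := this
      refine ⟨a, hs a ha, ?_, haγ⟩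
      rw [← hsum, ← Multiset.cons_erase ha, Multiset.sum_cons, form_add_left, hs a ha,
        form_multiset_sum_left]
      have : 0 ≤ ((s.erase a).map fun x => form M x a).sum := by
        refine Multiset.sum_nonneg fun x hx => ?_
        obtain ⟨b, hb, rfl⟩ := Multiset.mem_map.mp hx
        rw [form_comm]
        exact hneg a ha b hb
      omega

lemma exists_multiset_roots (v : Lat I) :
    ∃ s : Multiset (Lat I), (∀ x ∈ s, form M x x = 2) ∧ s.sum = v := by
  have h : v ∈ AddSubmonoid.closure {x : Lat I | form M x x = 2} := by
    rw [lat_eq_sum v]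
    refine sum_mem fun i _ => ?_
    obtain ⟨n, hn | hn⟩ := Int.eq_nat_or_neg (v i)
    · rw [hn, natCast_zsmul]
      exact nsmul_mem (AddSubmonoid.subset_closure
        (show simpleRoot i ∈ {x : Lat I | form M x x = 2} from form_simpleRoot_self i)) n
    · rw [hn, neg_smul, natCast_zsmul, ← smul_neg]
      refine nsmul_mem (AddSubmonoid.subset_closure ?_) n
      simp only [Set.mem_ofPred_eq, form_neg_left, form_neg_right, neg_neg, form_simpleRoot_self]
  exact AddSubmonoid.exists_multiset_of_mem_closure h

lemma exists_root_two_le (v γ : Lat I) (h : 1 ≤ form M v γ) :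
    ∃ α, form M α α = 2 ∧ 2 ≤ form M v α ∧ 1 ≤ form M α γ := by
  obtain ⟨s, hs, hv⟩ := exists_multiset_roots (M := M) v
  exact exists_root_of_multiset s.card s v γ le_rfl hs hv h

lemma IsAdmissible.finite {B : Set (Lat I)} (hB : IsAdmissible M B) : B.Finite :=
  (finite_setOf_isRoot (M := M)).subset fun _ h => (hB.pos _ h).1

/-- Only the parities of the coefficients matter: even parts are absorbed into 2Q. -/
lemma exists_sum_of_mem_span2 {B : Finset (Lat I)} {x : Lat I} (hx : x ∈ span2 (B : Set (Lat I))) :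
    ∃ S ⊆ B, ∃ y, x = ∑ β ∈ S, β + (2 : ℤ) • y := by
  classical
  have : ∃ (n : Lat I → ℤ) (y : Lat I), x = ∑ β ∈ B, n β • β + (2 : ℤ) • y := by
    induction hx using Submodule.span_induction with
    | mem x h =>
      rcases h with h | ⟨y, rfl⟩
      · refine ⟨fun β => if β = x then 1 else 0, 0, ?_⟩
        simp only [ite_smul, one_smul, zero_smul, smul_zero, add_zero, Finset.sum_ite_eq', ]
        rw [if_pos (Finset.mem_coe.mp h)]
      · exact ⟨0, y, by simp⟩
    | zero => exact ⟨0, 0, by simp⟩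
    | add x y _ _ hx hy =>
      obtain ⟨n, z, rfl⟩ := hx
      obtain ⟨n', z', rfl⟩ := hy
      refine ⟨n + n', z + z', ?_⟩
      simp only [Pi.add_apply, add_smul, Finset.sum_add_distrib, smul_add]
      abel
    | smul c x _ hx =>
      obtain ⟨n, z, rfl⟩ := hx
      refine ⟨c • n, c • z, ?_⟩
      simp only [Pi.smul_apply, smul_add, Finset.smul_sum, smul_smul, smul_eq_mul, mul_comm c 2]
  obtain ⟨n, y, rfl⟩ := this
  refine ⟨B.filter fun β => Odd (n β), Finset.filter_subset _ _, y + ∑ β ∈ B, (n β / 2) • β, ?_⟩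
  rw [Finset.sum_filter, smul_add, Finset.smul_sum, add_left_comm, ← Finset.sum_add_distrib,
    add_comm]
  congr 1
  refine Finset.sum_congr rfl fun β _ => ?_
  rw [smul_smul]
  split_ifs with h
  · nth_rw 1 [← Int.two_mul_ediv_two_add_one_of_odd h]
    rw [add_smul, one_smul, add_comm]
  · rw [zero_add, Int.two_mul_ediv_two_of_even (Int.not_odd_iff_even.mp h)]

/-- The roots in the lattice of an admissible set belong to it. -/
lemma IsAdmissible.pm_of_mem_span2 {B : Set (Lat I)} (hB : IsAdmissible M B) {γ : Lat I}
    (hγ : IsRoot M γ) (h : γ ∈ span2 B) : Pm B γ := by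
  classical
  by_contra hn
  have hγ2 := hγ.form_self
  lift B to Finset (Lat I) using hB.finite
  obtain ⟨S, hS, y, hy⟩ := exists_sum_of_mem_span2 h
  have hB2 : ∀ β ∈ B, form M β β = 2 := fun β hβ => (hB.pos β hβ).form_self
  have hsum : ∀ β ∈ B, ∀ c : Lat I → ℤ, ∑ τ ∈ S, c τ * form M τ β = if β ∈ S then 2 * c β else 0 :=
    fun β hβ c => by
      rw [← Finset.sum_ite_eq' S β fun τ => 2 * c τ]
      refine Finset.sum_congr rfl fun τ hτ => ?_
      split_ifs with e
      · subst e; rw [hB2 _ hβ, mul_comm]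
      · rw [hB.orth _ (hS hτ) _ hβ e, mul_zero]
  -- The products of γ with B are even, so they are 0 or ±2, and ±2 would put γ or -γ in B.
  have orth : ∀ β ∈ B, form M γ β = 0 := fun β hβ => by
    have he : Even (form M γ β) := by
      rw [hy, form_add_left, form_sum_left, form_smul_left]
      have := hsum β hβ 1
      simp only [Pi.one_apply, one_mul, mul_one] at this
      rw [this]
      refine Even.add ?_ (even_two.mul_right _)
      split_ifs <;> simp
    have h1 := form_le_two hγ2 (hB2 β hβ)
    have h2 := neg_two_le_form hγ2 (hB2 β hβ)
    obtain ⟨a, ha⟩ := he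
    rcases (show form M γ β = 2 ∨ form M γ β = -2 ∨ form M γ β = 0 by omega) with h | h | h
    · exact absurd (Or.inl (by rw [eq_of_form_eq_two hγ2 (hB2 β hβ) h]; exact hβ)) hn
    · refine absurd (Or.inr ?_) hn
      rw [eq_neg_of_form_eq_neg_two hγ2 (hB2 β hβ) h, neg_neg]
      exact hβ
    · exact h
  -- The half sum (γ + Σ β)/2 lies in the root lattice. As γ is orthogonal to S, its product with γ
  -- is 1, so there is a root α with (v, α) ≥ 2 and (α, γ) ≥ 1.
  set v : Lat I := ∑ β ∈ S, β + y with hv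
  have hv2 : (2 : ℤ) • v = γ + ∑ β ∈ S, β := by rw [hv, hy]; module
  have hform : ∀ x, 2 * form M v x = form M γ x + ∑ β ∈ S, form M β x := fun x => by
    rw [← form_smul_left, hv2, form_add_left, form_sum_left]
  have hvγ : 1 ≤ form M v γ := by
    have := hform γ
    rw [hγ2, Finset.sum_eq_zero fun β hβ => by rw [form_comm, orth β (hS hβ)]] at this
    omega
  obtain ⟨α, hα, hvα, hαγ⟩ := exists_root_two_le v γ hvγ
  set c : Lat I → ℤ := fun β => form M α β with hc
  -- Bessel: z is twice the component of α orthogonal to γ and S, and its norm is 8 - 2 Σ c², where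
  -- c runs over the products of α with γ and the members of S.
  set z : Lat I := (2 : ℤ) • α - c γ • γ - ∑ β ∈ S, c β • β with hz
  have hzz : form M z z = 8 - 2 * (c γ * c γ) - 2 * ∑ β ∈ S, c β * c β := by
    have e1 : form M γ (∑ β ∈ S, c β • β) = 0 := by
      rw [form_sum_right]
      exact Finset.sum_eq_zero fun β hβ => by rw [form_smul_right, orth β (hS hβ), mul_zero]
    have e2 : form M α (∑ β ∈ S, c β • β) = ∑ β ∈ S, c β * c β := by
      rw [form_sum_right]
      exact Finset.sum_congr rfl fun β _ => form_smul_right _ _ _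
    have e3 : form M (∑ β ∈ S, c β • β) (∑ β ∈ S, c β • β) = 2 * ∑ β ∈ S, c β * c β := by
      rw [form_sum_right, Finset.mul_sum]
      refine Finset.sum_congr rfl fun β hβ => ?_
      rw [form_smul_right, form_sum_left]
      have := hsum β (hS hβ) c
      rw [if_pos hβ] at this
      simp only [form_smul_left]
      rw [this]; ring
    have e4 : form M α γ = c γ := rfl
    rw [hz]
    simp only [form_sub_left, form_sub_right, form_smul_left, form_smul_right,
      form_comm (∑ β ∈ S, c β • β) α, form_comm (∑ β ∈ S, c β • β) γ, form_comm γ α,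
      e1, e2, e3, e4, hα, hγ2]
    ring
  have hz0 := form_self_nonneg (M := M) z
  -- The products sum to at least 4 while their squares sum to at most 4. As c² ≥ c on integers,
  -- equality holds throughout: every product is 0 or 1, exactly four are 1, one of them is that
  -- with γ, and z = 0.
  have hfour : 4 ≤ c γ + ∑ β ∈ S, c β := by
    have := hform α
    have e : ∑ β ∈ S, form M β α = ∑ β ∈ S, c β :=
      Finset.sum_congr rfl fun β _ => form_comm _ _
    rw [e, form_comm γ α] at this
    change 2 * form M v α = c γ + ∑ β ∈ S, c β at this
    omega
  have hle : ∀ β, 0 ≤ c β * c β - c β := fun β => by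
    rcases le_or_gt (c β) 0 with h | h <;> nlinarith
  have hdiff : ∑ β ∈ S, (c β * c β - c β) = ∑ β ∈ S, c β * c β - ∑ β ∈ S, c β :=
    Finset.sum_sub_distrib _ _
  have hdiff0 : 0 ≤ ∑ β ∈ S, (c β * c β - c β) := Finset.sum_nonneg fun β _ => hle β
  have hγ' := hle γ
  have hcγ : c γ = 1 := by
    have : c γ * c γ - c γ = 0 := by omega
    have h1 : 1 ≤ c γ := hαγ
    nlinarith
  have hall : ∀ β ∈ S, c β * c β - c β = 0 :=
    (Finset.sum_eq_zero_iff_of_nonneg fun β _ => hle β).mp (by omega)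
  have h01 : ∀ β ∈ S, c β = 0 ∨ c β = 1 := fun β hβ => by
    have : c β * (c β - 1) = 0 := by linarith [hall β hβ]
    rcases mul_eq_zero.mp this with h | h
    · exact Or.inl h
    · exact Or.inr (by omega)
  have hS3 : ∑ β ∈ S, c β = 3 := by rw [hcγ] at hzz hfour; omega
  have hz' : z = 0 := eq_zero_of_form_self (M := M) (by rw [hcγ] at hzz; omega)
  have hfil : ∑ β ∈ S, c β • β = ∑ β ∈ S.filter (fun β => c β = 1), β := by
    rw [Finset.sum_filter]
    refine Finset.sum_congr rfl fun β hβ => ?_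
    rcases h01 β hβ with h | h <;> simp [h]
  have hcard : (S.filter (fun β => c β = 1)).card = 3 := by
    have : ∑ β ∈ S, c β = ∑ β ∈ S, if c β = 1 then 1 else 0 :=
      Finset.sum_congr rfl fun β hβ => by rcases h01 β hβ with h | h <;> simp [h]
    rw [hS3, Finset.sum_boole] at this
    exact_mod_cast this.symm
  obtain ⟨β₁, β₂, β₃, n12, n13, n23, hset⟩ := Finset.card_eq_three.mp hcard
  have hmem : ∀ β ∈ ({β₁, β₂, β₃} : Finset (Lat I)), β ∈ B ∧ form M α β = 1 := fun β hβ => by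
    rw [← hset] at hβ
    have := Finset.mem_filter.mp hβ
    exact ⟨hS this.1, this.2⟩
  obtain ⟨b1, a1⟩ := hmem β₁ (by simp)
  obtain ⟨b2, a2⟩ := hmem β₂ (by simp)
  obtain ⟨b3, a3⟩ := hmem β₃ (by simp)
  have hfour' := hB.fourth β₁ b1 β₂ b2 β₃ b3 n12 n13 n23 α (isRoot_iff.mpr hα) (by rw [a1]; rfl)
    (by rw [a2]; rfl) (by rw [a3]; rfl)
  -- The equation z = 0 reads γ = 2α - β₁ - β₂ - β₃, so γ is the fourth root attached to β₁, β₂, β₃.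
  have hγeq : γ = refl M α (refl M β₁ (refl M β₂ (refl M β₃ α))) := by
    rw [refl_fourth (hB.orth _ b1 _ b2 n12)
      (hB.orth _ b1 _ b3 n13) (hB.orth _ b2 _ b3 n23) hα (by rw [a1]; rfl) (by rw [a2]; rfl)
      (by rw [a3]; rfl), a1, a2, a3]
    have h3 : z = (2 : ℤ) • α - γ - (β₁ + (β₂ + β₃)) := by
      rw [hz, hfil, hset, hcγ, one_smul, Finset.sum_insert (by simp [n12, n13]),
        Finset.sum_pair n23]
    rw [h3] at hz'
    have : γ = (2 : ℤ) • α - (β₁ + (β₂ + β₃)) := by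
      rw [← sub_eq_zero, ← neg_eq_zero]
      rw [← hz']; abel
    rw [this]; module
  rw [← hγeq] at hfour'
  exact hn hfour'

lemma IsAdmissible.mem_of_mem_span2 {B : Set (Lat I)} (hB : IsAdmissible M B) {γ : Lat I}
    (hγ : IsPosRoot M γ) (h : γ ∈ span2 B) : γ ∈ B := by
  rcases hB.pm_of_mem_span2 hγ.1 h with h | h
  · exact h
  · exact absurd (hB.pos _ h) hγ.not_neg

lemma IsAdmissible.rootsIn_span2 {B : Set (Lat I)} (hB : IsAdmissible M B) :
    rootsIn M (span2 B) = B :=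
  Set.ext fun γ => ⟨fun h => hB.mem_of_mem_span2 h.1 h.2, fun h => ⟨hB.pos γ h, subset_span2 B h⟩⟩

lemma evenOn_span2 {B : Set (Lat I)} (hB : ∀ x ∈ B, ∀ y ∈ B, Even (form M x y)) :
    EvenOn M (span2 B) := by
  have h1 : ∀ x ∈ B, span2 B ≤ evenSub M x := fun x hx =>
    span2_le.mpr ⟨fun y hy => hB y hy x hx, fun y => two_smul_mem_evenSub x y⟩
  intro x hx y hy
  suffices h : span2 B ≤ evenSub M y from h hx
  refine span2_le.mpr ⟨fun z hz => ?_, fun z => two_smul_mem_evenSub y z⟩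
  rw [SetLike.mem_coe, mem_evenSub, form_comm]
  exact h1 z hz hy

lemma IsAdmissible.evenOn {B : Set (Lat I)} (hB : IsAdmissible M B) : EvenOn M (span2 B) :=
  evenOn_span2 fun x hx y hy => by
    rcases eq_or_ne x y with rfl | h
    · exact even_form_self x
    · rw [hB.orth x hx y hy h]; exact Even.zero

/-- The positive roots of a lattice with even inner products form an admissible set. -/
lemma isAdmissible_rootsIn {L : Submodule ℤ (Lat I)} (hL : EvenOn M L)
    (h2 : ∀ x : Lat I, (2 : ℤ) • x ∈ L) : IsAdmissible M (rootsIn M L) := by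
  have orth : ∀ β ∈ rootsIn M L, ∀ γ ∈ rootsIn M L, β ≠ γ → form M β γ = 0 :=
    fun β hβ γ hγ h => hβ.1.form_eq_zero hγ.1 h (hL β hβ.2 γ hγ.2)
  refine ⟨fun β h => h.1, orth, fun β₁ h1 β₂ h2' β₃ h3 n12 n13 n23 α hα c1 c2 c3 => ?_⟩
  have e := refl_fourth (orth _ h1 _ h2' n12)
    (orth _ h1 _ h3 n13) (orth _ h2' _ h3 n23) hα.form_self c1 c2 c3
  have hr : IsRoot M (refl M α (refl M β₁ (refl M β₂ (refl M β₃ α)))) := by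
    rw [isRoot_iff, form_refl_refl hα.form_self, form_refl_refl h1.1.form_self,
      form_refl_refl h2'.1.form_self, form_refl_refl h3.1.form_self, hα.form_self]
  have hmem : refl M α (refl M β₁ (refl M β₂ (refl M β₃ α))) ∈ L := by
    rw [e]
    exact sub_mem (sub_mem (sub_mem (h2 α) (L.smul_mem _ h1.2)) (L.smul_mem _ h2'.2))
      (L.smul_mem _ h3.2)
  exact (isPosRoot_or_neg hr).imp (fun h => ⟨h, hmem⟩) fun h => ⟨h, neg_mem hmem⟩

/-! ### The action of the Coxeter group on admissible sets -/

lemma pm_act {B : Set (Lat I)} (hB : ∀ β ∈ B, IsPosRoot M β) {w : W M} {x : Lat I} :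
    Pm (act M w B) x ↔ Pm B (geom M w⁻¹ x) := by
  constructor
  · rintro (h | h)
    · exact (mem_act.mp h).2
    · have := (mem_act.mp h).2.neg
      rwa [map_neg, neg_neg] at this
  · intro h
    have hr : IsRoot M x := by
      have : IsRoot M (geom M w⁻¹ x) := by
        rcases h with h | h
        · exact (hB _ h).1
        · simpa using (hB _ h).1.neg
      simpa [geom_geom_inv] using this.geom w
    rcases isPosRoot_or_neg hr with hp | hp
    · exact Or.inl (mem_act.mpr ⟨hp, h⟩)
    · exact Or.inr (mem_act.mpr ⟨hp, by rw [map_neg]; exact h.neg⟩)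

lemma act_act {B : Set (Lat I)} (hB : ∀ β ∈ B, IsPosRoot M β) (w w' : W M) :
    act M w (act M w' B) = act M (w * w') B := by
  ext γ
  rw [mem_act, mem_act, pm_act hB, mul_inv_rev, geom_mul_apply]

lemma act_one {B : Set (Lat I)} (hB : ∀ β ∈ B, IsPosRoot M β) : act M 1 B = B := by
  ext γ
  rw [mem_act, inv_one, geom_one_apply]
  refine ⟨fun h => ?_, fun h => ⟨hB γ h, Or.inl h⟩⟩
  exact h.2.resolve_right fun h' => h.1.not_neg (hB _ h')

lemma span2_act {B : Set (Lat I)} (hB : ∀ β ∈ B, IsPosRoot M β) (w : W M) :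
    span2 (act M w B) = (span2 B).map (geom M w) := by
  refine le_antisymm (span2_le.mpr ⟨fun γ hγ => ?_, fun x => ?_⟩) ?_
  · exact ⟨_, pm_mem_span2 (mem_act.mp hγ).2, geom_geom_inv w γ⟩
  · exact ⟨(2 : ℤ) • geom M w⁻¹ x, two_smul_mem_span2 _ _, by rw [map_smul, geom_geom_inv]⟩
  · rw [Submodule.map_le_iff_le_comap]
    refine span2_le.mpr ⟨fun β hβ => ?_, fun x => ?_⟩
    · exact pm_mem_span2 ((pm_act hB).mpr (by rw [geom_inv_geom]; exact Or.inl hβ))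
    · rw [Submodule.mem_comap, map_smul]
      exact two_smul_mem_span2 _ _

lemma IsAdmissible.act {B : Set (Lat I)} (hB : IsAdmissible M B) (w : W M) :
    IsAdmissible M (act M w B) := by
  have h : BrauerADE.act M w B = rootsIn M ((span2 B).map (geom M w)) := by
    ext γ
    rw [mem_act]
    refine and_congr_right fun hγ => ⟨fun h => ⟨_, pm_mem_span2 h, geom_geom_inv w γ⟩, ?_⟩
    rintro ⟨x, hx, rfl⟩
    rw [geom_inv_geom]
    refine hB.pm_of_mem_span2 ?_ hx
    simpa [geom_inv_geom] using hγ.1.geom w⁻¹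
  rw [h]
  refine isAdmissible_rootsIn ?_ fun x => ?_
  · rintro _ ⟨x, hx, rfl⟩ _ ⟨y, hy, rfl⟩
    rw [form_geom]
    exact hB.evenOn x hx y hy
  · exact ⟨(2 : ℤ) • geom M w⁻¹ x, two_smul_mem_span2 _ _, by rw [map_smul, geom_geom_inv]⟩

instance : MulAction (W M) (Adm M) where
  smul w B := ⟨act M w B.1, B.2.act w⟩
  one_smul B := Subtype.ext (act_one B.2.pos)
  mul_smul w w' B := Subtype.ext (act_act B.2.pos w w').symm

lemma smul_val (w : W M) (B : Adm M) : (w • B).1 = act M w B.1 := rfl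

lemma span2_smul (w : W M) (B : Adm M) : span2 (w • B).1 = (span2 B.1).map (geom M w) :=
  span2_act B.2.pos w

lemma pm_smul {w : W M} {B : Adm M} {x : Lat I} : Pm (w • B).1 x ↔ Pm B.1 (geom M w⁻¹ x) :=
  pm_act B.2.pos

/-- An admissible set is recovered from its lattice as the set of positive roots in it. Identities
between admissible sets are therefore proved on lattices. -/
lemma adm_ext {B B' : Adm M} (h : span2 B.1 = span2 B'.1) : B = B' :=
  Subtype.ext (by rw [← B.2.rootsIn_span2, h, B'.2.rootsIn_span2])

/-! ### The contraction by a root -/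

/-- The lattice `(L ∩ α^⊥) + ⟨α⟩`, where orthogonality is taken modulo `2`. -/
def eLat (M : SimpleGraph I) (α : Lat I) (L : Submodule ℤ (Lat I)) : Submodule ℤ (Lat I) :=
  (L ⊓ evenSub M α) ⊔ Submodule.span ℤ {α}

lemma mem_eLat {α x : Lat I} {L : Submodule ℤ (Lat I)} :
    x ∈ eLat M α L ↔ ∃ y ∈ L, Even (form M y α) ∧ ∃ c : ℤ, x = y + c • α := by
  simp only [eLat, Submodule.mem_sup, Submodule.mem_inf, mem_evenSub,
    Submodule.mem_span_singleton]
  constructor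
  · rintro ⟨y, ⟨hy, he⟩, _, ⟨c, rfl⟩, rfl⟩
    exact ⟨y, hy, he, c, rfl⟩
  · rintro ⟨y, hy, he, c, rfl⟩
    exact ⟨y, ⟨hy, he⟩, _, ⟨c, rfl⟩, rfl⟩

lemma self_mem_eLat (α : Lat I) (L : Submodule ℤ (Lat I)) : α ∈ eLat M α L :=
  (le_sup_right : _ ≤ eLat M α L) (Submodule.mem_span_singleton_self α)

lemma mem_eLat_of_mem {α x : Lat I} {L : Submodule ℤ (Lat I)} (hx : x ∈ L)
    (h : Even (form M x α)) : x ∈ eLat M α L := (le_sup_left : _ ≤ eLat M α L) ⟨hx, h⟩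

lemma two_smul_mem_eLat {L : Submodule ℤ (Lat I)} (h2 : ∀ x : Lat I, (2 : ℤ) • x ∈ L)
    (α x : Lat I) : (2 : ℤ) • x ∈ eLat M α L := mem_eLat_of_mem (h2 x) (two_smul_mem_evenSub α x)

lemma EvenOn.eLat {α : Lat I} {L : Submodule ℤ (Lat I)} (hL : EvenOn M L) :
    EvenOn M (eLat M α L) := by
  intro x hx y hy
  obtain ⟨z, hz, hzα, c, rfl⟩ := mem_eLat.mp hx
  obtain ⟨y, hw, hyα, d, rfl⟩ := mem_eLat.mp hy
  simp only [form_add_left, form_add_right, form_smul_left, form_smul_right]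
  rw [form_comm α y]
  exact ((hL z hz y hw).add (hyα.mul_left _)).add ((hzα.add ((even_form_self α).mul_left _)).mul_left _)

/-- The set `e_α B`. -/
def eAdm (M : SimpleGraph I) [PosDef M] (α : Lat I) (B : Adm M) : Adm M :=
  ⟨rootsIn M (eLat M α (span2 B.1)), isAdmissible_rootsIn B.2.evenOn.eLat fun x =>
    two_smul_mem_eLat (two_smul_mem_span2 _) α x⟩

lemma mem_eAdm {α γ : Lat I} {B : Adm M} :
    γ ∈ (eAdm M α B).1 ↔ IsPosRoot M γ ∧ γ ∈ eLat M α (span2 B.1) := Iff.rfl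

/-- With c = (α, β) odd, r_β preserves L, and r_α alters vectors of L ∩ α^⊥ (modulo 2) only by 2Q,
so r_α r_β maps L ∩ α^⊥ into L. It maps α to (c² - 1)α - cβ, also in L because c² - 1 is even. This
is the lattice form of e_α B = r_β r_α B. -/
lemma eLat_eq_map {L : Submodule ℤ (Lat I)} (hL : EvenOn M L) (h2 : ∀ x : Lat I, (2 : ℤ) • x ∈ L)
    {α β : Lat I} (hα : IsRoot M α) (hβ : IsRoot M β) (hβL : β ∈ L) (h : Odd (form M α β)) :
    eLat M α L = L.map (geom M (reflW M β * reflW M α)) := by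
  have hβα : Odd (form M β α) := by rwa [form_comm]
  apply le_antisymm
  · rw [eLat, sup_le_iff, Submodule.span_le, Set.singleton_subset_iff]
    constructor
    · rintro x ⟨hx, he⟩
      refine ⟨geom M (reflW M α * reflW M β) x, ?_, ?_⟩
      · rw [geom_mul_apply, geom_reflW hα, geom_reflW hβ]
        refine sub_mem (sub_mem hx (L.smul_mem _ hβL)) (even_smul_mem h2 ?_ _)
        rw [form_sub_left, form_smul_left]
        exact he.sub ((hL x hx β hβL).mul_right _)
      · rw [← geom_mul_apply, mul_assoc, ← mul_assoc (reflW M α), reflW_mul_self hα, one_mul,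
          reflW_mul_self hβ, geom_one_apply]
    · refine ⟨geom M (reflW M α * reflW M β) α, ?_, ?_⟩
      · rw [geom_mul_apply, geom_reflW hα, geom_reflW hβ, form_sub_left, form_smul_left,
          hα.form_self, form_comm β α]
        have : α - form M α β • β - (2 - form M α β * form M α β) • α
            = (form M α β * form M α β - 1) • α - form M α β • β := by module
        rw [this]
        exact sub_mem (even_smul_mem h2 ((h.mul h).sub_odd odd_one) _) (L.smul_mem _ hβL)
      · rw [← geom_mul_apply, mul_assoc, ← mul_assoc (reflW M α), reflW_mul_self hα, one_mul,
          reflW_mul_self hβ, geom_one_apply]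
  · rintro _ ⟨x, hx, rfl⟩
    rw [geom_mul_apply, geom_reflW hβ, geom_reflW hα, form_sub_left, form_smul_left]
    refine mem_eLat.mpr ⟨x - (form M x β - form M x α * form M α β) • β,
      sub_mem hx (L.smul_mem _ hβL), ?_, -form M x α, by module⟩
    rw [form_sub_left, form_smul_left, form_comm β α]
    have : form M x α - (form M x β - form M x α * form M α β) * form M α β
        = form M x α * (1 + form M α β * form M α β) - form M x β * form M α β := by ring
    rw [this]
    exact ((odd_one.add_odd (h.mul h)).mul_left _).sub ((hL x hx β hβL).mul_right _)

lemma eLat_of_mem {L : Submodule ℤ (Lat I)} (hL : EvenOn M L) {α : Lat I} (h : α ∈ L) :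
    eLat M α L = L := by
  refine le_antisymm ?_ fun x hx => mem_eLat_of_mem hx (hL x hx α h)
  rw [eLat, sup_le_iff, Submodule.span_le, Set.singleton_subset_iff]
  exact ⟨inf_le_left, h⟩

lemma exists_odd_of_not_even {B : Set (Lat I)} {α : Lat I}
    (h : ¬ ∀ β ∈ B, Even (form M α β)) : ∃ β ∈ B, Odd (form M α β) := by
  push Not at h
  obtain ⟨β, hβ, h⟩ := h
  exact ⟨β, hβ, Int.not_even_iff_odd.mp h⟩

lemma eAdm_of_odd {α β : Lat I} {B : Adm M} (hα : IsRoot M α) (hβ : β ∈ B.1)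
    (h : Odd (form M α β)) : eAdm M α B = (reflW M β * reflW M α) • B := by
  refine Subtype.ext ?_
  change rootsIn M (eLat M α (span2 B.1)) = _
  rw [eLat_eq_map B.2.evenOn (two_smul_mem_span2 _) hα (B.2.pos β hβ).1 (subset_span2 _ hβ) h,
    ← span2_smul]
  exact ((reflW M β * reflW M α) • B).2.rootsIn_span2

/-- The contracted lattice is generated by its own roots and 2Q, so that `adm_ext` applies to
contracted sets. If α has even products with B, the roots B and α suffice; otherwise the lattice is
a W-translate of that of B. -/
lemma span2_eAdm {α : Lat I} (hα : IsRoot M α) (B : Adm M) :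
    span2 (eAdm M α B).1 = eLat M α (span2 B.1) := by
  by_cases h : ∀ β ∈ B.1, Even (form M α β)
  · refine le_antisymm (span2_le.mpr ⟨fun x hx => (mem_eAdm.mp hx).2,
      fun x => two_smul_mem_eLat (two_smul_mem_span2 _) α x⟩) ?_
    rw [eLat, sup_le_iff, Submodule.span_le, Set.singleton_subset_iff]
    constructor
    · refine inf_le_left.trans (span2_le.mpr ⟨fun β hβ => ?_, two_smul_mem_span2 _⟩)
      exact subset_span2 _ (mem_eAdm.mpr ⟨B.2.pos β hβ, mem_eLat_of_mem (subset_span2 _ hβ)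
        (by rw [form_comm]; exact h β hβ)⟩)
    · have hmem : α ∈ eLat M α (span2 B.1) := self_mem_eLat α _
      have hpm : Pm (eAdm M α B).1 α := by
        rcases isPosRoot_or_neg hα with hp | hp
        · exact Or.inl (mem_eAdm.mpr ⟨hp, hmem⟩)
        · exact Or.inr (mem_eAdm.mpr ⟨hp, neg_mem hmem⟩)
      exact pm_mem_span2 hpm
  · obtain ⟨β, hβ, h⟩ := exists_odd_of_not_even h
    rw [eAdm_of_odd hα hβ h, span2_smul, eLat_eq_map B.2.evenOn (two_smul_mem_span2 _) hα
      (B.2.pos β hβ).1 (subset_span2 _ hβ) h]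

lemma eLat_map (w : W M) (α : Lat I) (L : Submodule ℤ (Lat I)) :
    eLat M (geom M w α) (L.map (geom M w)) = (eLat M α L).map (geom M w) := by
  ext x
  rw [mem_eLat]
  constructor
  · rintro ⟨_, ⟨y, hy, rfl⟩, he, c, rfl⟩
    rw [form_geom] at he
    exact ⟨y + c • α, mem_eLat.mpr ⟨y, hy, he, c, rfl⟩, by rw [map_add, map_smul]⟩
  · rintro ⟨z, hz, rfl⟩
    obtain ⟨y, hy, he, c, rfl⟩ := mem_eLat.mp hz
    exact ⟨_, ⟨y, hy, rfl⟩, by rwa [form_geom], c, by rw [map_add, map_smul]⟩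

lemma eLat_neg (α : Lat I) (L : Submodule ℤ (Lat I)) : eLat M (-α) L = eLat M α L := by
  have : evenSub M (-α) = evenSub M α := by
    ext x
    rw [mem_evenSub, mem_evenSub, form_neg_right, even_neg]
  rw [eLat, eLat, this, ← Set.neg_singleton, Submodule.span_neg]

/-- One inclusion suffices, since the hypothesis is symmetric in α and β. -/
lemma eLat_comm {α β : Lat I} (h : Even (form M α β)) (L : Submodule ℤ (Lat I)) :
    eLat M α (eLat M β L) ≤ eLat M β (eLat M α L) := by
  intro x hx
  obtain ⟨y, hy, he, c, rfl⟩ := mem_eLat.mp hx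
  obtain ⟨z, hz, hez, d, rfl⟩ := mem_eLat.mp hy
  rw [form_add_left, form_smul_left, form_comm β α] at he
  have he' : Even (form M z α) := by
    have := he.sub (h.mul_left d)
    rwa [add_sub_cancel_right] at this
  refine mem_eLat.mpr ⟨z + c • α, mem_eLat.mpr ⟨z, hz, he', c, rfl⟩, ?_, d, by abel⟩
  rw [form_add_left, form_smul_left]
  exact hez.add (h.mul_left c)

lemma eAdm_smul (w : W M) {α : Lat I} (hα : IsRoot M α) (B : Adm M) :
    eAdm M (geom M w α) (w • B) = w • eAdm M α B :=
  adm_ext (by rw [span2_eAdm (hα.geom w), span2_smul, span2_smul, span2_eAdm hα, eLat_map])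

lemma eAdm_neg {α : Lat I} (hα : IsRoot M α) (B : Adm M) : eAdm M (-α) B = eAdm M α B :=
  adm_ext (by rw [span2_eAdm hα.neg, span2_eAdm hα, eLat_neg])

lemma eAdm_of_pm {α : Lat I} (hα : IsRoot M α) {B : Adm M} (h : Pm B.1 α) : eAdm M α B = B :=
  adm_ext (by rw [span2_eAdm hα, eLat_of_mem B.2.evenOn (pm_mem_span2 h)])

lemma pm_eAdm {α : Lat I} (hα : IsRoot M α) (B : Adm M) : Pm (eAdm M α B).1 α :=
  (eAdm M α B).2.pm_of_mem_span2 hα (by rw [span2_eAdm hα]; exact self_mem_eLat α _)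

lemma eAdm_comm {α β : Lat I} (hα : IsRoot M α) (hβ : IsRoot M β) (h : form M α β = 0)
    (B : Adm M) : eAdm M α (eAdm M β B) = eAdm M β (eAdm M α B) := by
  refine adm_ext ?_
  rw [span2_eAdm hα, span2_eAdm hβ, span2_eAdm hβ, span2_eAdm hα]
  exact le_antisymm (eLat_comm (by rw [h]; exact Even.zero) _)
    (eLat_comm (by rw [form_comm, h]; exact Even.zero) _)

lemma eAdm_mono {α : Lat I} {B B' : Adm M} (h : B.1 ⊆ B'.1) :
    (eAdm M α B).1 ⊆ (eAdm M α B').1 := fun γ hγ => by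
  have hle : span2 B.1 ≤ span2 B'.1 :=
    span2_le.mpr ⟨h.trans (subset_span2 _), two_smul_mem_span2 _⟩
  obtain ⟨y, hy, he, c, hx⟩ := mem_eLat.mp hγ.2
  exact ⟨hγ.1, mem_eLat.mpr ⟨y, hle hy, he, c, hx⟩⟩

/-- Reflections in the elements of an admissible set stabilise it. -/
lemma reflW_smul_of_pm {β : Lat I} {B : Adm M} (hβ : IsRoot M β) (h : Pm B.1 β) :
    reflW M β • B = B := by
  refine adm_ext ?_
  have hle : (span2 B.1).map (geom M (reflW M β)) ≤ span2 B.1 := by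
    rintro _ ⟨x, hx, rfl⟩
    rw [geom_reflW hβ]
    exact sub_mem hx (Submodule.smul_mem _ _ (pm_mem_span2 h))
  rw [span2_smul]
  refine le_antisymm hle fun x hx => ?_
  refine ⟨geom M (reflW M β) x, hle ⟨x, hx, rfl⟩, ?_⟩
  rw [← geom_mul_apply, reflW_mul_self hβ, geom_one_apply]

lemma reflW_smul_of_perp {β : Lat I} {B : Adm M} (hβ : IsRoot M β) (h : Perp M β B.1) :
    reflW M β • B = B := by
  refine Subtype.ext (Set.ext fun γ => ?_)
  rw [smul_val, mem_act, reflW_inv hβ]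
  constructor
  · rintro ⟨hγ, hp⟩
    have : form M β γ = 0 := by
      have h0 : form M β (geom M (reflW M β) γ) = 0 := by
        rcases hp with hp | hp
        · exact h _ hp
        · rw [← neg_neg (geom M (reflW M β) γ), form_neg_right, h _ hp, neg_zero]
      rw [geom_reflW hβ, form_sub_right, form_smul_right, hβ.form_self, form_comm γ] at h0
      omega
    rw [geom_reflW hβ, form_comm, this, zero_smul, sub_zero] at hp
    exact hp.resolve_right fun h' => hγ.not_neg (B.2.pos _ h')
  · intro hγ
    refine ⟨B.2.pos γ hγ, Or.inl ?_⟩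
    rwa [geom_reflW hβ, form_comm, h γ hγ, zero_smul, sub_zero]

end Lattices

/-! ### The action of the Brauer monoid on admissible sets -/

section Sigma

variable {I : Type*} [Fintype I] {M : SimpleGraph I}

lemma gen_delta_central (x : Gen I) : gen M .delta * gen M x = gen M x * gen M .delta :=
  PresentedMonoid.mk_eq_mk_of_rel (BrauerRel.delta_central x)

lemma gen_delta_mul_inv : gen M .delta * gen M .deltaInv = 1 :=
  PresentedMonoid.mk_eq_mk_of_rel BrauerRel.delta_inv

/-- A map on generators that satisfies the defining relations extends to the Brauer monoid. -/
lemma exists_lift {N : Type*} [Monoid N] (f : Gen I → N)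
    (delta_central : ∀ x, f .delta * f x = f x * f .delta)
    (delta_inv : f .delta * f .deltaInv = 1)
    (rr : ∀ i, f (.r i) * f (.r i) = 1)
    (er : ∀ i, f (.e i) * f (.r i) = f (.e i))
    (re : ∀ i, f (.r i) * f (.e i) = f (.e i))
    (ee : ∀ i, f (.e i) * f (.e i) = f .delta * f (.e i))
    (crr : ∀ i j, ¬ M.Adj i j → f (.r i) * f (.r j) = f (.r j) * f (.r i))
    (cer : ∀ i j, ¬ M.Adj i j → f (.e i) * f (.r j) = f (.r j) * f (.e i))
    (cee : ∀ i j, ¬ M.Adj i j → f (.e i) * f (.e j) = f (.e j) * f (.e i))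
    (rrr : ∀ i j, M.Adj i j →
      f (.r i) * f (.r j) * f (.r i) = f (.r j) * f (.r i) * f (.r j))
    (rer : ∀ i j, M.Adj i j →
      f (.r j) * f (.e i) * f (.r j) = f (.r i) * f (.e j) * f (.r i))
    (rre : ∀ i j, M.Adj i j → f (.r j) * f (.r i) * f (.e j) = f (.e i) * f (.e j)) :
    ∃ φ : BrM M →* N, ∀ x, φ (gen M x) = f x := by
  refine ⟨PresentedMonoid.lift f fun a b h => ?_, fun x => PresentedMonoid.lift_of _ _⟩
  cases h <;> simp only [map_mul, map_one, FreeMonoid.lift_eval_of]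
  exacts [delta_central _, delta_inv, rr _, er _, re _, ee _, crr _ _ ‹_›, cer _ _ ‹_›,
    cee _ _ ‹_›, rrr _ _ ‹_›, rer _ _ ‹_›, rre _ _ ‹_›]

lemma brM_hom_ext {N : Type*} [Monoid N] {φ ψ : BrM M →* N}
    (h : ∀ x, φ (gen M x) = ψ (gen M x)) : φ = ψ :=
  PresentedMonoid.ext (BrauerRel M) h

@[elab_as_elim]
lemma BrM_induction {p : BrM M → Prop} (a : BrM M) (one : p 1)
    (mul : ∀ x a, p a → p (gen M x * a)) : p a := by
  have h : a ∈ Submonoid.closure (Set.range (gen M)) := by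
    have := PresentedMonoid.closure_range_of (BrauerRel M)
    rw [show gen M = PresentedMonoid.of (BrauerRel M) from rfl, this]
    trivial
  induction h using Submonoid.closure_induction_left with
  | one => exact one
  | mul_left x hx y _ ih =>
    obtain ⟨g, rfl⟩ := hx
    exact mul g y ih

/-- The image of δ⁻¹ is forced as the inverse of the image of δ, although the defining rules say
nothing about it. -/
lemma map_deltaInv_unique {N : Type*} [Monoid N] {φ ψ : BrM M →* N}
    (h : φ (gen M .delta) = ψ (gen M .delta)) : φ (gen M .deltaInv) = ψ (gen M .deltaInv) := by
  have h1 : φ (gen M .delta) * φ (gen M .deltaInv) = 1 := by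
    rw [← map_mul, gen_delta_mul_inv, map_one]
  have h2 : ψ (gen M .deltaInv) * φ (gen M .delta) = 1 := by
    rw [h, ← map_mul, ← gen_delta_central, gen_delta_mul_inv, map_one]
  exact (left_inv_eq_right_inv h2 h1).symm

variable [PosDef M]

lemma form_simpleRoot_cases {β : Lat I} (hβ : IsPosRoot M β) (i : I) :
    β = simpleRoot i ∨ form M (simpleRoot i) β = 1 ∨ form M (simpleRoot i) β = 0 ∨
      form M (simpleRoot i) β = -1 := by
  have h1 := form_le_two (form_simpleRoot_self (M := M) i) hβ.form_self
  have h2 := neg_two_le_form (form_simpleRoot_self (M := M) i) hβ.form_self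
  have h4 : form M (simpleRoot i) β ≠ -2 := fun h => by
    have := eq_neg_of_form_eq_neg_two (form_simpleRoot_self i) hβ.form_self h
    exact hβ.not_neg (this ▸ isPosRoot_simpleRoot i)
  by_cases h : form M (simpleRoot i) β = 2
  · exact Or.inl (eq_of_form_eq_two (form_simpleRoot_self i) hβ.form_self h).symm
  · omega

lemma simpleRoot_mem_or (i : I) (B : Adm M) : simpleRoot i ∈ B.1 ∨ Perp M (simpleRoot i) B.1 ∨
    ∃ β ∈ B.1, |form M (simpleRoot i) β| = 1 := by
  by_cases h : Perp M (simpleRoot i) B.1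
  · exact Or.inr (Or.inl h)
  · simp only [Perp] at h
    push Not at h
    obtain ⟨β, hβ, h⟩ := h
    rcases form_simpleRoot_cases (B.2.pos β hβ) i with rfl | h' | h' | h'
    · exact Or.inl hβ
    · exact Or.inr (Or.inr ⟨β, hβ, by rw [h']; rfl⟩)
    · exact absurd h' h
    · exact Or.inr (Or.inr ⟨β, hβ, by rw [h']; rfl⟩)

/-- An admissible Y containing B and α contains every positive root of its own lattice, and that
lattice contains the contracted one. -/
lemma eAdm_perp {α : Lat I} (hα : IsPosRoot M α) {B : Adm M} (h : Perp M α B.1) :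
    (eAdm M α B).1 = admClosure M (B.1 ∪ {α}) := by
  apply subset_antisymm
  · intro γ hγ Y hY hBY
    obtain ⟨y, hy, -, c, rfl⟩ := mem_eLat.mp (mem_eAdm.mp hγ).2
    have hle : span2 B.1 ≤ span2 Y :=
      span2_le.mpr ⟨(Set.subset_union_left.trans hBY).trans (subset_span2 _), two_smul_mem_span2 _⟩
    exact hY.mem_of_mem_span2 (mem_eAdm.mp hγ).1
      (add_mem (hle hy) (Submodule.smul_mem _ _ (subset_span2 _ (hBY (by simp)))))
  · intro γ hγ
    refine hγ _ (eAdm M α B).2 (Set.union_subset (fun β hβ => ?_) ?_)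
    · exact mem_eAdm.mpr ⟨B.2.pos β hβ, mem_eLat_of_mem (subset_span2 _ hβ)
        (by rw [form_comm, h β hβ]; exact Even.zero)⟩
    · rw [Set.singleton_subset_iff]
      exact mem_eAdm.mpr ⟨hα, self_mem_eLat α _⟩

/-- The action of the generators of the Brauer monoid on admissible sets. -/
def sigmaGen (M : SimpleGraph I) [PosDef M] : Gen I → Function.End (Adm M)
  | .r i => fun B => s M i • B
  | .e i => fun B => eAdm M (simpleRoot i) B
  | .delta => fun B => B
  | .deltaInv => fun B => B

lemma geom_s_of_adj {i j : I} (h : M.Adj i j) :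
    geom M (s M i) (simpleRoot j) = simpleRoot i + simpleRoot j := by
  rw [geom_s_apply, form_simpleRoot, cartan_of_adj h.symm]; module

lemma geom_s_of_not_adj {i j : I} (hij : i ≠ j) (h : ¬ M.Adj i j) :
    geom M (s M i) (simpleRoot j) = simpleRoot j := by
  rw [geom_s_apply, form_simpleRoot, cartan_comm, cartan_of_not_adj hij h]; module

lemma s_smul_of_pm {i : I} {B : Adm M} (h : Pm B.1 (simpleRoot i)) : s M i • B = B := by
  rw [← reflW_simpleRoot]
  exact reflW_smul_of_pm (isRoot_simpleRoot i) h

/-- Relations that mix r and e follow from W-equivariance of the contractions, together with the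
fact that α_i belongs to e_i B and hence r_i fixes e_i B. -/
lemma exists_isSigma_sigmaGen :
    ∃ σ : BrM M →* Function.End (Adm M), ∀ x, σ (gen M x) = sigmaGen M x := by
  have sr := isRoot_simpleRoot (M := M)
  have smul_e (i j : I) (B : Adm M) : s M j • eAdm M (simpleRoot i) B =
      eAdm M (geom M (s M j) (simpleRoot i)) (s M j • B) := (eAdm_smul _ (sr i) B).symm
  have re (i : I) (B : Adm M) : s M i • eAdm M (simpleRoot i) B = eAdm M (simpleRoot i) B :=
    s_smul_of_pm (pm_eAdm (sr i) B)
  refine exists_lift (sigmaGen M) (fun x => rfl) rfl (fun i => funext fun B => ?_)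
    (fun i => funext fun B => ?_) (fun i => funext fun B => re i B) (fun i => funext fun B => ?_)
    (fun i j h => funext fun B => ?_) (fun i j h => funext fun B => ?_)
    (fun i j h => funext fun B => ?_) (fun i j h => funext fun B => ?_)
    (fun i j h => funext fun B => ?_) (fun i j h => funext fun B => ?_)
  · change s M i • s M i • B = B
    rw [smul_smul, s_mul_s, one_smul]
  · change eAdm M (simpleRoot i) (s M i • B) = eAdm M (simpleRoot i) B
    have h := smul_e i i B
    rw [re, geom_s_apply, form_simpleRoot_self] at h
    rw [h, ← eAdm_neg (sr i)]
    congr 1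
    module
  · exact eAdm_of_pm (sr i) (pm_eAdm (sr i) B)
  · change s M i • s M j • B = s M j • s M i • B
    rw [smul_smul, smul_smul, s_comm h]
  · change eAdm M (simpleRoot i) (s M j • B) = s M j • eAdm M (simpleRoot i) B
    rcases eq_or_ne j i with rfl | hij
    · rw [smul_e, geom_s_apply, form_simpleRoot_self, ← eAdm_neg (sr j)]
      congr 1
      module
    · rw [smul_e, geom_s_of_not_adj hij (mt SimpleGraph.Adj.symm h)]
  · change eAdm M (simpleRoot i) (eAdm M (simpleRoot j) B)
      = eAdm M (simpleRoot j) (eAdm M (simpleRoot i) B)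
    rcases eq_or_ne i j with rfl | hij
    · rfl
    · exact eAdm_comm (sr i) (sr j) (by rw [form_simpleRoot, cartan_of_not_adj hij h]) B
  · change s M i • s M j • s M i • B = s M j • s M i • s M j • B
    rw [smul_smul, smul_smul, smul_smul, smul_smul, mul_assoc, mul_assoc, s_braid h]
  · change s M j • eAdm M (simpleRoot i) (s M j • B) = s M i • eAdm M (simpleRoot j) (s M i • B)
    rw [smul_e, smul_e, smul_smul, smul_smul, s_mul_s, s_mul_s, geom_s_of_adj h,
      geom_s_of_adj h.symm, add_comm]
  -- The root α_j lies in e_j B and has odd product with α_i, so on e_j B the contraction e_i is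
  -- given by r_j r_i.
  · change s M j • s M i • eAdm M (simpleRoot j) B
      = eAdm M (simpleRoot i) (eAdm M (simpleRoot j) B)
    set E := eAdm M (simpleRoot j) B with hE
    have hj : simpleRoot j ∈ E.1 := by
      refine (pm_eAdm (sr j) B).resolve_right fun h' => ?_
      exact (isPosRoot_simpleRoot j).not_neg (E.2.pos _ h')
    rw [eAdm_of_odd (sr i) hj (by rw [form_simpleRoot, cartan_of_adj h]; decide),
      reflW_simpleRoot, reflW_simpleRoot, smul_smul]

lemma isSigma_of_gen {σ : BrM M →* Function.End (Adm M)}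
    (h : ∀ x, σ (gen M x) = sigmaGen M x) : IsSigma M σ where
  delta B := by rw [h]; rfl
  r i B := by rw [h]; rfl
  e_mem i B hi := by rw [h]; exact eAdm_of_pm (isRoot_simpleRoot i) (Or.inl hi)
  e_perp i B hi := by rw [h]; exact eAdm_perp (isPosRoot_simpleRoot i) hi
  e_adj i B β hβ hne t ht := by
    rw [h, ht.eq_reflW, ← smul_val, ← reflW_simpleRoot i]
    change (eAdm M (simpleRoot i) B).1 = _
    rcases form_simpleRoot_cases (B.2.pos β hβ) i with rfl | h' | h' | h'
    · rw [reflW_simpleRoot, s_mul_s, one_smul, eAdm_of_pm (isRoot_simpleRoot i) (Or.inl hβ)]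
    · rw [eAdm_of_odd (isRoot_simpleRoot i) hβ (by rw [h']; decide)]
    · exact absurd h' hne
    · rw [eAdm_of_odd (isRoot_simpleRoot i) hβ (by rw [h']; decide)]

lemma IsSigma.gen_eq {σ : BrM M →* Function.End (Adm M)} (h : IsSigma M σ) (x : Gen I) :
    σ (gen M x) = sigmaGen M x := by
  obtain ⟨τ, hτ⟩ := exists_isSigma_sigmaGen (M := M)
  have hτ' := isSigma_of_gen hτ
  rw [← hτ]
  have hδ : σ (gen M .delta) = τ (gen M .delta) :=
    funext fun B => (h.delta B).trans (hτ'.delta B).symm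
  cases x with
  | r i => exact funext fun B => Subtype.ext ((h.r i B).trans (hτ'.r i B).symm)
  | e i =>
    refine funext fun B => ?_
    rcases simpleRoot_mem_or i B with hi | hi | ⟨β, hβ, hi⟩
    · exact (h.e_mem i B hi).trans (hτ'.e_mem i B hi).symm
    · exact Subtype.ext ((h.e_perp i B hi).trans (hτ'.e_perp i B hi).symm)
    · have hne : form M (simpleRoot i) β ≠ 0 := fun h0 => by rw [h0] at hi; simp at hi
      have ht := isReflection_reflW (B.2.pos β hβ).1
      exact Subtype.ext ((h.e_adj i B β hβ hne _ ht).trans (hτ'.e_adj i B β hβ hne _ ht).symm)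
  | delta => exact hδ
  | deltaInv => exact map_deltaInv_unique hδ

lemma existsUnique_isSigma : ∃! σ : BrM M →* Function.End (Adm M), IsSigma M σ := by
  obtain ⟨τ, hτ⟩ := exists_isSigma_sigmaGen (M := M)
  exact ⟨τ, isSigma_of_gen hτ, fun σ hσ => brM_hom_ext fun x => by rw [hσ.gen_eq, hτ]⟩

lemma IsSigma.mono {σ : BrM M →* Function.End (Adm M)} (h : IsSigma M σ) (a : BrM M)
    (Y X : Adm M) (hYX : Y.1 ⊆ X.1) : (σ a Y).1 ⊆ (σ a X).1 := by
  induction a using BrM_induction with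
  | one => rwa [map_one]
  | mul x a ih =>
    rw [map_mul, h.gen_eq]
    change (sigmaGen M x (σ a Y)).1 ⊆ (sigmaGen M x (σ a X)).1
    cases x with
    | r i => exact fun γ hγ => mem_act.mpr ⟨(mem_act.mp hγ).1, (mem_act.mp hγ).2.imp (@ih _) (@ih _)⟩
    | e i => exact eAdm_mono ih
    | delta => exact ih
    | deltaInv => exact ih

end Sigma

/-! ### Raising admissible sets -/

section Raising

variable {I : Type*} [Fintype I] {M : SimpleGraph I}

lemma form_simpleRoot_of_adj {i j : I} (h : M.Adj i j) :
    form M (simpleRoot i) (simpleRoot j) = -1 := by rw [form_simpleRoot, cartan_of_adj h]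

lemma form_simpleRoot_of_not_adj {i j : I} (hij : i ≠ j) (h : ¬ M.Adj i j) :
    form M (simpleRoot i) (simpleRoot j) = 0 := by rw [form_simpleRoot, cartan_of_not_adj hij h]

lemma height_geom_s (k : I) (x : Lat I) :
    height (geom M (s M k) x) = height x - form M (simpleRoot k) x := by
  rw [geom_s_apply, height_sub, height_smul, height_simpleRoot, mul_one, form_comm]

lemma form_geom_s (l k : I) (x : Lat I) : form M (simpleRoot l) (geom M (s M k) x) =
    form M (simpleRoot l) x - form M (simpleRoot k) x * form M (simpleRoot l) (simpleRoot k) := by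
  rw [geom_s_apply, form_sub_right, form_smul_right, form_comm x]

lemma form_sub_self (x y : Lat I) :
    form M (x - y) (x - y) = form M x x - 2 * form M y x + form M y y := by
  simp only [form_sub_left, form_sub_right, form_comm x y]; ring

lemma form_geom_s_self (k : I) (x : Lat I) :
    form M (simpleRoot k) (geom M (s M k) x) = -form M (simpleRoot k) x := by
  rw [form_geom_s, form_simpleRoot_self]; ring

lemma form_geom_s_of_adj {l k : I} (h : M.Adj l k) (x : Lat I) :
    form M (simpleRoot l) (geom M (s M k) x) =
      form M (simpleRoot l) x + form M (simpleRoot k) x := by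
  rw [form_geom_s, form_simpleRoot_of_adj h]; ring

lemma form_geom_s_of_not_adj {l k : I} (hlk : l ≠ k) (h : ¬ M.Adj l k) (x : Lat I) :
    form M (simpleRoot l) (geom M (s M k) x) = form M (simpleRoot l) x := by
  rw [form_geom_s, form_simpleRoot_of_not_adj hlk h]; ring

variable [PosDef M]

lemma mem_s_smul {k : I} {B : Adm M} (hk : simpleRoot k ∉ B.1) {γ : Lat I} :
    γ ∈ (s M k • B).1 ↔ ∃ β ∈ B.1, γ = geom M (s M k) β := by
  constructor
  · intro h
    obtain ⟨hγ, β, hβ, rfl | rfl⟩ := h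
    · exact ⟨β, hβ, rfl⟩
    · have : IsPosRoot M (geom M (s M k) β) :=
        (B.2.pos β hβ).geom_s fun h => hk (h ▸ hβ)
      exact absurd hγ this.not_neg
  · rintro ⟨β, hβ, rfl⟩
    exact ⟨(B.2.pos β hβ).geom_s fun h => hk (h ▸ hβ), β, hβ, Or.inl rfl⟩

lemma raises_s_smul_iff {k l : I} {B : Adm M} (hk : simpleRoot k ∉ B.1) :
    Raises M l (s M k • B).1 ↔
      ∃ β ∈ B.1, form M (simpleRoot l) (geom M (s M k) β) = -1 ∧
        ∀ γ ∈ B.1, form M (simpleRoot l) (geom M (s M k) γ) = 1 →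
          height (geom M (s M k) β) < height (geom M (s M k) γ) := by
  constructor
  · rintro ⟨_, hβ, h1, h2⟩
    obtain ⟨β, hβ', rfl⟩ := (mem_s_smul hk).mp hβ
    exact ⟨β, hβ', h1, fun γ hγ h => h2 _ ((mem_s_smul hk).mpr ⟨γ, hγ, rfl⟩) h⟩
  · rintro ⟨β, hβ, h1, h2⟩
    refine ⟨_, (mem_s_smul hk).mpr ⟨β, hβ, rfl⟩, h1, fun γ hγ h => ?_⟩
    obtain ⟨γ, hγ', rfl⟩ := (mem_s_smul hk).mp hγ
    exact h2 γ hγ' h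

lemma mem_s_smul_smul {k l : I} {B : Adm M} (hk : simpleRoot k ∉ B.1)
    (hl : simpleRoot l ∉ (s M k • B).1) {γ : Lat I} :
    γ ∈ (s M l • s M k • B).1 ↔ ∃ β ∈ B.1, γ = geom M (s M l) (geom M (s M k) β) := by
  rw [mem_s_smul hl]
  constructor
  · rintro ⟨β, hβ, rfl⟩
    obtain ⟨β, hβ', rfl⟩ := (mem_s_smul hk).mp hβ
    exact ⟨β, hβ', rfl⟩
  · rintro ⟨β, hβ, rfl⟩
    exact ⟨_, (mem_s_smul hk).mpr ⟨β, hβ, rfl⟩, rfl⟩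

lemma raises_of_map {l : I} {B B' : Adm M} (f : Lat I → Lat I)
    (h : ∀ γ, γ ∈ B'.1 ↔ ∃ β ∈ B.1, γ = f β)
    (hf : ∃ β ∈ B.1, form M (simpleRoot l) (f β) = -1 ∧
      ∀ γ ∈ B.1, form M (simpleRoot l) (f γ) = 1 → height (f β) < height (f γ)) :
    Raises M l B'.1 := by
  obtain ⟨β, hβ, h1, h2⟩ := hf
  refine ⟨_, (h _).mpr ⟨β, hβ, rfl⟩, h1, fun γ hγ hl => ?_⟩
  obtain ⟨γ, hγ', rfl⟩ := (h _).mp hγ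
  exact h2 γ hγ' hl

lemma Raises.not_mem {k : I} {B : Adm M} (h : Raises M k B.1) : simpleRoot k ∉ B.1 := fun hk => by
  obtain ⟨β, hβ, h1, -⟩ := h
  rcases eq_or_ne β (simpleRoot k) with rfl | hne
  · rw [form_simpleRoot_self] at h1; omega
  · rw [B.2.orth _ hk β hβ hne.symm] at h1; omega

lemma Raises.not_perp {k : I} {B : Adm M} (h : Raises M k B.1) : ¬ Perp M (simpleRoot k) B.1 :=
  fun hk => by
    obtain ⟨β, hβ, h1, -⟩ := h
    rw [hk β hβ] at h1; omega

/-! ### Gaps between the heights of two members -/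

section Gaps

variable {B : Adm M} {β γ : Lat I} (hβ : β ∈ B.1) (hγ : γ ∈ B.1) {k : I}
  (hkβ : form M (simpleRoot k) β = -1) (hkγ : form M (simpleRoot k) γ = 1)

include hβ hγ hkβ hkγ

/-- Since β ⊥ γ, the norm is 6 - 2 - 2 = 2. That this difference is a root restricts the height gap
between a raised and a lowered member; the following lemmas exclude the small gaps. -/
lemma form_gap : form M (γ - β - simpleRoot k) (γ - β - simpleRoot k) = 2 := by
  have h0 : form M β γ = 0 := B.2.orth β hβ γ hγ (by rintro rfl; omega)
  simp only [form_sub_left, form_sub_right, form_comm γ β, form_comm γ (simpleRoot k),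
    form_comm β (simpleRoot k), h0, hkβ, hkγ, form_simpleRoot_self, (B.2.pos β hβ).form_self,
    (B.2.pos γ hγ).form_self]
  norm_num

lemma height_gap_one : height γ ≠ height β + 1 := fun h => by
  refine height_ne_zero (form_gap hβ hγ hkβ hkγ) ?_
  rw [height_sub, height_sub, height_simpleRoot]; omega

lemma eq_of_height_gap_two (h : height γ = height β + 2) :
    ∃ m, γ = β + simpleRoot k + simpleRoot m := by
  obtain ⟨m, hm⟩ := exists_eq_simpleRoot (form_gap hβ hγ hkβ hkγ)
    (by rw [height_sub, height_sub, height_simpleRoot]; omega)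
  exact ⟨m, by rw [← hm]; abel⟩

/-- A gap of 2 would make γ - β - α_k a simple root α_m, and equality of the products with α_i
forces (α_i, α_m) = 1, impossible for simple roots. -/
lemma height_gap_two {i : I} (hik : M.Adj i k)
    (hi : form M (simpleRoot i) γ = form M (simpleRoot i) β) : height γ ≠ height β + 2 := fun h => by
  obtain ⟨m, rfl⟩ := eq_of_height_gap_two hβ hγ hkβ hkγ h
  rw [form_add_right, form_add_right, form_simpleRoot_of_adj hik] at hi
  rcases form_simpleRoot_mem (M := M) (i := i) (j := m) with h | h | h <;> omega

/-- Along the path k - i - l, the vector γ - β - α_k - α_i - α_l is again a root and has product 1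
with α_k. It has nonzero height and is not simple, which excludes the gaps 3 and 4. -/
lemma height_gap_five {i l : I} (hik : M.Adj i k) (hil : M.Adj i l) (hkl : k ≠ l)
    (hkl' : ¬ M.Adj k l) (hi : form M (simpleRoot i) γ = form M (simpleRoot i) β)
    (hl : form M (simpleRoot l) γ = form M (simpleRoot l) β) (h : height β < height γ) :
    height β + 5 ≤ height γ := by
  have h1 := height_gap_one hβ hγ hkβ hkγ
  have h2 := height_gap_two hβ hγ hkβ hkγ hik hi
  set x := γ - β - simpleRoot k - simpleRoot i - simpleRoot l with hx
  have hik' := form_simpleRoot_of_adj hik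
  have hil' := form_simpleRoot_of_adj hil
  have hkl'' := form_simpleRoot_of_not_adj hkl hkl'
  have hk2 : form M (simpleRoot k) x = 1 := by
    rw [hx]
    simp only [form_sub_right, hkβ, hkγ, form_simpleRoot_self, form_comm (simpleRoot k)
      (simpleRoot i), hik', hkl'']
    norm_num
  have hxx : form M x x = 2 := by
    have h0 := form_gap hβ hγ hkβ hkγ
    have e1 : form M (simpleRoot i) (γ - β - simpleRoot k) = 1 := by
      rw [form_sub_right, form_sub_right, hi, hik']; norm_num
    have e2 : form M (simpleRoot l) (γ - β - simpleRoot k - simpleRoot i) = 1 := by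
      rw [form_sub_right, form_sub_right, form_sub_right, hl, form_comm _ (simpleRoot k), hkl'',
        form_comm _ (simpleRoot i), hil']; norm_num
    rw [hx, form_sub_self, form_sub_self, h0, e1, e2, form_simpleRoot_self, form_simpleRoot_self]
    norm_num
  have hht : height x = height γ - height β - 3 := by
    rw [hx]; simp only [height_sub, height_simpleRoot]; ring
  have h3 := height_ne_zero hxx
  have h4 : height x ≠ 1 := fun h => by
    obtain ⟨m, hm⟩ := exists_eq_simpleRoot hxx h
    rw [hm] at hk2
    rcases form_simpleRoot_mem (M := M) (i := k) (j := m) with h | h | h <;> omega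
  omega

/-- Here k is the middle node of the path i - k - l. Subtracting α_k, α_i and α_l in turn gives
roots; a gap of 4 leaves a simple root having product 2 with α_k, that is, α_k itself. -/
lemma height_gap_five_or {i l : I} (hik : M.Adj i k) (hlk : M.Adj l k) (hil : i ≠ l)
    (hil' : ¬ M.Adj i l) (hi : form M (simpleRoot i) γ = form M (simpleRoot i) β)
    (hl : form M (simpleRoot l) γ = form M (simpleRoot l) β) (h : height β < height γ) :
    height β + 5 ≤ height γ ∨
      γ - β = (2 : ℤ) • simpleRoot k + simpleRoot i + simpleRoot l := by
  have h1 := height_gap_one hβ hγ hkβ hkγ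
  have h2 := height_gap_two hβ hγ hkβ hkγ hik hi
  have hik' := form_simpleRoot_of_adj hik
  have hlk' := form_simpleRoot_of_adj hlk
  have hil'' := form_simpleRoot_of_not_adj hil hil'
  set y := γ - β - simpleRoot k - simpleRoot i with hy
  have h0 := form_gap hβ hγ hkβ hkγ
  have e1 : form M (simpleRoot i) (γ - β - simpleRoot k) = 1 := by
    rw [form_sub_right, form_sub_right, hi, hik']; norm_num
  have e2 : form M (simpleRoot l) y = 1 := by
    rw [hy, form_sub_right, form_sub_right, form_sub_right, hl, hlk', form_comm _ (simpleRoot i),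
      hil'']; norm_num
  have e3 : form M (simpleRoot k) y = 1 := by
    rw [hy, form_sub_right, form_sub_right, form_sub_right, hkβ, hkγ, form_simpleRoot_self,
      form_comm _ (simpleRoot i), hik']; norm_num
  have hyy : form M y y = 2 := by
    rw [hy, form_sub_self, h0, e1, form_simpleRoot_self]; norm_num
  have hyh : height y = height γ - height β - 2 := by
    rw [hy]; simp only [height_sub, height_simpleRoot]; ring
  have h3 : height y ≠ 1 := fun h => by
    obtain ⟨m, hm⟩ := exists_eq_simpleRoot hyy h
    rw [hm] at e3
    rcases form_simpleRoot_mem (M := M) (i := k) (j := m) with h | h | h <;> omega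
  have hzz : form M (y - simpleRoot l) (y - simpleRoot l) = 2 := by
    rw [form_sub_self, hyy, e2, form_simpleRoot_self]; norm_num
  have hzh : height (y - simpleRoot l) = height γ - height β - 3 := by
    rw [height_sub, height_simpleRoot, hyh]; ring
  by_cases h4 : height (y - simpleRoot l) = 1
  · right
    obtain ⟨m, hm⟩ := exists_eq_simpleRoot hzz h4
    have e4 : form M (simpleRoot k) (y - simpleRoot l) = 2 := by
      rw [form_sub_right, e3, form_comm _ (simpleRoot l), hlk']; norm_num
    rw [hm] at e4
    have hmk : k = m := by
      rcases form_simpleRoot_mem (M := M) (i := k) (j := m) with h | h | h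
      · exact h.2
      · omega
      · omega
    have : γ - β = (y - simpleRoot l) + simpleRoot k + simpleRoot i + simpleRoot l := by
      rw [hy]; abel
    rw [this, hm, hmk]; module
  · left; omega

end Gaps

/-- A raised member of minimal height. -/
lemma Raises.exists_min {k : I} {B : Adm M} (h : Raises M k B.1) :
    ∃ β ∈ B.1, form M (simpleRoot k) β = -1 ∧
      (∀ γ ∈ B.1, form M (simpleRoot k) γ = -1 → height β ≤ height γ) ∧
      ∀ γ ∈ B.1, form M (simpleRoot k) γ = 1 → height β + 2 ≤ height γ := by
  obtain ⟨β₀, hβ₀, h1, h2⟩ := h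
  obtain ⟨β, ⟨hβ, hβ1⟩, hmin⟩ := Set.exists_min_image {β | β ∈ B.1 ∧ form M (simpleRoot k) β = -1}
    height (B.2.finite.subset fun _ h => h.1) ⟨β₀, hβ₀, h1⟩
  refine ⟨β, hβ, hβ1, fun γ hγ hγ1 => hmin γ ⟨hγ, hγ1⟩, fun γ hγ hγ1 => ?_⟩
  have e1 := hmin β₀ ⟨hβ₀, h1⟩
  have e2 := h2 γ hγ hγ1
  have e3 := height_gap_one hβ hγ hβ1 hγ1
  omega

/-! ### Raising steps and their diamonds -/

lemma form_cases_of_not_mem {k : I} {B : Adm M} (hk : simpleRoot k ∉ B.1) {β : Lat I}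
    (hβ : β ∈ B.1) : form M (simpleRoot k) β = 1 ∨ form M (simpleRoot k) β = 0 ∨
      form M (simpleRoot k) β = -1 :=
  (form_simpleRoot_cases (B.2.pos β hβ) k).resolve_left fun h => hk (h ▸ hβ)

/-- A node that moves `B` raises either `B` or its image. -/
lemma raises_or_raises {k : I} {B : Adm M} (hk : simpleRoot k ∉ B.1)
    (hp : ¬ Perp M (simpleRoot k) B.1) : Raises M k B.1 ∨ Raises M k (s M k • B).1 := by
  rw [raises_s_smul_iff hk]
  simp only [form_geom_s_self, height_geom_s]
  have hfin (c : ℤ) : {β | β ∈ B.1 ∧ form M (simpleRoot k) β = c}.Finite :=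
    B.2.finite.subset fun _ h => h.1
  by_cases hup : {β | β ∈ B.1 ∧ form M (simpleRoot k) β = -1}.Nonempty
  · obtain ⟨β, ⟨hβ, hβ1⟩, hmin⟩ := Set.exists_min_image _ height (hfin (-1)) hup
    -- Otherwise some lowered γ is no higher than the lowest raised member. In r_k B the roles are
    -- exchanged, and r_k γ is then lower than every member lowered by k.
    by_cases hlow : ∀ γ ∈ B.1, form M (simpleRoot k) γ = 1 → height β < height γ
    · exact Or.inl ⟨β, hβ, hβ1, hlow⟩
    · push Not at hlow
      obtain ⟨γ, hγ, hγ1, hle⟩ := hlow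
      refine Or.inr ⟨γ, hγ, by omega, fun β' hβ' h' => ?_⟩
      have := hmin β' ⟨hβ', by omega⟩
      omega
  · right
    simp only [Perp] at hp
    push Not at hp
    obtain ⟨γ, hγ, hγ1⟩ := hp
    have hno : ∀ β ∈ B.1, form M (simpleRoot k) β ≠ -1 := fun β hβ h => hup ⟨β, hβ, h⟩
    have := form_cases_of_not_mem hk hγ
    have := hno γ hγ
    exact ⟨γ, hγ, by omega, fun β hβ h => absurd (by omega) (hno β hβ)⟩

/-- If `α_i ⊥ B`, `k` raises `B` and `i ∼ k`, then `i` raises `r_k B`. -/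
lemma Raises.perp_adj {i k : I} {B : Adm M} (h : Raises M k B.1) (hi : Perp M (simpleRoot i) B.1)
    (hik : M.Adj i k) : Raises M i (s M k • B).1 := by
  rw [raises_s_smul_iff h.not_mem]
  simp only [form_geom_s_of_adj hik, height_geom_s]
  obtain ⟨β, hβ, h1, -, h2⟩ := h.exists_min
  refine ⟨β, hβ, by rw [hi β hβ, h1]; norm_num, fun γ hγ h3 => ?_⟩
  rw [hi γ hγ, zero_add] at h3
  have := h2 γ hγ h3
  -- Applying r_k lifts β by 1 and drops γ by 1, so the inequality needs a gap of at least 3.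
  have := height_gap_two hβ hγ h1 h3 hik ((hi γ hγ).trans (hi β hβ).symm)
  omega

/-- Since α_i + α_j is a positive root of height 2, a product of -2 would make β negative and a
product of 2 makes β equal to it. -/
lemma form_pair_cases {i j : I} (hij : M.Adj i j) {β : Lat I} (hβ : IsPosRoot M β) :
    form M (simpleRoot i) β + form M (simpleRoot j) β ≠ -2 ∧
      (form M (simpleRoot i) β + form M (simpleRoot j) β = 2 → height β = 2) := by
  have hs : form M (simpleRoot i + simpleRoot j) (simpleRoot i + simpleRoot j) = 2 := by
    simp only [form_add_left, form_add_right, form_simpleRoot_self, form_simpleRoot_of_adj hij,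
      form_simpleRoot_of_adj hij.symm]
    norm_num
  constructor
  · intro h
    have := eq_neg_of_form_eq_neg_two hs hβ.form_self (by rw [form_add_left, h])
    have h2 := hβ.height_pos
    rw [← neg_eq_iff_eq_neg] at this
    rw [← this, height_neg, height_add, height_simpleRoot, height_simpleRoot] at h2
    omega
  · intro h
    have := eq_of_form_eq_two hs hβ.form_self (by rw [form_add_left, h])
    rw [← this, height_add, height_simpleRoot, height_simpleRoot]
    norm_num

/-- Two adjacent nodes that raise `B`: the first step of the braid diamond. -/
lemma Raises.adj_left {i j : I} {B : Adm M} (hi : Raises M i B.1) (hj : Raises M j B.1)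
    (hij : M.Adj i j) : Raises M j (s M i • B).1 := by
  rw [raises_s_smul_iff hi.not_mem]
  simp only [form_geom_s_of_adj hij.symm, height_geom_s]
  obtain ⟨x, hx, hx1, hx2, hx3⟩ := hi.exists_min
  obtain ⟨y, hy, hy1, hy2, hy3⟩ := hj.exists_min
  have cx := form_cases_of_not_mem hj.not_mem hx
  have cy := form_cases_of_not_mem hi.not_mem hy
  have px := (form_pair_cases hij (B.2.pos x hx)).1
  have py := (form_pair_cases hij (B.2.pos y hy)).1
  have hgx : form M (simpleRoot j) x = 0 → ∀ γ ∈ B.1, form M (simpleRoot i) γ = 1 →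
      form M (simpleRoot j) γ = 0 → height x + 3 ≤ height γ := fun h γ hγ h1 h2 => by
    have := hx3 γ hγ h1
    have := height_gap_two hx hγ hx1 h1 hij.symm (h2.trans h.symm)
    omega
  -- After r_i, the product with α_j is the sum of the products with α_i and α_j. Both x (if
  -- orthogonal to α_j) and y (if orthogonal to α_i) can become raised by j; the witness is the one
  -- whose image is lower, and x is forced when i lowers y.
  by_cases hc : form M (simpleRoot j) x = 0 ∧ height x + 1 ≤ height y - form M (simpleRoot i) y ∨
      form M (simpleRoot i) y = 1
  · have hxj : form M (simpleRoot j) x = 0 := by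
      by_contra hne
      have h1 := hx3 y hy (by omega)
      have h2 := hy3 x hx (by omega)
      omega
    refine ⟨x, hx, by omega, fun γ hγ h => ?_⟩
    have ci := form_cases_of_not_mem hi.not_mem hγ
    have cj := form_cases_of_not_mem hj.not_mem hγ
    rcases (show form M (simpleRoot i) γ = 1 ∧ form M (simpleRoot j) γ = 0 ∨
      form M (simpleRoot i) γ = 0 ∧ form M (simpleRoot j) γ = 1 by omega) with ⟨h1, h2⟩ | ⟨h1, h2⟩
    · have := hgx hxj γ hγ h1 h2
      omega
    · have := hy3 γ hγ h2
      rcases hc with hc | hc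
      · omega
      · have := hx3 y hy hc
        omega
  · have hyi : form M (simpleRoot i) y = 0 := by omega
    refine ⟨y, hy, by omega, fun γ hγ h => ?_⟩
    have ci := form_cases_of_not_mem hi.not_mem hγ
    have cj := form_cases_of_not_mem hj.not_mem hγ
    rcases (show form M (simpleRoot i) γ = 1 ∧ form M (simpleRoot j) γ = 0 ∨
      form M (simpleRoot i) γ = 0 ∧ form M (simpleRoot j) γ = 1 by omega) with ⟨h1, h2⟩ | ⟨h1, h2⟩
    · have := hx3 γ hγ h1
      rcases (show form M (simpleRoot j) x = 0 ∨ form M (simpleRoot j) x = 1 by omega) with h' | h'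
      · have := hgx h' γ hγ h1 h2
        omega
      · have := hy3 x hx h'
        omega
    · have := hy3 γ hγ h2
      omega

/-- Two adjacent nodes that raise `B`: the last step of the braid diamond. -/
lemma Raises.adj_right {i j : I} {B : Adm M} (hi : Raises M i B.1) (hj : Raises M j B.1)
    (hij : M.Adj i j) : Raises M i (s M j • s M i • B).1 := by
  have hji := hi.adj_left hj hij
  refine raises_of_map _ (fun γ => mem_s_smul_smul hi.not_mem hji.not_mem) ?_
  simp only [form_geom_s_of_adj hij, form_geom_s_of_adj hij.symm, form_geom_s_self, height_geom_s]
  obtain ⟨y, hy, hy1, hy2, hy3⟩ := hj.exists_min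
  have cy := form_cases_of_not_mem hi.not_mem hy
  have py := (form_pair_cases hij (B.2.pos y hy)).1
  -- Since r_i r_j α_i = α_j, the members of r_j r_i B raised or lowered by i are the images of
  -- those of B raised or lowered by j.
  refine ⟨y, hy, by omega, fun γ hγ h => ?_⟩
  have ci := form_cases_of_not_mem hi.not_mem hγ
  have hγj : form M (simpleRoot j) γ = 1 := by omega
  have := hy3 γ hγ hγj
  have p2 := (form_pair_cases hij (B.2.pos γ hγ)).2
  have := (B.2.pos y hy).height_pos
  by_cases h' : form M (simpleRoot i) γ = form M (simpleRoot i) y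
  · have := height_gap_two hy hγ hy1 hγj hij h'
    omega
  · omega

lemma smul_eq_self_of_map_le {B : Adm M} {w : W M} (hw : w * w = 1)
    (h : ∀ x ∈ span2 B.1, geom M w x ∈ span2 B.1) : w • B = B := by
  refine adm_ext ?_
  rw [span2_smul]
  refine le_antisymm (by rintro _ ⟨x, hx, rfl⟩; exact h x hx) fun x hx => ⟨_, h x hx, ?_⟩
  rw [← geom_mul_apply, hw, geom_one_apply]

/-- The element r_j r_i maps x to x - (x, α_i)(α_i + α_j) + ((x, α_i) - (x, α_j)) α_j. On the
lattice of B the last coefficient is even, so the lattice is preserved. -/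
lemma s_smul_eq_s_smul {i j : I} (hij : i ≠ j) (hadj : ¬ M.Adj i j) {B : Adm M}
    (h : simpleRoot i + simpleRoot j ∈ span2 B.1) : s M i • B = s M j • B := by
  have hc := s_comm hadj
  have key : (s M j * s M i) • B = B := by
    refine smul_eq_self_of_map_le ?_ fun x hx => ?_
    · rw [mul_assoc, ← mul_assoc (s M i), hc, mul_assoc, s_mul_s, mul_one, s_mul_s]
    · have e : geom M (s M j * s M i) x = x - form M x (simpleRoot i) • (simpleRoot i + simpleRoot j)
          + (form M x (simpleRoot i) - form M x (simpleRoot j)) • simpleRoot j := by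
        rw [geom_mul_apply, geom_s_apply, geom_s_apply, form_sub_left, form_smul_left,
          form_simpleRoot_of_not_adj hij hadj]
        module
      rw [e]
      refine add_mem (sub_mem hx (Submodule.smul_mem _ _ h))
        (even_smul_mem (two_smul_mem_span2 _) ?_ _)
      have := B.2.evenOn x hx _ h
      rw [form_add_right] at this
      rwa [Int.even_sub, ← Int.even_add]
  calc s M i • B = s M j • (s M j * s M i) • B := by rw [smul_smul, s_mul_s_mul]
    _ = s M j • B := by rw [key]

/-- Two non-adjacent nodes that raise `B`. -/
lemma Raises.not_adj {i j : I} {B : Adm M} (hi : Raises M i B.1) (hj : Raises M j B.1)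
    (hij : i ≠ j) (hadj : ¬ M.Adj i j) :
    (∃ β ∈ B.1, β + simpleRoot i + simpleRoot j ∈ B.1) ∨ Raises M j (s M i • B).1 := by
  rw [raises_s_smul_iff hi.not_mem]
  simp only [form_geom_s_of_not_adj hij.symm (mt SimpleGraph.Adj.symm hadj), height_geom_s]
  obtain ⟨y, hy, hy1, hy2, hy3⟩ := hj.exists_min
  -- The only way to lose the inequality is a gap of 2 that r_i closes completely. The gap root is
  -- then α_i, so B contains both y and y + α_i + α_j, and r_i and r_j have the same effect on B.
  by_cases h : ∃ γ ∈ B.1, form M (simpleRoot j) γ = 1 ∧ height γ = height y + 2 ∧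
      form M (simpleRoot i) γ = 1 ∧ form M (simpleRoot i) y = -1
  · obtain ⟨γ, hγ, h1, h2, h3, h4⟩ := h
    obtain ⟨m, rfl⟩ := eq_of_height_gap_two hy hγ hy1 h1 h2
    rw [form_add_right, form_add_right, form_simpleRoot_of_not_adj hij hadj] at h3
    have hm : i = m := by
      rcases form_simpleRoot_mem (M := M) (i := i) (j := m) with h | h | h
      · exact h.2
      · omega
      · omega
    subst hm
    exact Or.inl ⟨y, hy, by rwa [add_right_comm] at hγ⟩
  · right
    refine ⟨y, hy, hy1, fun γ hγ h1 => ?_⟩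
    have := hy3 γ hγ h1
    have ci := form_cases_of_not_mem hi.not_mem hγ
    have cy := form_cases_of_not_mem hi.not_mem hy
    by_contra hn
    exact h ⟨γ, hγ, h1, by omega, by omega, by omega⟩

lemma s_smul_eq_of_mem {i j : I} (hij : i ≠ j) (hadj : ¬ M.Adj i j) {B : Adm M} {β : Lat I}
    (hβ : β ∈ B.1) (hγ : β + simpleRoot i + simpleRoot j ∈ B.1) : s M i • B = s M j • B := by
  refine s_smul_eq_s_smul hij hadj ?_
  have : simpleRoot i + simpleRoot j = (β + simpleRoot i + simpleRoot j) - β := by abel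
  rw [this]
  exact sub_mem (subset_span2 _ hγ) (subset_span2 _ hβ)

/-! ### Raising is well-founded -/

/-- `B'` is above `B`: at the lowest height where they differ, `B'` has fewer members. -/
def Below (B B' : Set (Lat I)) : Prop :=
  ∃ m : ℤ, (∀ β : Lat I, height β < m → (β ∈ B ↔ β ∈ B')) ∧
    (∀ β ∈ B', height β = m → β ∈ B) ∧ ∃ β ∈ B, height β = m ∧ β ∉ B'

omit [PosDef M] in
lemma Below.irrefl (B : Set (Lat I)) : ¬ Below B B := by
  rintro ⟨m, -, -, β, h, -, h'⟩
  exact h' h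

lemma Below.trans {B B' B'' : Set (Lat I)} (h : Below B B') (h' : Below B' B'') : Below B B'' := by
  obtain ⟨m, h1, h2, β, h3, h4, h5⟩ := h
  obtain ⟨m', h1', h2', β', h3', h4', h5'⟩ := h'
  rcases lt_trichotomy m m' with hm | rfl | hm
  · refine ⟨m, fun x hx => (h1 x hx).trans (h1' x (hx.trans hm)),
      fun x hx hxm => h2 x ((h1' x (hxm ▸ hm)).mpr hx) hxm, β, h3, h4, fun h => h5 ?_⟩
    exact (h1' β (h4 ▸ hm)).mpr h
  · exact ⟨m, fun x hx => (h1 x hx).trans (h1' x hx), fun x hx hxm => h2 x (h2' x hx hxm) hxm, β, h3,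
      h4, fun h => h5 (h2' β h h4)⟩
  · exact ⟨m', fun x hx => (h1 x (hx.trans hm)).trans (h1' x hx),
      fun x hx hxm => (h1 x (hxm ▸ hm)).mpr (h2' x hx hxm), β', (h1 β' (h4' ▸ hm)).mpr h3', h4', h5'⟩

/-- Let y be a raised member of least height. Nothing changes below that height; at that height y
leaves and nothing enters, because lowered members start at least two higher. -/
lemma Raises.below {k : I} {B : Adm M} (h : Raises M k B.1) : Below B.1 (s M k • B).1 := by
  have hk := h.not_mem
  obtain ⟨y, hy, hy1, hy2, hy3⟩ := h.exists_min
  have hfix : ∀ x ∈ B.1, form M (simpleRoot k) x = 0 → geom M (s M k) x = x := fun x _ h => by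
    rw [geom_s_apply, form_comm, h, zero_smul, sub_zero]
  have hup : ∀ x, height x ≤ height y → x ∈ (s M k • B).1 → x ∈ B.1 := fun x hx hmem => by
    obtain ⟨β, hβ, rfl⟩ := (mem_s_smul hk).mp hmem
    rw [height_geom_s] at hx
    rcases form_cases_of_not_mem hk hβ with h | h | h
    · have := hy3 β hβ h
      omega
    · rwa [hfix β hβ h]
    · have := hy2 β hβ h
      omega
  refine ⟨height y, fun x hx => ⟨fun hmem => ?_, hup x hx.le⟩, fun x hx hxm => hup x hxm.le hx, y, hy,
    rfl, fun hmem => ?_⟩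
  · refine (mem_s_smul hk).mpr ⟨x, hmem, (hfix x hmem ?_).symm⟩
    rcases form_cases_of_not_mem hk hmem with h | h | h
    · have := hy3 x hmem h
      omega
    · exact h
    · have := hy2 x hmem h
      omega
  · obtain ⟨β, hβ, he⟩ := (mem_s_smul hk).mp hmem
    have hht := congrArg height he
    have hf := congrArg (form M (simpleRoot k)) he
    rw [height_geom_s] at hht
    rw [form_geom_s_self, hy1] at hf
    have := hy3 β hβ (by omega)
    omega

instance : Finite (Adm M) := by
  have : {B : Set (Lat I) | B ⊆ {x | IsRoot M x}}.Finite := finite_setOf_isRoot.finite_subsets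
  exact (this.subset fun B (hB : IsAdmissible M B) x hx => (hB.pos x hx).1).to_subtype

lemma wellFounded_above : WellFounded fun B' B : Adm M => Below B.1 B'.1 := by
  have : IsTrans (Adm M) fun B' B : Adm M => Below B.1 B'.1 := ⟨fun _ _ _ h h' => h'.trans h⟩
  have : Std.Irrefl fun B' B : Adm M => Below B.1 B'.1 := ⟨fun B => Below.irrefl B.1⟩
  exact Finite.wellFounded_of_trans_of_irrefl _

/-! ### The highest element of an orbit -/

/-- A raising step. -/
def Step (M : SimpleGraph I) [PosDef M] (B B' : Adm M) : Prop :=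
  ∃ k, Raises M k B.1 ∧ B' = s M k • B

/-- No node raises `B`. -/
def Terminal (M : SimpleGraph I) [PosDef M] (B : Adm M) : Prop := ∀ k, ¬ Raises M k B.1

lemma Step.below {B B' : Adm M} (h : Step M B B') : Below B.1 B'.1 := by
  obtain ⟨k, hk, rfl⟩ := h
  exact hk.below

lemma eq_or_below_of_steps {B B' : Adm M} (h : Relation.ReflTransGen (Step M) B B') :
    B = B' ∨ Below B.1 B'.1 := by
  induction h with
  | refl => exact Or.inl rfl
  | tail _ h ih =>
    rcases ih with rfl | ih
    · exact Or.inr h.below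
    · exact Or.inr (ih.trans h.below)

/-- Adjacent nodes close up in the hexagon r_i r_j r_i = r_j r_i r_j. Non-adjacent nodes close up in
a commuting square unless r_i B = r_j B. -/
lemma step_confluent {B B₁ B₂ : Adm M} (h₁ : Step M B B₁) (h₂ : Step M B B₂) :
    ∃ D, Relation.ReflTransGen (Step M) B₁ D ∧ Relation.ReflTransGen (Step M) B₂ D := by
  obtain ⟨i, hi, rfl⟩ := h₁
  obtain ⟨j, hj, rfl⟩ := h₂
  rcases eq_or_ne i j with rfl | hij
  · exact ⟨_, .refl, .refl⟩
  by_cases hadj : M.Adj i j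
  · refine ⟨s M i • s M j • s M i • B, ?_, ?_⟩
    · exact .head ⟨j, hi.adj_left hj hadj, rfl⟩ (.single ⟨i, hi.adj_right hj hadj, rfl⟩)
    · refine .head ⟨i, hj.adj_left hi hadj.symm, rfl⟩
        (.single ⟨j, hj.adj_right hi hadj.symm, ?_⟩)
      simp only [smul_smul, s_braid hadj]
  · rcases hi.not_adj hj hij hadj with ⟨β, hβ, hγ⟩ | h
    · rw [s_smul_eq_of_mem hij hadj hβ hγ]
      exact ⟨_, .refl, .refl⟩
    rcases hj.not_adj hi hij.symm (mt SimpleGraph.Adj.symm hadj) with ⟨β, hβ, hγ⟩ | h'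
    · rw [s_smul_eq_of_mem hij.symm (mt SimpleGraph.Adj.symm hadj) hβ hγ]
      exact ⟨_, .refl, .refl⟩
    refine ⟨s M j • s M i • B, .single ⟨j, h, rfl⟩, .single ⟨i, h', ?_⟩⟩
    rw [smul_smul, smul_smul, s_comm hadj]

/-- Newman's argument: local confluence together with well-founded induction upwards gives a unique
normal form. -/
lemma existsUnique_terminal (B : Adm M) :
    ∃! T, Terminal M T ∧ Relation.ReflTransGen (Step M) B T := by
  refine wellFounded_above.induction (C := fun B : Adm M =>
    ∃! T, Terminal M T ∧ Relation.ReflTransGen (Step M) B T) B fun B ih => ?_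
  by_cases hB : Terminal M B
  · refine ⟨B, ⟨hB, .refl⟩, fun T hT => ?_⟩
    rcases hT.2.cases_head with h | ⟨C, ⟨k, hk, -⟩, -⟩
    · exact h.symm
    · exact absurd hk (hB k)
  · simp only [Terminal] at hB
    push Not at hB
    obtain ⟨k, hk⟩ := hB
    have hstep : Step M B (s M k • B) := ⟨k, hk, rfl⟩
    obtain ⟨T, ⟨hT, hBT⟩, huniq⟩ := ih _ hstep.below
    refine ⟨T, ⟨hT, .head hstep hBT⟩, fun T' ⟨hT', hBT'⟩ => ?_⟩
    rcases hBT'.cases_head with rfl | ⟨C, hC, hCT⟩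
    · exact absurd hk (hT' k)
    · obtain ⟨D, h1, h2⟩ := step_confluent hstep hC
      obtain ⟨T₀, ⟨hT₀, hDT₀⟩, -⟩ : ∃! T, Terminal M T ∧ Relation.ReflTransGen (Step M) D T := by
        refine ih D ?_
        rcases eq_or_below_of_steps h1 with h | h
        · rw [← h]; exact hstep.below
        · exact hstep.below.trans h
      rw [← huniq T₀ ⟨hT₀, h1.trans hDT₀⟩]
      exact (ih C hC.below).unique ⟨hT', hCT⟩ ⟨hT₀, h2.trans hDT₀⟩

/-- Unless r_k fixes B, one of B and r_k B is raised to the other, so both have the same terminal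
set. Hence one terminal set serves the whole orbit. -/
lemma terminal_s_smul {B T : Adm M} (k : I) (hT : Terminal M T)
    (h : Relation.ReflTransGen (Step M) B T) : Relation.ReflTransGen (Step M) (s M k • B) T := by
  by_cases hk : simpleRoot k ∈ B.1
  · rwa [s_smul_of_pm (Or.inl hk)]
  by_cases hp : Perp M (simpleRoot k) B.1
  · rw [← reflW_simpleRoot, reflW_smul_of_perp (isRoot_simpleRoot k) hp]
    exact h
  rcases raises_or_raises hk hp with h' | h'
  · obtain ⟨T', ⟨hT', hs⟩, -⟩ := existsUnique_terminal (s M k • B)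
    have : Relation.ReflTransGen (Step M) B T' := .head ⟨k, h', rfl⟩ hs
    rwa [(existsUnique_terminal B).unique ⟨hT, h⟩ ⟨hT', this⟩]
  · exact .head ⟨k, h', by rw [smul_smul, s_mul_s, one_smul]⟩ h

lemma terminal_smul {B T : Adm M} (w : W M) (hT : Terminal M T)
    (h : Relation.ReflTransGen (Step M) B T) : Relation.ReflTransGen (Step M) (w • B) T := by
  induction w using W_induction with
  | one => rwa [one_smul]
  | mul w i ih =>
    rw [mul_smul]
    exact terminal_s_smul i hT ih

lemma orbitLE_iff {B B' : Adm M} :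
    OrbitLE M B.1 B'.1 ↔ Relation.ReflTransGen (Step M) B B' := by
  constructor
  · intro h
    suffices ∀ S, OrbitLE M B.1 S → ∃ C : Adm M, C.1 = S ∧ Relation.ReflTransGen (Step M) B C by
      obtain ⟨C, hC, hs⟩ := this _ h
      rwa [← Subtype.ext hC]
    intro S hS
    induction hS with
    | refl => exact ⟨B, rfl, .refl⟩
    | tail _ h ih =>
      obtain ⟨C, rfl, hC⟩ := ih
      obtain ⟨k, hk, rfl⟩ := h
      exact ⟨s M k • C, rfl, hC.tail ⟨k, hk, rfl⟩⟩
  · intro h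
    induction h with
    | refl => exact .refl
    | tail _ h ih =>
      obtain ⟨k, hk, rfl⟩ := h
      exact ih.tail ⟨k, hk, rfl⟩

lemma steps_smul {B B' : Adm M} (h : Relation.ReflTransGen (Step M) B B') : ∃ w : W M, B' = w • B := by
  induction h with
  | refl => exact ⟨1, (one_smul _ _).symm⟩
  | tail _ h ih =>
    obtain ⟨w, rfl⟩ := ih
    obtain ⟨k, -, rfl⟩ := h
    exact ⟨s M k * w, mul_smul _ _ _ |>.symm⟩

instance (X : Adm M) : MulAction (W M) (Orbit M X) where
  smul w B := ⟨w • B.1, by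
    obtain ⟨w', hw'⟩ := B.2
    exact ⟨w * w', by rw [smul_val, hw', act_act X.2.pos]⟩⟩
  one_smul B := Subtype.ext (one_smul (W M) B.1)
  mul_smul w w' B := Subtype.ext (mul_smul w w' B.1)

lemma orbit_smul_val {X : Adm M} (w : W M) (B : Orbit M X) : (w • B).1 = w • B.1 := rfl

lemma IsHighest.terminal {X : Adm M} {B₀ : Orbit M X} (h : IsHighest B₀) : Terminal M B₀.1 := by
  intro k hk
  rcases eq_or_below_of_steps (orbitLE_iff.mp (h (s M k • B₀))) with h' | h'
  · have := hk.below
    rw [← orbit_smul_val, h'] at this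
    exact Below.irrefl _ this
  · exact Below.irrefl _ (hk.below.trans h')

lemma IsHighest.steps {X : Adm M} {B₀ : Orbit M X} (h : IsHighest B₀) (B : Orbit M X) :
    Relation.ReflTransGen (Step M) B.1 B₀.1 := orbitLE_iff.mp (h B)

lemma existsUnique_isHighest (X : Adm M) : ∃! B₀ : Orbit M X, IsHighest B₀ := by
  obtain ⟨T, ⟨hT, hXT⟩, -⟩ := existsUnique_terminal X
  obtain ⟨w, hw⟩ := steps_smul hXT
  refine ⟨⟨T, w, by rw [hw]; rfl⟩, fun B => ?_, fun B h => ?_⟩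
  · obtain ⟨w', hw'⟩ := B.2
    rw [orbitLE_iff, show B.1 = w' • X from Subtype.ext hw']
    exact terminal_smul w' hT hXT
  · refine Subtype.ext ?_
    rcases (h.steps ⟨T, w, by rw [hw]; rfl⟩).cases_head with h' | ⟨C, ⟨k, hk, -⟩, -⟩
    · exact h'.symm
    · exact absurd hk (hT k)

end Raising

section Nodes

variable {I : Type*} [Fintype I] {M : SimpleGraph I} [PosDef M]

/-! ### Raising next to an orthogonal node -/

lemma Perp.s_smul_of_not_adj {i k : I} {B : Adm M} (hi : Perp M (simpleRoot i) B.1)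
    (hik : ¬ M.Adj i k) : Perp M (simpleRoot i) (s M k • B).1 := by
  rcases eq_or_ne i k with rfl | hne
  · rwa [← reflW_simpleRoot, reflW_smul_of_perp (isRoot_simpleRoot i) hi]
  · rintro _ ⟨-, β, hβ, rfl | rfl⟩
    · rw [form_geom_s_of_not_adj hne hik, hi β hβ]
    · rw [form_neg_right, form_geom_s_of_not_adj hne hik, hi β hβ, neg_zero]

lemma Perp.s_smul_smul {i k : I} {B : Adm M} (hi : Perp M (simpleRoot i) B.1)
    (hik : M.Adj i k) : Perp M (simpleRoot k) (s M i • s M k • B).1 := by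
  rw [smul_smul]
  have e : ∀ β, form M (simpleRoot k) (geom M (s M i * s M k) β) = form M (simpleRoot i) β := by
    intro β
    rw [geom_mul_apply, form_geom_s_of_adj hik.symm, form_geom_s_self, form_geom_s_of_adj hik]
    ring
  rintro _ ⟨-, β, hβ, rfl | rfl⟩
  · rw [e, hi β hβ]
  · rw [form_neg_right, e, hi β hβ, neg_zero]

/-- Common core of `Raises.of_adj_adj` and `Raises.of_adj_path`. If α_i ⊥ B, then r_i r_k changes
the height of β by -2(α_k, β), and in both configurations the product of the image with α_l is (α_k,
β) + (α_l, β). A raised and a lowered member each move by 2 towards one another, hence the required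
gap of 5. -/
lemma exists_raised_of_pair {k l : I} {B : Adm M} (hk : Raises M k B.1) (hl : Raises M l B.1)
    (hkl : ∀ δ ∈ B.1, form M (simpleRoot k) δ + form M (simpleRoot l) δ ≠ -2)
    (hgap : ∀ β ∈ B.1, ∀ γ ∈ B.1, form M (simpleRoot k) β = -1 → form M (simpleRoot l) β = 0 →
      form M (simpleRoot k) γ = 1 → form M (simpleRoot l) γ = 0 → height β < height γ →
      height β + 5 ≤ height γ) :
    ∃ β ∈ B.1, form M (simpleRoot k) β + form M (simpleRoot l) β = -1 ∧
      ∀ γ ∈ B.1, form M (simpleRoot k) γ + form M (simpleRoot l) γ = 1 →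
        height β - 2 * form M (simpleRoot k) β < height γ - 2 * form M (simpleRoot k) γ := by
  obtain ⟨x, hx, hx1, hx2, hx3⟩ := hk.exists_min
  obtain ⟨y, hy, hy1, hy2, hy3⟩ := hl.exists_min
  have cx := form_cases_of_not_mem hl.not_mem hx
  have cy := form_cases_of_not_mem hk.not_mem hy
  have px := hkl x hx
  have py := hkl y hy
  have key : ∀ γ ∈ B.1, form M (simpleRoot k) γ + form M (simpleRoot l) γ = 1 →
      (form M (simpleRoot k) γ = 1 ∧ form M (simpleRoot l) γ = 0 ∧ height x + 2 ≤ height γ ∧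
        (form M (simpleRoot l) x = 0 → height x + 5 ≤ height γ)) ∨
      (form M (simpleRoot k) γ = 0 ∧ form M (simpleRoot l) γ = 1 ∧ height y + 2 ≤ height γ) := by
    intro γ hγ h
    have c1 := form_cases_of_not_mem hk.not_mem hγ
    have c2 := form_cases_of_not_mem hl.not_mem hγ
    rcases (show form M (simpleRoot k) γ = 1 ∧ form M (simpleRoot l) γ = 0 ∨
      form M (simpleRoot k) γ = 0 ∧ form M (simpleRoot l) γ = 1 by omega) with ⟨h1, h2⟩ | ⟨h1, h2⟩
    · have h3 := hx3 γ hγ h1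
      exact Or.inl ⟨h1, h2, h3, fun h0 => hgap x hx γ hγ hx1 h0 h1 h2 (by omega)⟩
    · exact Or.inr ⟨h1, h2, hy3 γ hγ h2⟩
  have hxy : form M (simpleRoot k) y = 1 → height x + 2 ≤ height y := hx3 y hy
  have hyx : form M (simpleRoot l) x = 1 → height y + 2 ≤ height x := hy3 x hx
  by_cases hc : form M (simpleRoot l) x = 0 ∧
      (form M (simpleRoot k) y = 1 ∨ height x + 2 ≤ height y)
  · refine ⟨x, hx, by omega, fun γ hγ h => ?_⟩
    have := key γ hγ h
    omega
  · refine ⟨y, hy, by omega, fun γ hγ h => ?_⟩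
    have := key γ hγ h
    omega

lemma form_triple_cases {i k l : I} (hik : M.Adj i k) (hil : M.Adj i l) (hkl : k ≠ l)
    (hkl' : ¬ M.Adj k l) {β : Lat I} (hβ : IsPosRoot M β) (hi : form M (simpleRoot i) β = 0) :
    form M (simpleRoot k) β + form M (simpleRoot l) β ≠ -2 ∧
      (form M (simpleRoot k) β + form M (simpleRoot l) β = 2 → height β = 3) := by
  set x := simpleRoot k + simpleRoot i + simpleRoot l with hx
  have hs : form M x x = 2 := by
    simp only [hx, form_add_left, form_add_right, form_simpleRoot_self, form_simpleRoot_of_adj hik,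
      form_simpleRoot_of_adj hik.symm, form_simpleRoot_of_adj hil, form_simpleRoot_of_adj hil.symm,
      form_simpleRoot_of_not_adj hkl hkl',
      form_simpleRoot_of_not_adj hkl.symm (mt SimpleGraph.Adj.symm hkl')]
    norm_num
  have hxβ : form M x β = form M (simpleRoot k) β + form M (simpleRoot l) β := by
    rw [hx, form_add_left, form_add_left, hi, add_zero]
  have hxh : height x = 3 := by
    simp only [hx, height_add, height_simpleRoot]; norm_num
  constructor
  · intro h
    have := eq_neg_of_form_eq_neg_two hs hβ.form_self (by rw [hxβ, h])
    have h2 := hβ.height_pos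
    rw [← neg_eq_iff_eq_neg] at this
    rw [← this, height_neg, hxh] at h2
    omega
  · intro h
    rw [← eq_of_form_eq_two hs hβ.form_self (by rw [hxβ, h]), hxh]

section Two

variable {i k l : I} {B : Adm M} (hk : Raises M k B.1) (hl : Raises M l B.1)
  (hi : Perp M (simpleRoot i) B.1) (hik : M.Adj i k)

include hk hl hi hik

lemma Raises.of_adj_adj (hil : M.Adj i l) (hkl : k ≠ l) (hkl' : ¬ M.Adj k l) :
    Raises M l (s M i • s M k • B).1 := by
  refine raises_of_map _ (fun γ => mem_s_smul_smul hk.not_mem (hk.perp_adj hi hik).not_mem) ?_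
  obtain ⟨β, hβ, h1, h2⟩ := exists_raised_of_pair hk hl
    (fun δ hδ => (form_triple_cases hik hil hkl hkl' (B.2.pos δ hδ) (hi δ hδ)).1)
    fun β hβ γ hγ h1 h2 h3 h4 h => height_gap_five hβ hγ h1 h3 hik hil hkl hkl'
      ((hi γ hγ).trans (hi β hβ).symm) (h4.trans h2.symm) h
  simp only [form_geom_s_of_adj hil.symm, form_geom_s_of_adj hik, height_geom_s,
    form_geom_s_of_not_adj hkl.symm (mt SimpleGraph.Adj.symm hkl')]
  refine ⟨β, hβ, by rw [hi β hβ]; omega, fun γ hγ h => ?_⟩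
  rw [hi γ hγ] at h
  have := h2 γ hγ (by omega)
  rw [hi γ hγ, hi β hβ]
  omega

/-- Since r_k r_i r_l α_i = α_l, the members raised by i at the end are the images of those of B
raised by l. -/
lemma Raises.of_adj_adj' (hil : M.Adj i l) (hkl : k ≠ l) (hkl' : ¬ M.Adj k l) :
    Raises M i (s M l • s M i • s M k • B).1 := by
  have h' := hk.of_adj_adj hl hi hik hil hkl hkl'
  have hmem : ∀ γ, γ ∈ (s M l • s M i • s M k • B).1 ↔
      ∃ β ∈ B.1, γ = geom M (s M l) (geom M (s M i) (geom M (s M k) β)) := by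
    intro γ
    rw [mem_s_smul h'.not_mem]
    constructor
    · rintro ⟨β, hβ, rfl⟩
      obtain ⟨β, hβ', rfl⟩ := (mem_s_smul_smul hk.not_mem (hk.perp_adj hi hik).not_mem).mp hβ
      exact ⟨β, hβ', rfl⟩
    · rintro ⟨β, hβ, rfl⟩
      exact ⟨_, (mem_s_smul_smul hk.not_mem (hk.perp_adj hi hik).not_mem).mpr ⟨β, hβ, rfl⟩, rfl⟩
  refine raises_of_map _ hmem ?_
  simp only [form_geom_s_of_adj hil, form_geom_s_of_adj hil.symm, form_geom_s_of_adj hik,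
    form_geom_s_self, height_geom_s,
    form_geom_s_of_not_adj hkl.symm (mt SimpleGraph.Adj.symm hkl')]
  obtain ⟨y, hy, hy1, hy2, hy3⟩ := hl.exists_min
  have cy := form_cases_of_not_mem hk.not_mem hy
  have py := form_triple_cases hik hil hkl hkl' (B.2.pos y hy) (hi y hy)
  have hy0 := (B.2.pos y hy).height_pos
  refine ⟨y, hy, by rw [hi y hy]; omega, fun γ hγ h => ?_⟩
  rw [hi γ hγ] at h
  have hγl : form M (simpleRoot l) γ = 1 := by omega
  have cγ := form_cases_of_not_mem hk.not_mem hγ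
  have pγ := form_triple_cases hik hil hkl hkl' (B.2.pos γ hγ) (hi γ hγ)
  have h1 := hy3 γ hγ hγl
  have h2 := height_gap_two hy hγ hy1 hγl hil ((hi γ hγ).trans (hi y hy).symm)
  have h3 : form M (simpleRoot k) γ = 0 → form M (simpleRoot k) y = 0 → height y + 5 ≤ height γ :=
    fun h h' => height_gap_five hy hγ hy1 hγl hil hik hkl.symm (mt SimpleGraph.Adj.symm hkl')
      ((hi γ hγ).trans (hi y hy).symm) (h.trans h'.symm) (by omega)
  rw [hi γ hγ, hi y hy]
  omega

variable (hkl : M.Adj k l) (hil : i ≠ l) (hil' : ¬ M.Adj i l)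

include hkl hil hil'

/-- The exceptional difference 2α_k + α_i + α_l is excluded by a member y raised by l: y is
orthogonal to β and γ, but its product with this vector is 2(α_k, y) - 1, which is odd. -/
lemma height_gap_five_of_raises {β γ : Lat I} (hβ : β ∈ B.1) (hγ : γ ∈ B.1)
    (h1 : form M (simpleRoot k) β = -1) (h2 : form M (simpleRoot l) β = 0)
    (h3 : form M (simpleRoot k) γ = 1) (h4 : form M (simpleRoot l) γ = 0)
    (h : height β < height γ) : height β + 5 ≤ height γ := by
  refine (height_gap_five_or hβ hγ h1 h3 hik hkl.symm hil hil' ((hi γ hγ).trans (hi β hβ).symm)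
    (h4.trans h2.symm) h).resolve_right fun he => ?_
  obtain ⟨y, hy, hy1, -⟩ := hl
  have e1 : form M (γ - β) y = 0 := by
    rw [form_sub_left, B.2.orth γ hγ y hy (by rintro rfl; omega),
      B.2.orth β hβ y hy (by rintro rfl; omega), sub_zero]
  rw [he] at e1
  simp only [form_add_left, form_smul_left, hi y hy, hy1] at e1
  omega

lemma Raises.of_adj_path : Raises M l (s M i • s M k • B).1 := by
  refine raises_of_map _ (fun γ => mem_s_smul_smul hk.not_mem (hk.perp_adj hi hik).not_mem) ?_
  obtain ⟨β, hβ, h1, h2⟩ := exists_raised_of_pair hk hl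
    (fun δ hδ => (form_pair_cases hkl (B.2.pos δ hδ)).1)
    fun β hβ γ hγ => height_gap_five_of_raises hk hl hi hik hkl hil hil' hβ hγ
  simp only [form_geom_s_of_not_adj hil.symm (mt SimpleGraph.Adj.symm hil'),
    form_geom_s_of_adj hkl.symm, form_geom_s_of_adj hik, height_geom_s]
  refine ⟨β, hβ, by omega, fun γ hγ h => ?_⟩
  have := h2 γ hγ (by omega)
  rw [hi γ hγ, hi β hβ]
  omega

/-- The product of α_l with r_i r_k r_l β equals (α_k, β), so the members raised by l at the end are
the images of those of B raised by k. -/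
lemma Raises.of_adj_path' : Raises M l (s M i • s M k • s M l • B).1 := by
  have hkl1 : Raises M k (s M l • B).1 := hl.adj_left hk hkl.symm
  have hil1 : Perp M (simpleRoot i) (s M l • B).1 := hi.s_smul_of_not_adj hil'
  have hmem : ∀ γ, γ ∈ (s M i • s M k • s M l • B).1 ↔
      ∃ β ∈ B.1, γ = geom M (s M i) (geom M (s M k) (geom M (s M l) β)) := by
    intro γ
    rw [mem_s_smul (hkl1.perp_adj hil1 hik).not_mem]
    constructor
    · rintro ⟨β, hβ, rfl⟩
      obtain ⟨β, hβ', rfl⟩ := (mem_s_smul_smul hl.not_mem hkl1.not_mem).mp hβ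
      exact ⟨β, hβ', rfl⟩
    · rintro ⟨β, hβ, rfl⟩
      exact ⟨_, (mem_s_smul_smul hl.not_mem hkl1.not_mem).mpr ⟨β, hβ, rfl⟩, rfl⟩
  refine raises_of_map _ hmem ?_
  simp only [form_geom_s_of_not_adj hil.symm (mt SimpleGraph.Adj.symm hil'),
    form_geom_s_of_not_adj hil hil', form_geom_s_of_adj hkl, form_geom_s_of_adj hkl.symm,
    form_geom_s_of_adj hik, form_geom_s_self, height_geom_s]
  obtain ⟨x, hx, hx1, hx2, hx3⟩ := hk.exists_min
  have cx := form_cases_of_not_mem hl.not_mem hx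
  have px := (form_pair_cases hkl (B.2.pos x hx)).1
  refine ⟨x, hx, by omega, fun γ hγ h => ?_⟩
  have hγk : form M (simpleRoot k) γ = 1 := by omega
  have cγ := form_cases_of_not_mem hl.not_mem hγ
  have h1 := hx3 γ hγ hγk
  have h2 : form M (simpleRoot l) γ ≠ 1 := fun h => by
    have e : form M (simpleRoot k + simpleRoot l) (simpleRoot k + simpleRoot l) = 2 := by
      simp only [form_add_left, form_add_right, form_simpleRoot_self, form_simpleRoot_of_adj hkl,
        form_simpleRoot_of_adj hkl.symm]
      norm_num
    have := eq_of_form_eq_two e (B.2.pos γ hγ).form_self (by rw [form_add_left, h, hγk]; norm_num)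
    have h0 := hi γ hγ
    rw [← this, form_add_right, form_simpleRoot_of_adj hik, form_simpleRoot_of_not_adj hil hil'] at h0
    omega
  have h3 : form M (simpleRoot l) x = 0 → form M (simpleRoot l) γ = 0 → height x + 5 ≤ height γ :=
    fun h h' => height_gap_five_of_raises hk hl hi hik hkl hil hil' hx hγ hx1 h hγk h' (by omega)
  rw [hi γ hγ, hi x hx]
  omega

end Two

/-- If `j` raises `r_j B` and `α_i ⊥ B` with `i ∼ j`, then `i` raises `r_i r_j B`. -/
lemma Perp.raises_of_adj {i j : I} {B : Adm M} (hi : Perp M (simpleRoot i) B.1) (hij : M.Adj i j)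
    (hj : Raises M j (s M j • B).1) : Raises M i (s M i • s M j • B).1 := by
  have hB : s M j • s M j • B = B := by rw [smul_smul, s_mul_s, one_smul]
  -- Orthogonality of α_i to B transfers to orthogonality of r_j α_i = α_i + α_j to r_j B.
  have hform : ∀ β ∈ (s M j • B).1, form M (simpleRoot i) β = - form M (simpleRoot j) β := by
    intro β hβ
    have h := (mem_s_smul (B := s M j • B) hj.not_mem).mpr ⟨β, hβ, rfl⟩
    rw [hB] at h
    have := hi _ h
    rw [form_geom_s_of_adj hij] at this
    omega
  obtain ⟨x, hx, hx1, -, hx3⟩ := hj.exists_min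
  have hmem : simpleRoot i ∉ (s M j • B).1 := fun h => by
    have := hform _ h
    rw [form_simpleRoot_self, form_simpleRoot_of_adj hij.symm] at this
    omega
  rw [raises_s_smul_iff hmem]
  simp only [form_geom_s_self, height_geom_s]
  refine ⟨x, hx, by rw [hform x hx, hx1]; norm_num, fun γ hγ h => ?_⟩
  have h1 := hform x hx
  have h2 := hform γ hγ
  have := hx3 γ hγ (by omega)
  omega

/-- The three simple roots of a triangle would sum to a nonzero isotropic vector. -/
lemma not_adj_of_adj_adj {i j k : I} (hij : M.Adj i j) (hik : M.Adj i k) : ¬ M.Adj j k := fun h => by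
  have e : form M (simpleRoot i + simpleRoot j + simpleRoot k)
      (simpleRoot i + simpleRoot j + simpleRoot k) = 0 := by
    simp only [form_add_left, form_add_right, form_simpleRoot_self, form_simpleRoot_of_adj hij,
      form_simpleRoot_of_adj hij.symm, form_simpleRoot_of_adj hik, form_simpleRoot_of_adj hik.symm,
      form_simpleRoot_of_adj h, form_simpleRoot_of_adj h.symm]
    norm_num
  have := congrArg height (eq_zero_of_form_self e)
  rw [height_add, height_add, height_simpleRoot, height_simpleRoot, height_simpleRoot] at this
  simp [height] at this

end Nodes

section Nodes

variable {I : Type*} [Fintype I] {M : SimpleGraph I} [PosDef M]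

/-! ### The node of the highest element that belongs to an orthogonal node -/

/-- `TopNode B i j`: raising `B` to the top of its orbit turns the node `i` into `j`. -/
inductive TopNode (M : SimpleGraph I) [PosDef M] : Adm M → I → I → Prop
  | top {B : Adm M} (h : Terminal M B) (i : I) : TopNode M B i i
  | not_adj {B : Adm M} {i j k : I} : Raises M k B.1 → ¬ M.Adj k i →
      TopNode M (s M k • B) i j → TopNode M B i j
  | adj {B : Adm M} {i j k : I} : Raises M k B.1 → M.Adj k i →
      TopNode M (s M i • s M k • B) k j → TopNode M B i j

lemma exists_topNode {B : Adm M} {i : I} (hi : Perp M (simpleRoot i) B.1) :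
    ∃ j, TopNode M B i j := by
  revert i
  refine wellFounded_above.induction (C := fun B : Adm M => ∀ {i : I},
    Perp M (simpleRoot i) B.1 → ∃ j, TopNode M B i j) B fun B ih i hi => ?_
  by_cases hB : Terminal M B
  · exact ⟨i, .top hB i⟩
  simp only [Terminal] at hB
  push Not at hB
  obtain ⟨k, hk⟩ := hB
  by_cases hki : M.Adj k i
  · obtain ⟨j, hj⟩ := ih _ (hk.below.trans (hk.perp_adj hi hki.symm).below)
      (hi.s_smul_smul hki.symm)
    exact ⟨j, .adj hk hki hj⟩
  · obtain ⟨j, hj⟩ := ih _ hk.below (hi.s_smul_of_not_adj (mt SimpleGraph.Adj.symm hki))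
    exact ⟨j, .not_adj hk hki hj⟩

/-- The node that `TopNode` assigns to `(B, i)` is determined. -/
def UniqueTop (M : SimpleGraph I) [PosDef M] (B : Adm M) : Prop :=
  ∀ i, Perp M (simpleRoot i) B.1 → ∀ j j', TopNode M B i j → TopNode M B i j' → j = j'

/-- Uniqueness allows the top node to be read through any raising node, not only the one with which
a given derivation begins. -/
lemma UniqueTop.up_not_adj {B : Adm M} (hB : UniqueTop M B) {i j k : I}
    (hi : Perp M (simpleRoot i) B.1) (hk : Raises M k B.1) (hki : ¬ M.Adj k i)
    (h : TopNode M B i j) : TopNode M (s M k • B) i j := by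
  obtain ⟨j', hj'⟩ := exists_topNode (hi.s_smul_of_not_adj (mt SimpleGraph.Adj.symm hki))
  rwa [hB i hi j j' h (.not_adj hk hki hj')]

lemma UniqueTop.up_adj {B : Adm M} (hB : UniqueTop M B) {i j k : I}
    (hi : Perp M (simpleRoot i) B.1) (hk : Raises M k B.1) (hki : M.Adj k i)
    (h : TopNode M B i j) : TopNode M (s M i • s M k • B) k j := by
  obtain ⟨j', hj'⟩ := exists_topNode (hi.s_smul_smul hki.symm)
  rwa [hB i hi j j' h (.adj hk hki hj')]

lemma s_smul_of_perp {i : I} {B : Adm M} (hi : Perp M (simpleRoot i) B.1) : s M i • B = B := by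
  rw [← reflW_simpleRoot, reflW_smul_of_perp (isRoot_simpleRoot i) hi]

lemma s_smul_s_smul (i : I) (B : Adm M) : s M i • s M i • B = B := by
  rw [smul_smul, s_mul_s, one_smul]

/-- Frees the argument from the direction of the step: k may raise B, lower it or fix it. In the
lowering case the constructor itself leads back to B. -/
lemma UniqueTop.move {B : Adm M} (hB : UniqueTop M B) {i j k : I}
    (hi : Perp M (simpleRoot i) B.1) (hki : ¬ M.Adj k i)
    (h : TopNode M B i j) : TopNode M (s M k • B) i j := by
  by_cases hk : simpleRoot k ∈ B.1
  · rwa [s_smul_of_pm (Or.inl hk)]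
  by_cases hp : Perp M (simpleRoot k) B.1
  · rwa [s_smul_of_perp hp]
  rcases raises_or_raises hk hp with h' | h'
  · exact hB.up_not_adj hi h' hki h
  · exact .not_adj h' hki (by rwa [s_smul_s_smul])

/-- If k lowers B instead, then i raises r_i r_k B by `Perp.raises_of_adj`, and the step from the
node k by i leads back to B and i. -/
lemma UniqueTop.move_adj {B : Adm M} (hB : UniqueTop M B) {i j k : I}
    (hi : Perp M (simpleRoot i) B.1) (hki : M.Adj k i) (hk : ¬ Perp M (simpleRoot k) B.1)
    (h : TopNode M B i j) : TopNode M (s M i • s M k • B) k j := by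
  have hk' : simpleRoot k ∉ B.1 := fun hk' => by
    have := hi _ hk'
    rw [form_simpleRoot_of_adj hki.symm] at this
    omega
  rcases raises_or_raises hk' hk with h' | h'
  · exact hB.up_adj hi h' hki h
  · refine .adj (hi.raises_of_adj hki.symm h') hki.symm ?_
    rwa [s_smul_s_smul, s_smul_s_smul]

lemma s_smul_s_smul_comm {i j : I} (h : ¬ M.Adj i j) (B : Adm M) :
    s M i • s M j • B = s M j • s M i • B := by
  rw [smul_smul, smul_smul, s_comm h]

lemma s_smul_braid {i j : I} (h : M.Adj i j) (B : Adm M) :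
    s M i • s M j • s M i • B = s M j • s M i • s M j • B := by
  simp only [smul_smul, s_braid h]

/-- What `TopNode.not_adj` and `TopNode.adj` prescribe for a raising node `k`. -/
def TopVia (M : SimpleGraph I) [PosDef M] (B : Adm M) (k i j : I) : Prop :=
  (¬ M.Adj k i ∧ TopNode M (s M k • B) i j) ∨ (M.Adj k i ∧ TopNode M (s M i • s M k • B) k j)

lemma TopNode.exists_via {B : Adm M} {i j k : I} (hk : Raises M k B.1) (h : TopNode M B i j) :
    ∃ l, Raises M l B.1 ∧ TopVia M B l i j := by
  cases h with
  | top h => exact absurd hk (h k)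
  | not_adj h1 h2 h3 => exact ⟨_, h1, Or.inl ⟨h2, h3⟩⟩
  | adj h1 h2 h3 => exact ⟨_, h1, Or.inr ⟨h2, h3⟩⟩

/-! ### Independence of the raising path -/

section Diamond

variable {B : Adm M} {i j k l : I} (ih : ∀ B' : Adm M, Below B.1 B'.1 → UniqueTop M B')
  (hi : Perp M (simpleRoot i) B.1) (hk : Raises M k B.1) (hl : Raises M l B.1)

include ih hi hk hl

lemma topNode_diamond_adj (hkl : M.Adj k l) (hki : ¬ M.Adj k i) (hli : ¬ M.Adj l i)
    (h : TopNode M (s M k • B) i j) : TopNode M (s M k • s M l • s M k • B) i j := by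
  have h1 := hk.adj_left hl hkl
  have hi1 := hi.s_smul_of_not_adj (mt SimpleGraph.Adj.symm hki)
  have hi2 := hi1.s_smul_of_not_adj (mt SimpleGraph.Adj.symm hli)
  refine UniqueTop.move (ih _ (hk.below.trans h1.below)) hi2 hki ?_
  exact UniqueTop.move (ih _ hk.below) hi1 hli h

/-- For k - i - l the node travels i, k, k, i up to a set that is symmetric in k and l by the braid
and commutation relations. -/
lemma topNode_diamond_fork (hik : M.Adj i k) (hil : M.Adj i l) (hkl : k ≠ l) (hkl' : ¬ M.Adj k l)
    (h : TopNode M (s M i • s M k • B) k j) :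
    TopNode M (s M k • s M i • s M l • s M i • s M k • B) i j := by
  have h1 := hk.perp_adj hi hik
  have h2 := hk.of_adj_adj hl hi hik hil hkl hkl'
  have h3 := hk.of_adj_adj' hl hi hik hil hkl hkl'
  have p1 := hi.s_smul_smul hik
  have p2 := p1.s_smul_of_not_adj hkl'
  refine UniqueTop.up_adj (ih _ ((hk.below.trans h1.below).trans h2.below)) p2 h3 hik ?_
  exact UniqueTop.move (ih _ (hk.below.trans h1.below)) p1 (mt SimpleGraph.Adj.symm hkl') h

/-- For i - k - l both routes end at r_i r_k r_l r_i r_k B = r_k r_l r_i r_k r_l B, and both carry i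
to l. -/
lemma topNode_diamond_path (hik : M.Adj i k) (hkl : M.Adj k l) (hil : i ≠ l) (hil' : ¬ M.Adj i l)
    (j' : I) (h : TopNode M (s M i • s M k • B) k j) (h' : TopNode M (s M l • B) i j') :
    j = j' := by
  have a1 := hk.perp_adj hi hik
  have a2 := hk.of_adj_path hl hi hik hkl hil hil'
  have p1 := hi.s_smul_smul hik
  have a3 := a2.perp_adj p1 hkl
  have p2 := p1.s_smul_smul hkl
  have b1 := hl.adj_left hk hkl.symm
  have q1 := hi.s_smul_of_not_adj hil'
  have b2 := b1.perp_adj q1 hik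
  have b3 := hk.of_adj_path' hl hi hik hkl hil hil'
  have q2 := q1.s_smul_smul hik
  have b4 := b3.perp_adj q2 hkl
  have q3 := q2.s_smul_smul hkl
  have ba := (hk.below.trans a1.below).trans a2.below
  have bb := ((hl.below.trans b1.below).trans b2.below).trans b3.below
  have t1 : TopNode M (s M i • s M k • s M l • s M i • s M k • B) l j := by
    refine UniqueTop.move (ih _ (ba.trans a3.below)) p2 hil' ?_
    exact UniqueTop.up_adj (ih _ (hk.below.trans a1.below)) p1 a2 hkl.symm h
  have t2 : TopNode M (s M k • s M l • s M i • s M k • s M l • B) l j' := by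
    refine UniqueTop.up_adj (ih _ ((hl.below.trans b1.below).trans b2.below)) q2 b3 hkl.symm ?_
    exact UniqueTop.up_adj (ih _ hl.below) q1 b1 hik.symm h'
  have e : s M i • s M k • s M l • s M i • s M k • B = s M k • s M l • s M i • s M k • s M l • B := by
    rw [s_smul_s_smul_comm (mt SimpleGraph.Adj.symm hil'), s_smul_braid hik, s_smul_braid hkl,
      s_smul_s_smul_comm hil']
  rw [e] at t1
  exact ih _ (bb.trans b4.below) _ q3 _ _ t1 t2

/-- Two nodes that raise `B` prescribe the same value. -/
lemma topVia_unique {j' : I} (h : TopVia M B k i j) (h' : TopVia M B l i j') : j = j' := by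
  have ms {a b : I} (h : ¬ M.Adj a b) : ¬ M.Adj b a := mt SimpleGraph.Adj.symm h
  rcases eq_or_ne k l with rfl | hne
  · rcases h with ⟨h1, h⟩ | ⟨h1, h⟩ <;> rcases h' with ⟨h2, h'⟩ | ⟨h2, h'⟩
    · exact ih _ hk.below _ (hi.s_smul_of_not_adj (ms h1)) _ _ h h'
    · exact absurd h2 h1
    · exact absurd h1 h2
    · exact ih _ (hk.below.trans (hk.perp_adj hi h1.symm).below) _ (hi.s_smul_smul h1.symm) _ _ h h'
  by_cases hkl : M.Adj k l
  · rcases h with ⟨h1, h⟩ | ⟨h1, h⟩ <;> rcases h' with ⟨h2, h'⟩ | ⟨h2, h'⟩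
    · have t1 := topNode_diamond_adj ih hi hk hl hkl h1 h2 h
      have t2 := topNode_diamond_adj ih hi hl hk hkl.symm h2 h1 h'
      rw [← s_smul_braid hkl] at t2
      exact ih _ ((hk.below.trans (hk.adj_left hl hkl).below).trans (hk.adj_right hl hkl).below) _
        (((hi.s_smul_of_not_adj (ms h1)).s_smul_of_not_adj (ms h2)).s_smul_of_not_adj (ms h1))
        _ _ t1 t2
    · exact (topNode_diamond_path ih hi hl hk h2.symm hkl.symm
        (fun e => hk.not_perp (e ▸ hi)) (ms h1) _ h' h).symm
    · exact topNode_diamond_path ih hi hk hl h1.symm hkl (fun e => hl.not_perp (e ▸ hi)) (ms h2) _ h h'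
    · exact absurd hkl (not_adj_of_adj_adj h1.symm h2.symm)
  · have tie (hadj : M.Adj k i ∨ M.Adj l i) :
        ¬ ∃ β ∈ B.1, β + simpleRoot k + simpleRoot l ∈ B.1 := by
      rintro ⟨β, hβ, hγ⟩
      have := hi _ hγ
      rw [form_add_right, form_add_right, hi β hβ] at this
      have c1 := form_simpleRoot_mem (M := M) (i := i) (j := k)
      have c2 := form_simpleRoot_mem (M := M) (i := i) (j := l)
      have n1 : i ≠ k := fun e => hk.not_perp (e ▸ hi)
      have n2 : i ≠ l := fun e => hl.not_perp (e ▸ hi)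
      rcases hadj with hadj | hadj
      · rw [form_simpleRoot_of_adj hadj.symm] at this
        omega
      · rw [form_simpleRoot_of_adj hadj.symm] at this
        omega
    rcases h with ⟨h1, h⟩ | ⟨h1, h⟩ <;> rcases h' with ⟨h2, h'⟩ | ⟨h2, h'⟩
    · rcases hk.not_adj hl hne hkl with ⟨β, hβ, hγ⟩ | h3
      · rw [s_smul_eq_of_mem hne hkl hβ hγ] at h
        exact ih _ hl.below _ (hi.s_smul_of_not_adj (ms h2)) _ _ h h'
      · have t1 := UniqueTop.move (ih _ hk.below) (hi.s_smul_of_not_adj (ms h1)) h2 h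
        have t2 := UniqueTop.move (ih _ hl.below) (hi.s_smul_of_not_adj (ms h2)) h1 h'
        rw [s_smul_s_smul_comm hkl] at t2
        exact ih _ (hk.below.trans h3.below) _
          ((hi.s_smul_of_not_adj (ms h1)).s_smul_of_not_adj (ms h2)) _ _ t1 t2
    · have h3 := (hk.not_adj hl hne hkl).resolve_left (tie (Or.inr h2))
      have q := hi.s_smul_of_not_adj (ms h1)
      have t1 := UniqueTop.up_adj (ih _ hk.below) q h3 h2 h
      have t2 := UniqueTop.move (ih _ (hl.below.trans (hl.perp_adj hi h2.symm).below))
        (hi.s_smul_smul h2.symm) hkl h'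
      rw [s_smul_s_smul_comm h1, s_smul_s_smul_comm hkl] at t2
      exact ih _ ((hk.below.trans h3.below).trans (h3.perp_adj q h2.symm).below) _
        (q.s_smul_smul h2.symm) _ _ t1 t2
    · have h3 := (hl.not_adj hk hne.symm (ms hkl)).resolve_left fun ⟨β, hβ, hγ⟩ =>
        tie (Or.inl h1) ⟨β, hβ, by rwa [add_right_comm]⟩
      have q := hi.s_smul_of_not_adj (ms h2)
      have t1 := UniqueTop.up_adj (ih _ hl.below) q h3 h1 h'
      have t2 := UniqueTop.move (ih _ (hk.below.trans (hk.perp_adj hi h1.symm).below))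
        (hi.s_smul_smul h1.symm) (ms hkl) h
      rw [s_smul_s_smul_comm h2, s_smul_s_smul_comm (ms hkl)] at t2
      exact ih _ ((hl.below.trans h3.below).trans (h3.perp_adj q h1.symm).below) _
        (q.s_smul_smul h1.symm) _ _ t2 t1
    · have t1 := topNode_diamond_fork ih hi hk hl h1.symm h2.symm hne hkl h
      have t2 := topNode_diamond_fork ih hi hl hk h2.symm h1.symm hne.symm (ms hkl) h'
      have e : s M k • s M i • s M l • s M i • s M k • B = s M l • s M i • s M k • s M i • s M l • B := by
        rw [s_smul_braid h2.symm, s_smul_s_smul_comm (ms hkl), s_smul_s_smul_comm hkl,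
          s_smul_braid h1]
      rw [← e] at t2
      have c1 := hk.perp_adj hi h1.symm
      have c2 := hk.of_adj_adj hl hi h1.symm h2.symm hne hkl
      have c3 := hk.of_adj_adj' hl hi h1.symm h2.symm hne hkl
      have p := (hi.s_smul_smul h1.symm).s_smul_of_not_adj hkl
      exact ih _ ((((hk.below.trans c1.below).trans c2.below).trans c3.below).trans
        (c3.perp_adj p h1).below) _ (p.s_smul_smul h1) _ _ t1 t2

end Diamond

lemma uniqueTop (B : Adm M) : UniqueTop M B := by
  refine wellFounded_above.induction (C := fun B : Adm M => UniqueTop M B) B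
    fun B ih i hi j j' h h' => ?_
  by_cases hB : Terminal M B
  · have key : ∀ j, TopNode M B i j → j = i := fun j h => by
      cases h with
      | top => rfl
      | not_adj h => exact absurd h (hB _)
      | adj h => exact absurd h (hB _)
    rw [key j h, key j' h']
  · simp only [Terminal] at hB
    push Not at hB
    obtain ⟨k, hk⟩ := hB
    obtain ⟨l, hl, hv⟩ := h.exists_via hk
    obtain ⟨l', hl', hv'⟩ := h'.exists_via hk
    exact topVia_unique (fun B' h => ih B' h) hi hl hl' hv hv'

/-- Places the top node in C, so that the values h_{B,i} lie in W(C). -/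
lemma TopNode.perp_top {B T : Adm M} {i j : I} (h : TopNode M B i j)
    (hi : Perp M (simpleRoot i) B.1) (hT : Terminal M T)
    (hBT : Relation.ReflTransGen (Step M) B T) : Perp M (simpleRoot j) T.1 := by
  induction h with
  | top h i =>
    rwa [(existsUnique_terminal _).unique ⟨hT, hBT⟩ ⟨h, .refl⟩]
  | not_adj _ h _ ih =>
    exact ih (hi.s_smul_of_not_adj (mt SimpleGraph.Adj.symm h)) (terminal_s_smul _ hT hBT)
  | adj _ h _ ih =>
    exact ih (hi.s_smul_smul h.symm) (terminal_s_smul _ hT (terminal_s_smul _ hT hBT))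

/-- Passing to the top preserves adjacency and non-adjacency. -/
lemma TopNode.adj_iff {B : Adm M} {i j p q : I} (hi : Perp M (simpleRoot i) B.1)
    (hj : Perp M (simpleRoot j) B.1) (hp : TopNode M B i p) (hq : TopNode M B j q) :
    M.Adj p q ↔ M.Adj i j := by
  revert i j p q
  refine wellFounded_above.induction (C := fun B : Adm M => ∀ {i j p q : I},
    Perp M (simpleRoot i) B.1 → Perp M (simpleRoot j) B.1 → TopNode M B i p → TopNode M B j q →
    (M.Adj p q ↔ M.Adj i j)) B fun B ih i j p q hi hj hp hq => ?_
  have ms {a b : I} (h : ¬ M.Adj a b) : ¬ M.Adj b a := mt SimpleGraph.Adj.symm h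
  by_cases hB : Terminal M B
  · rw [uniqueTop B i hi p i hp (.top hB i), uniqueTop B j hj q j hq (.top hB j)]
  simp only [Terminal] at hB
  push Not at hB
  obtain ⟨k, hk⟩ := hB
  -- The node k meets i but not j. If i ∼ j, the pair (i, j) becomes (k, i) over r_j r_i r_k B;
  -- otherwise it becomes (k, j) over r_i r_k B. Adjacency agrees in both cases.
  have fork : ∀ {i j p q : I}, Perp M (simpleRoot i) B.1 → Perp M (simpleRoot j) B.1 →
      TopNode M B i p → TopNode M B j q → M.Adj k i → ¬ M.Adj k j →
      (M.Adj p q ↔ M.Adj i j) := by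
    intro i j p q hi hj hp hq hki hkj
    have r := hk.perp_adj hi hki.symm
    have b := hk.below.trans r.below
    have p1 := hi.s_smul_smul hki.symm
    have q1 := hj.s_smul_of_not_adj (ms hkj)
    have t1 := (uniqueTop B).move_adj hi hki hk.not_perp hp
    have t2 := (uniqueTop B).move hj hkj hq
    by_cases hij : M.Adj i j
    · have r1 := r.perp_adj q1 hij.symm
      have := ih _ (b.trans r1.below) (p1.s_smul_of_not_adj hkj) (q1.s_smul_smul hij.symm)
        ((uniqueTop _).move p1 (ms hkj) t1) ((uniqueTop _).up_adj q1 r hij t2)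
      rw [this]
      exact iff_of_true hki hij
    · have := ih _ b p1 (q1.s_smul_of_not_adj (ms hij)) t1 ((uniqueTop _).move q1 hij t2)
      rw [this]
      exact iff_of_false hkj hij
  by_cases hki : M.Adj k i <;> by_cases hkj : M.Adj k j
  · have hij := not_adj_of_adj_adj hki hkj
    refine iff_of_false ?_ hij
    rcases eq_or_ne i j with rfl | hne
    · rw [uniqueTop B i hi p q hp hq]
      exact M.loopless.irrefl q
    have r := hk.perp_adj hi hki.symm
    have r' := hk.perp_adj hj hkj.symm
    have p1 := hi.s_smul_smul hki.symm
    have q1 := hj.s_smul_smul hkj.symm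
    have t1 := (uniqueTop B).up_adj hi hk hki hp
    have t2 := (uniqueTop B).up_adj hj hk hkj hq
    -- When both nodes lead to the same set, both have become k there, so the top nodes coincide.
    -- Otherwise two further steps turn the pair (i, j) into (j, i) over a common higher set.
    have same : s M i • s M k • B = s M j • s M k • B → ¬ M.Adj p q := fun h => by
      rw [h] at t1 p1
      rw [uniqueTop _ _ p1 p q t1 t2]
      exact M.loopless.irrefl q
    rcases r.not_adj r' hne hij with ⟨β, hβ, hγ⟩ | h1
    · exact same (s_smul_eq_of_mem hne hij hβ hγ)
    rcases r'.not_adj r hne.symm (ms hij) with ⟨β, hβ, hγ⟩ | h2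
    · exact same (s_smul_eq_of_mem hne.symm (ms hij) hβ hγ).symm
    have u1 := (uniqueTop _).up_adj p1 h1 hkj.symm t1
    have u2 := (uniqueTop _).up_adj q1 h2 hki.symm t2
    rw [← s_smul_s_smul_comm hij] at u1
    have h3 := h2.perp_adj q1 hki
    have b := ((hk.below.trans r'.below).trans h2.below).trans h3.below
    have p2 := p1.s_smul_smul hkj
    rw [← s_smul_s_smul_comm hij] at p2
    rw [ih _ b p2 (q1.s_smul_smul hki) u1 u2]
    exact ms hij
  · exact fork hi hj hp hq hki hkj
  · rw [M.adj_comm, M.adj_comm i]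
    exact fork hj hi hq hp hkj hki
  · exact ih _ hk.below (hi.s_smul_of_not_adj (ms hki)) (hj.s_smul_of_not_adj (ms hkj))
      ((uniqueTop B).move hi hki hp) ((uniqueTop B).move hj hkj hq)

/-! ### The elements `h_{B,i}` -/

open Classical in
/-- The element `h_{B,i}`, in `W(M)`. -/
def hElt (B : Adm M) (i : I) : W M :=
  if h : Perp M (simpleRoot i) B.1 then s M (exists_topNode h).choose else 1

lemma hElt_of_not_perp {B : Adm M} {i : I} (h : ¬ Perp M (simpleRoot i) B.1) : hElt B i = 1 :=
  dif_neg h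

lemma TopNode.hElt {B : Adm M} {i j : I} (h : TopNode M B i j)
    (hi : Perp M (simpleRoot i) B.1) : hElt B i = s M j := by
  rw [BrauerADE.hElt, dif_pos hi, uniqueTop B i hi _ j (exists_topNode hi).choose_spec h]

lemma hElt_move {B : Adm M} {i k : I} (hi : Perp M (simpleRoot i) B.1) (hki : ¬ M.Adj k i) :
    hElt (s M k • B) i = hElt B i := by
  obtain ⟨j, hj⟩ := exists_topNode hi
  rw [hj.hElt hi, ((uniqueTop B).move hi hki hj).hElt
    (hi.s_smul_of_not_adj (mt SimpleGraph.Adj.symm hki))]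

lemma hElt_move_adj {B : Adm M} {i k : I} (hi : Perp M (simpleRoot i) B.1) (hki : M.Adj k i)
    (hk : ¬ Perp M (simpleRoot k) B.1) : hElt (s M i • s M k • B) k = hElt B i := by
  obtain ⟨j, hj⟩ := exists_topNode hi
  rw [hj.hElt hi, ((uniqueTop B).move_adj hi hki hk hj).hElt (hi.s_smul_smul hki.symm)]

/-! ### The cocycle identities for h_{B,i} -/

lemma hElt_mul_self (B : Adm M) (i : I) : hElt (s M i • B) i * hElt B i = 1 := by
  by_cases hi : Perp M (simpleRoot i) B.1
  · obtain ⟨j, hj⟩ := exists_topNode hi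
    rw [s_smul_of_perp hi, hj.hElt hi, s_mul_s]
  · rw [hElt_of_not_perp hi, mul_one, hElt_of_not_perp]
    intro h
    have := s_smul_s_smul i B
    rw [s_smul_of_perp h] at this
    rw [this] at h
    exact hi h

lemma hElt_comm (B : Adm M) {i j : I} (hij : ¬ M.Adj i j) :
    hElt (s M j • B) i * hElt B j = hElt (s M i • B) j * hElt B i := by
  have ms {a b : I} (h : ¬ M.Adj a b) : ¬ M.Adj b a := mt SimpleGraph.Adj.symm h
  have np {a b : I} (hab : ¬ M.Adj a b) (ha : ¬ Perp M (simpleRoot a) B.1) :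
      hElt (s M b • B) a = 1 := hElt_of_not_perp fun h => ha <| by
    rw [← s_smul_s_smul b B]
    exact h.s_smul_of_not_adj hab
  by_cases hi : Perp M (simpleRoot i) B.1 <;> by_cases hj : Perp M (simpleRoot j) B.1
  · obtain ⟨p, hp⟩ := exists_topNode hi
    obtain ⟨q, hq⟩ := exists_topNode hj
    rw [s_smul_of_perp hi, s_smul_of_perp hj, hp.hElt hi, hq.hElt hj,
      s_comm (mt (hp.adj_iff hi hj hq).mp hij)]
  · rw [hElt_move hi (ms hij), hElt_of_not_perp hj, np (ms hij) hj, mul_one, one_mul]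
  · rw [hElt_move hj hij, hElt_of_not_perp hi, np hij hi, mul_one, one_mul]
  · rw [np hij hi, np (ms hij) hj, hElt_of_not_perp hi, hElt_of_not_perp hj]

lemma perp_s_smul_iff {i j : I} (hij : M.Adj i j) (B : Adm M) :
    Perp M (simpleRoot i) (s M j • B).1 ↔ Perp M (simpleRoot i + simpleRoot j) B.1 := by
  have key : ∀ w : W M, ∀ x, ∀ B : Adm M, Perp M x B.1 → Perp M (geom M w x) (w • B).1 := by
    rintro w x B h _ ⟨-, β, hβ, rfl | rfl⟩
    · rw [form_geom, h β hβ]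
    · rw [form_neg_right, form_geom, h β hβ, neg_zero]
  have e : geom M (s M j) (simpleRoot i) = simpleRoot i + simpleRoot j := by
    rw [geom_s_apply, form_simpleRoot_of_adj hij]; module
  constructor
  · intro h
    have := key (s M j) _ _ h
    rwa [e, s_smul_s_smul] at this
  · intro h
    have := key (s M j) _ _ h
    rwa [← e, ← geom_mul_apply, s_mul_s, geom_one_apply] at this

lemma hElt_braid (B : Adm M) {i j : I} (hij : M.Adj i j) :
    hElt (s M j • s M i • B) i * (hElt (s M i • B) j * hElt B i) =
      hElt (s M i • s M j • B) j * (hElt (s M j • B) i * hElt B j) := by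
  -- With only α_i orthogonal to B, all other factors are trivial and the identity reduces to the
  -- transport rule h_{r_i r_j B, j} = h_{B,i}.
  have mixed : ∀ {i j : I}, M.Adj i j → Perp M (simpleRoot i) B.1 → ¬ Perp M (simpleRoot j) B.1 →
      hElt (s M j • s M i • B) i * (hElt (s M i • B) j * hElt B i) =
      hElt (s M i • s M j • B) j * (hElt (s M j • B) i * hElt B j) := by
    intro i j hij hi hj
    have h1 : hElt (s M j • B) i = 1 := hElt_of_not_perp fun h => hj fun β hβ => by
      have := (perp_s_smul_iff hij B).mp h β hβ
      rwa [form_add_left, hi β hβ, zero_add] at this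
    rw [s_smul_of_perp hi, h1, hElt_of_not_perp hj, hElt_move_adj hi hij.symm hj]
    simp
  by_cases hi : Perp M (simpleRoot i) B.1 <;> by_cases hj : Perp M (simpleRoot j) B.1
  · obtain ⟨p, hp⟩ := exists_topNode hi
    obtain ⟨q, hq⟩ := exists_topNode hj
    simp only [s_smul_of_perp hi, s_smul_of_perp hj, hp.hElt hi, hq.hElt hj]
    exact s_braid ((hp.adj_iff hi hj hq).mpr hij)
  · exact mixed hij hi hj
  · exact (mixed hij.symm hj hi).symm
  -- With neither orthogonal, the outer factors are trivial because r_i r_j α_i = α_j. The middle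
  -- factors are nontrivial only when α_i + α_j ⊥ B, and then they are related by the transport
  -- rule.
  · have h1 : ∀ {i j : I}, M.Adj i j → ¬ Perp M (simpleRoot i) B.1 → ¬ Perp M (simpleRoot j) B.1 →
        hElt (s M j • s M i • B) i = 1 := by
      intro i j hij hi hj
      refine hElt_of_not_perp fun h => hj ?_
      rw [perp_s_smul_iff hij] at h
      have e : geom M (s M i) (simpleRoot i + simpleRoot j) = simpleRoot j := by
        rw [geom_s_apply, form_add_left, form_simpleRoot_self, form_simpleRoot_of_adj hij.symm]
        module
      intro β hβ
      have hβi : geom M (s M i) β ∈ (s M i • B).1 ∨ -geom M (s M i) β ∈ (s M i • B).1 :=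
        pm_smul.mpr (by rw [geom_inv_geom]; exact Or.inl hβ)
      rw [← form_geom (s M i), ← e, ← geom_mul_apply, s_mul_s, geom_one_apply]
      rcases hβi with h' | h'
      · exact h _ h'
      · have := h _ h'
        rwa [form_neg_right, neg_eq_zero] at this
    rw [h1 hij hi hj, h1 hij.symm hj hi, hElt_of_not_perp hi, hElt_of_not_perp hj, mul_one, mul_one,
      one_mul, one_mul]
    by_cases h : Perp M (simpleRoot j) (s M i • B).1
    · have hi' : ¬ Perp M (simpleRoot i) (s M i • B).1 := fun h => hi <| by
        have e := s_smul_s_smul i B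
        rw [s_smul_of_perp h] at e
        rwa [e] at h
      have := hElt_move_adj h hij hi'
      rw [s_smul_s_smul] at this
      exact this.symm
    · have h' : ¬ Perp M (simpleRoot i) (s M j • B).1 := by
        rwa [perp_s_smul_iff hij, add_comm, ← perp_s_smul_iff hij.symm]
      rw [hElt_of_not_perp h, hElt_of_not_perp h']

/-! ### The family `h` -/

lemma hElt_mem {X : Adm M} {B₀ : Orbit M X} (h₀ : IsHighest B₀) (B : Orbit M X) (i : I) :
    hElt B.1 i ∈ WC M B₀.1.1 := by
  by_cases hi : Perp M (simpleRoot i) B.1.1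
  · obtain ⟨j, hj⟩ := exists_topNode hi
    rw [hj.hElt hi]
    exact Subgroup.subset_closure ⟨j, hj.perp_top hi h₀.terminal (h₀.steps B), rfl⟩
  · rw [hElt_of_not_perp hi]
    exact one_mem _

lemma isH_hElt {X : Adm M} {B₀ : Orbit M X} (h₀ : IsHighest B₀) :
    IsH M B₀ fun B i => ⟨hElt B.1 i, hElt_mem h₀ B i⟩ where
  top i hi := (TopNode.top h₀.terminal i).hElt hi
  not_perp B i hi := Subtype.ext (hElt_of_not_perp hi)
  not_adj B B' i k hi _ hki hB' := Subtype.ext <| by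
    obtain rfl : B' = s M k • B := Subtype.ext (Subtype.ext hB')
    exact (hElt_move hi hki).symm
  adj B B' i k hi hk hki hB' := Subtype.ext <| by
    obtain rfl : B' = s M i • s M k • B :=
      Subtype.ext (Subtype.ext (by rw [hB', orbit_smul_val, orbit_smul_val, smul_smul]; rfl))
    exact (hElt_move_adj hi hki hk.not_perp).symm

/-- The clauses of `IsH` mirror the constructors of `TopNode`, so a derivation of the top node
computes any such family. -/
lemma IsH.eq_hElt {X : Adm M} {B₀ : Orbit M X} (h₀ : IsHighest B₀) {h : Orbit M X → I → WC M B₀.1.1}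
    (hh : IsH M B₀ h) (B : Orbit M X) (i : I) : (h B i : W M) = hElt B.1 i := by
  by_cases hi : Perp M (simpleRoot i) B.1.1
  · obtain ⟨j, hj⟩ := exists_topNode hi
    rw [hj.hElt hi]
    suffices ∀ A : Adm M, TopNode M A i j → ∀ B : Orbit M X, B.1 = A →
        Perp M (simpleRoot i) B.1.1 → (h B i : W M) = s M j from this _ hj B rfl hi
    clear hi hj B
    intro A hA
    induction hA with
    | top hT i =>
      rintro B rfl hi
      have : B = B₀ := Subtype.ext <| (existsUnique_terminal B.1).unique ⟨hT, .refl⟩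
        ⟨h₀.terminal, h₀.steps B⟩
      rw [this] at hi ⊢
      exact hh.top i hi
    | @not_adj A i j k hk hki _ ih =>
      rintro B rfl hi
      rw [hh.not_adj B (s M k • B) i k hi hk hki rfl]
      exact ih _ rfl (hi.s_smul_of_not_adj (mt SimpleGraph.Adj.symm hki))
    | @adj A i j k hk hki _ ih =>
      rintro B rfl hi
      have hB : (s M i • s M k • B).1.1 = act M (s M i * s M k) B.1.1 := by
        rw [smul_smul]; rfl
      rw [hh.adj B (s M i • s M k • B) i k hi hk hki hB]
      exact ih _ rfl (hi.s_smul_smul hki.symm)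
  · rw [hh.not_perp B i hi, hElt_of_not_perp hi]
    rfl

lemma existsUnique_isH {X : Adm M} {B₀ : Orbit M X} (h₀ : IsHighest B₀) : ∃! h, IsH M B₀ h :=
  ⟨_, isH_hElt h₀, fun _ hh => funext fun B => funext fun i => Subtype.ext (hh.eq_hElt h₀ B i)⟩

end Nodes

section WRep

variable {I : Type*} [Fintype I] {M : SimpleGraph I} [PosDef M] {X : Adm M} {B₀ : Orbit M X}

/-! ### The right module `V` -/

/-- The endomorphism of `V` with prescribed values on the basis. -/
def endOfBasis (B₀ : Orbit M X) (v : Orbit M X → V M B₀) : EndV M B₀ :=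
  Finsupp.lsum ℕ fun B =>
    { toFun := fun a => v B <• a
      map_add' := fun a b => by rw [MulOpposite.op_add, add_smul]
      map_smul' := fun c a => by
        rw [RingHom.id_apply, ← mul_smul]
        rfl }

lemma endOfBasis_xi (v : Orbit M X → V M B₀) (B : Orbit M X) :
    endOfBasis B₀ v (xi M B₀ B) = v B := by
  simp [endOfBasis, xi]

lemma endV_ext {f g : EndV M B₀} (h : ∀ B, f (xi M B₀ B) = g (xi M B₀ B)) : f = g := by
  refine LinearMap.toAddMonoidHom_injective (Finsupp.addHom_ext fun B a => ?_)
  have e : (Finsupp.single B a : V M B₀) = xi M B₀ B <• a := by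
    rw [xi, Finsupp.smul_single, op_smul_eq_mul, one_mul]
  change f (Finsupp.single B a) = g (Finsupp.single B a)
  rw [e, map_smul, map_smul, h]

lemma smul_coeffW_smul (v : V M B₀) (g g' : WC M B₀.1.1) :
    (v <• coeffW M B₀.1.1 g) <• coeffW M B₀.1.1 g' = v <• coeffW M B₀.1.1 (g * g') := by
  rw [smul_smul, ← MulOpposite.op_mul, coeffW, coeffW, coeffW, map_mul]

lemma smul_coeffW_one (v : V M B₀) : v <• coeffW M B₀.1.1 1 = v := by
  rw [coeffW, map_one, MulOpposite.op_one, one_smul]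

/-! ### The representation of `W` -/

/-- The element `h_{B,i}`, in `W(C)`. -/
def hC (h₀ : IsHighest B₀) (B : Orbit M X) (i : I) : WC M B₀.1.1 := ⟨hElt B.1 i, hElt_mem h₀ B i⟩

/-- The operator by which `r_i` acts. -/
def rOp (h₀ : IsHighest B₀) (i : I) : EndV M B₀ :=
  endOfBasis B₀ fun B => xi M B₀ (s M i • B) <• coeffW M B₀.1.1 (hC h₀ B i)

lemma rOp_xi (h₀ : IsHighest B₀) (i : I) (B : Orbit M X) :
    rOp h₀ i (xi M B₀ B) = xi M B₀ (s M i • B) <• coeffW M B₀.1.1 (hC h₀ B i) :=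
  endOfBasis_xi _ _

lemma rOp_mul_self (h₀ : IsHighest B₀) (i : I) : rOp h₀ i * rOp h₀ i = 1 := by
  refine endV_ext fun B => ?_
  have : hC h₀ (s M i • B) i * hC h₀ B i = 1 := Subtype.ext (hElt_mul_self B.1 i)
  rw [Module.End.mul_apply, rOp_xi, map_smul, rOp_xi, smul_coeffW_smul, this, smul_coeffW_one,
    smul_smul, s_mul_s, one_smul]
  rfl

lemma rOp_comm (h₀ : IsHighest B₀) {i j : I} (hij : ¬ M.Adj i j) :
    rOp h₀ i * rOp h₀ j = rOp h₀ j * rOp h₀ i := by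
  refine endV_ext fun B => ?_
  have : hC h₀ (s M j • B) i * hC h₀ B j = hC h₀ (s M i • B) j * hC h₀ B i :=
    Subtype.ext (hElt_comm B.1 hij)
  simp only [Module.End.mul_apply, rOp_xi, map_smul, smul_coeffW_smul, this]
  rw [smul_smul, smul_smul, s_comm hij]

lemma rOp_braid (h₀ : IsHighest B₀) {i j : I} (hij : M.Adj i j) :
    rOp h₀ i * (rOp h₀ j * rOp h₀ i) = rOp h₀ j * (rOp h₀ i * rOp h₀ j) := by
  refine endV_ext fun B => ?_
  have : hC h₀ (s M j • s M i • B) i * (hC h₀ (s M i • B) j * hC h₀ B i) =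
      hC h₀ (s M i • s M j • B) j * (hC h₀ (s M j • B) i * hC h₀ B j) :=
    Subtype.ext (hElt_braid B.1 hij)
  simp only [Module.End.mul_apply, rOp_xi, map_smul, smul_coeffW_smul, this]
  simp only [smul_smul, s_braid hij]

lemma isLiftable_rOp (h₀ : IsHighest B₀) : (coxeterMatrix M).IsLiftable (rOp h₀) := by
  have sq := rOp_mul_self h₀
  intro i j
  simp only [coxeterMatrix, Matrix.of_apply]
  split_ifs with h1 h2
  · subst h1
    rw [pow_one, sq]
  · rw [pow_succ, pow_two]
    calc rOp h₀ i * rOp h₀ j * (rOp h₀ i * rOp h₀ j) * (rOp h₀ i * rOp h₀ j)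
        = (rOp h₀ i * (rOp h₀ j * rOp h₀ i)) * (rOp h₀ j * (rOp h₀ i * rOp h₀ j)) := by
          simp only [mul_assoc]
      _ = rOp h₀ i * (rOp h₀ j * (rOp h₀ i * rOp h₀ i)) * rOp h₀ j * rOp h₀ i := by
          rw [← rOp_braid h₀ h2]; simp only [mul_assoc]
      _ = 1 := by rw [sq, mul_one, mul_assoc (rOp h₀ i), sq, mul_one, sq]
  · rw [pow_two]
    calc rOp h₀ i * rOp h₀ j * (rOp h₀ i * rOp h₀ j)
        = rOp h₀ i * rOp h₀ j * (rOp h₀ j * rOp h₀ i) := by rw [← rOp_comm h₀ h2]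
      _ = rOp h₀ i * (rOp h₀ j * rOp h₀ j) * rOp h₀ i := by simp only [mul_assoc]
      _ = 1 := by rw [sq, mul_one, sq]

/-- The representation of `W` on `V`. -/
def wRep (h₀ : IsHighest B₀) : W M →* EndV M B₀ :=
  (coxeterMatrix M).toCoxeterSystem.lift ⟨rOp h₀, isLiftable_rOp h₀⟩

lemma wRep_s (h₀ : IsHighest B₀) (i : I) : wRep h₀ (s M i) = rOp h₀ i :=
  CoxeterSystem.lift_apply_simple _ (isLiftable_rOp h₀) i

lemma wRep_s_xi (h₀ : IsHighest B₀) {B : Orbit M X} {i : I} (hi : ¬ Perp M (simpleRoot i) B.1.1) :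
    wRep h₀ (s M i) (xi M B₀ B) = xi M B₀ (s M i • B) := by
  have : hC h₀ B i = 1 := Subtype.ext (hElt_of_not_perp hi)
  rw [wRep_s, rOp_xi, this, smul_coeffW_one]

lemma wRep_mul_apply (h₀ : IsHighest B₀) (w w' : W M) (v : V M B₀) :
    wRep h₀ (w * w') v = wRep h₀ w (wRep h₀ w' v) := by
  rw [map_mul, Module.End.mul_apply]

lemma wRep_one_apply (h₀ : IsHighest B₀) (v : V M B₀) : wRep h₀ 1 v = v := by
  rw [map_one, Module.End.one_apply]

lemma exists_wRep_xi (h₀ : IsHighest B₀) (w : W M) (B : Orbit M X) :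
    ∃ g, wRep h₀ w (xi M B₀ B) = xi M B₀ (w • B) <• coeffW M B₀.1.1 g := by
  induction w using W_induction with
  | one => exact ⟨1, by rw [wRep_one_apply, smul_coeffW_one, one_smul]⟩
  | mul w i ih =>
    obtain ⟨g, hg⟩ := ih
    exact ⟨hC h₀ (w • B) i * g, by
      rw [wRep_mul_apply, hg, map_smul, wRep_s, rOp_xi, smul_coeffW_smul, mul_smul]⟩

/-- The representation of `W` on `V`, with values in the general linear group. -/
def wRepGL (h₀ : IsHighest B₀) :
    W M →* LinearMap.GeneralLinearGroup (Coeff M B₀.1.1)ᵐᵒᵖ (V M B₀) := (wRep h₀).toHomUnits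

lemma wRepGL_apply (h₀ : IsHighest B₀) (w : W M) : (wRepGL h₀ w : EndV M B₀) = wRep h₀ w := rfl

lemma isWRep_wRepGL (h₀ : IsHighest B₀) {h : Orbit M X → I → WC M B₀.1.1} (hh : IsH M B₀ h) :
    IsWRep M B₀ h (wRepGL h₀) := fun B i => by
  refine ⟨s M i • B, rfl, ?_⟩
  have : h B i = hC h₀ B i := Subtype.ext (hh.eq_hElt h₀ B i)
  rw [wRepGL_apply, wRep_s, rOp_xi, this]

lemma IsWRep.eq_wRepGL (h₀ : IsHighest B₀) {h : Orbit M X → I → WC M B₀.1.1} (hh : IsH M B₀ h)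
    {ρW : W M →* LinearMap.GeneralLinearGroup (Coeff M B₀.1.1)ᵐᵒᵖ (V M B₀)}
    (hρ : IsWRep M B₀ h ρW) : ρW = wRepGL h₀ := by
  refine (coxeterMatrix M).toCoxeterSystem.ext_simple fun i => Units.ext (endV_ext fun B => ?_)
  obtain ⟨B', hB', h'⟩ := hρ B i
  obtain ⟨B'', hB'', h''⟩ := isWRep_wRepGL h₀ hh B i
  obtain rfl : B' = B'' := Subtype.ext (Subtype.ext (hB'.trans hB''.symm))
  exact h'.trans h''.symm

/-! ### Elements of `W` that fix a basis vector -/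

/-- The group acts on basis vectors up to right scalars from W(C), and the operators commute with
right scalars. Fixing a basis vector may therefore be tested after conjugation. -/
lemma wRep_conj_xi (h₀ : IsHighest B₀) {n : W M} {B : Orbit M X} (w : W M)
    (h : wRep h₀ (w * n * w⁻¹) (xi M B₀ (w • B)) = xi M B₀ (w • B)) :
    wRep h₀ n (xi M B₀ B) = xi M B₀ B := by
  obtain ⟨g, hg⟩ := exists_wRep_xi h₀ w B
  have h1 : wRep h₀ w (wRep h₀ n (xi M B₀ B)) = wRep h₀ w (xi M B₀ B) := by
    rw [← wRep_mul_apply, hg, ← h, ← map_smul, ← hg, ← wRep_mul_apply, inv_mul_cancel_right]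
  have := congrArg (wRep h₀ w⁻¹) h1
  rwa [← wRep_mul_apply, ← wRep_mul_apply, ← wRep_mul_apply, inv_mul_cancel, one_mul,
    wRep_one_apply] at this

/-- Conjugation reduces to a simple root α_i in ±B. There r_i fixes the set, and h_{B,i} = 1 because
α_i is not orthogonal to itself. -/
lemma wRep_reflW_xi (h₀ : IsHighest B₀) {β : Lat I} {B : Orbit M X} (hβ : Pm B.1.1 β) :
    wRep h₀ (reflW M β) (xi M B₀ B) = xi M B₀ B := by
  have hroot : IsRoot M β := by
    rcases hβ with h | h
    · exact (B.1.2.pos _ h).1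
    · simpa using (B.1.2.pos _ h).1.neg
  obtain ⟨w, i, rfl⟩ := hroot
  refine wRep_conj_xi h₀ w⁻¹ ?_
  rw [reflW_geom (isRoot_simpleRoot i), reflW_simpleRoot]
  have e : w⁻¹ * (w * s M i * w⁻¹) * w⁻¹⁻¹ = s M i := by group
  rw [e]
  have hpm : Pm (w⁻¹ • B).1.1 (simpleRoot i) := by
    rw [orbit_smul_val, pm_smul, inv_inv]
    exact hβ
  rw [wRep_s_xi h₀]
  · congr 1
    exact Subtype.ext (s_smul_of_pm hpm)
  · intro hp
    rcases hpm with h | h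
    · have := hp _ h
      rw [form_simpleRoot_self] at this
      omega
    · have := hp _ h
      rw [form_neg_right, form_simpleRoot_self] at this
      omega

lemma exists_list_prod (w : W M) : ∃ l : List I, w = (l.map (s M)).prod := by
  induction w using W_induction with
  | one => exact ⟨[], rfl⟩
  | mul w i ih =>
    obtain ⟨l, rfl⟩ := ih
    exact ⟨i :: l, by simp⟩

lemma isPosRoot_geom_or_neg (w : W M) {x : Lat I} (hx : IsRoot M x) :
    IsPosRoot M (geom M w x) ∨ IsPosRoot M (-geom M w x) := isPosRoot_or_neg (hx.geom w)

/-- The exchange property. -/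
lemma exists_list_exchange (l : List I) (i : I)
    (h : ¬ IsPosRoot M (geom M (l.map (s M)).prod (simpleRoot i))) :
    ∃ l' : List I, l'.length + 1 = l.length ∧
      (l.map (s M)).prod * s M i = (l'.map (s M)).prod := by
  induction l with
  | nil => exact absurd (by simpa using isPosRoot_simpleRoot (M := M) i) h
  | cons j l ih =>
    simp only [List.map_cons, List.prod_cons] at h ⊢
    set u := (l.map (s M)).prod with hu
    by_cases hpos : IsPosRoot M (geom M u (simpleRoot i))
    · have hj : geom M u (simpleRoot i) = simpleRoot j := by
        by_contra hne
        exact h (by rw [geom_mul_apply]; exact hpos.geom_s hne)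
      have e := reflW_geom (M := M) (isRoot_simpleRoot i) u
      rw [hj, reflW_simpleRoot, reflW_simpleRoot] at e
      refine ⟨l, rfl, ?_⟩
      rw [e, ← hu]
      have hs : s M i * s M i = 1 := s_mul_s i
      calc u * s M i * u⁻¹ * u * s M i = u * (s M i * s M i) := by group
        _ = u := by rw [hs, mul_one]
    · obtain ⟨l', hl', he⟩ := ih hpos
      exact ⟨j :: l', by simp [← hl'], by simp [mul_assoc, he]⟩

/-- `w` maps the positive roots orthogonal to `B` to positive roots. -/
def PreservesPos (w : W M) (B : Adm M) : Prop :=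
  ∀ x, IsPosRoot M x → Perp M x B.1 → IsPosRoot M (geom M w x)

lemma Perp.geom_smul {x : Lat I} {B : Adm M} (h : Perp M x B.1) (w : W M) :
    Perp M (geom M w x) (w • B).1 := by
  rintro _ ⟨-, β, hβ, rfl | rfl⟩
  · rw [form_geom, h β hβ]
  · rw [form_neg_right, form_geom, h β hβ, neg_zero]

lemma Perp.neg {x : Lat I} {B : Set (Lat I)} (h : Perp M x B) : Perp M (-x) B := fun β hβ => by
  rw [form_neg_left, h β hβ, neg_zero]

/-- Nontrivial scalars arise only from letters whose simple root is orthogonal to the current set;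
the hypothesis allows these letters to be removed from a word for w. -/
lemma wRep_xi_of_preservesPos (h₀ : IsHighest B₀) {w : W M} {B : Orbit M X}
    (hw : PreservesPos w B.1) : wRep h₀ w (xi M B₀ B) = xi M B₀ (w • B) := by
  obtain ⟨l, rfl⟩ := exists_list_prod w
  induction hn : l.length using Nat.strong_induction_on generalizing l B with
  | _ n ih =>
    rcases List.eq_nil_or_concat l with rfl | ⟨l, i, rfl⟩
    · simp only [List.map_nil, List.prod_nil]
      rw [wRep_one_apply, one_smul]
    · have e : ((l.concat i).map (s M)).prod = (l.map (s M)).prod * s M i := by simp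
      rw [e] at hw ⊢
      rw [List.length_concat] at hn
      -- If α_i ⊥ B, positivity of w α_i means that the remaining prefix sends α_i to a negative
      -- root, so exchange gives a shorter word for w. Otherwise r_i acts without scalar and the
      -- prefix inherits the hypothesis over r_i B.
      by_cases hi : Perp M (simpleRoot i) B.1.1
      · have h1 := hw _ (isPosRoot_simpleRoot i) hi
        have h2 : ¬ IsPosRoot M (geom M (l.map (s M)).prod (simpleRoot i)) := fun h => by
          refine h.not_neg ?_
          rw [← map_neg]
          have e' : geom M (s M i) (simpleRoot i) = -simpleRoot i := by
            rw [geom_s_apply, form_simpleRoot_self]; module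
          rwa [geom_mul_apply, e'] at h1
        obtain ⟨l', hl', he⟩ := exists_list_exchange l i h2
        rw [he] at hw ⊢
        exact ih l'.length (by omega) l' hw rfl
      · rw [wRep_mul_apply, wRep_s_xi h₀ hi, mul_smul]
        refine ih l.length (by omega) l (fun x hx hp => ?_) rfl
        have hp' := hp.geom_smul (s M i)
        rw [orbit_smul_val, s_smul_s_smul] at hp'
        have hne : x ≠ simpleRoot i := by
          rintro rfl
          refine hi ?_
          rw [geom_s_apply, form_simpleRoot_self] at hp'
          have := hp'.neg
          rwa [show -(simpleRoot i - (2 : ℤ) • simpleRoot i : Lat I) = simpleRoot i by module] at this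
        have := hw _ (hx.geom_s hne) hp'
        rwa [geom_mul_apply, ← geom_mul_apply (s M i), s_mul_s, geom_one_apply] at this

end WRep

section Mixed

variable {I : Type*} [Fintype I] {M : SimpleGraph I} [PosDef M]

/-! ### Vectors of norm 4 -/

/-- A simple reflection changes one coordinate only, so reversing the sign of a vector would force
it to be a multiple c α_i, of norm 2c², which is never 4. -/
lemma nonneg_geom_of_norm_four {x : Lat I} (h4 : form M x x = 4) (h0 : 0 ≤ x)
    (h : ∀ w, 0 ≤ geom M w x ∨ geom M w x ≤ 0) (w : W M) : 0 ≤ geom M w x := by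
  induction w using W_induction with
  | one => rwa [geom_one_apply]
  | mul w i ih =>
    refine (h (s M i * w)).resolve_right fun hle => ?_
    set y := geom M w x with hy
    rw [geom_mul_apply, ← hy, geom_s_apply] at hle
    have hyi : y = y i • simpleRoot i := by
      funext j
      rcases eq_or_ne j i with rfl | hj
      · simp [simpleRoot]
      · have h1 := ih j
        have h2 := hle j
        have h3 : (simpleRoot i : Lat I) j = 0 := by simp [simpleRoot, hj]
        simp only [Pi.sub_apply, Pi.smul_apply, h3, smul_zero, sub_zero, Pi.zero_apply] at h1 h2 ⊢
        omega
    have h4' : form M y y = 4 := by rw [hy, form_geom, h4]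
    rw [hyi, form_smul_left, form_smul_right, form_simpleRoot_self] at h4'
    have hsq : y i * y i = 2 := by linarith
    have h1 : y i < 2 := by nlinarith
    have h2 : -2 < y i := by nlinarith
    interval_cases (y i) <;> omega

/-- A vector of norm 4 that is conjugate to its opposite has a conjugate with coordinates of both
signs. -/
lemma exists_geom_mixed {x : Lat I} (h4 : form M x x = 4) {n : W M} (hn : geom M n x = -x) :
    ∃ w, ¬ 0 ≤ geom M w x ∧ ¬ geom M w x ≤ 0 := by
  by_contra! hcon
  have h : ∀ w, 0 ≤ geom M w x ∨ geom M w x ≤ 0 := fun w => or_iff_not_imp_left.mpr (hcon w)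
  have key : ∀ x : Lat I, form M x x = 4 → geom M n x = -x → 0 ≤ x →
      (∀ w, 0 ≤ geom M w x ∨ geom M w x ≤ 0) → False := by
    intro x h4 hn h0 h
    have := nonneg_geom_of_norm_four h4 h0 h n
    rw [hn] at this
    have hx : x = 0 := le_antisymm (neg_nonneg.mp this) h0
    rw [hx, form_zero_left] at h4
    omega
  rcases h 1 with h0 | h0
  · rw [geom_one_apply] at h0
    exact key x h4 hn h0 h
  · rw [geom_one_apply] at h0
    refine key (-x) ?_ (by rw [map_neg, hn]) (neg_nonneg.mpr h0) fun w => ?_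
    · rw [form_neg_left, form_neg_right, neg_neg, h4]
    · rw [map_neg]
      exact (h w).symm.imp neg_nonneg.mpr neg_nonpos.mpr

lemma Pm.isRoot {B : Adm M} {x : Lat I} (h : Pm B.1 x) : IsRoot M x := by
  rcases h with h | h
  · exact (B.2.pos _ h).1
  · simpa using (B.2.pos _ h).1.neg

lemma Pm.form_cases {B : Adm M} {x y : Lat I} (hx : Pm B.1 x) (hy : Pm B.1 y) :
    x = y ∨ x = -y ∨ form M x y = 0 := by
  have key : ∀ a ∈ B.1, ∀ b ∈ B.1, a = b ∨ form M a b = 0 := fun a ha b hb =>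
    or_iff_not_imp_left.mpr (B.2.orth a ha b hb)
  rcases hx with hx | hx <;> rcases hy with hy | hy <;> rcases key _ hx _ hy with h | h
  · exact Or.inl h
  · exact Or.inr (Or.inr h)
  · exact Or.inr (Or.inl h)
  · rw [form_neg_right, neg_eq_zero] at h
    exact Or.inr (Or.inr h)
  · exact Or.inr (Or.inl (neg_eq_iff_eq_neg.mp h))
  · rw [form_neg_left, neg_eq_zero] at h
    exact Or.inr (Or.inr h)
  · exact Or.inl (neg_injective h)
  · rw [form_neg_left, form_neg_right, neg_neg] at h
    exact Or.inr (Or.inr h)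

lemma Perp.form_eq_zero {B : Adm M} {x y : Lat I} (hx : Perp M x B.1) (hy : Pm B.1 y) :
    form M x y = 0 := by
  rcases hy with hy | hy
  · exact hx y hy
  · have := hx _ hy
    rwa [form_neg_right, neg_eq_zero] at this

/-- A root belongs to `±B`, is orthogonal to `B`, or is moved by a member of `±B`. -/
lemma root_cases (B : Adm M) {x : Lat I} (hx : IsRoot M x) :
    Pm B.1 x ∨ Perp M x B.1 ∨ ∃ β, Pm B.1 β ∧ form M x β = -1 := by
  by_cases hp : Perp M x B.1
  · exact Or.inr (Or.inl hp)
  simp only [Perp] at hp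
  push Not at hp
  obtain ⟨β, hβ, h⟩ := hp
  have hβ2 := (B.2.pos β hβ).form_self
  have h1 := form_le_two hx.form_self hβ2
  have h2 := neg_two_le_form hx.form_self hβ2
  rcases (show form M x β = 2 ∨ form M x β = -2 ∨ form M x β = 1 ∨ form M x β = -1 by omega) with
    h | h | h | h
  · rw [eq_of_form_eq_two hx.form_self hβ2 h]
    exact Or.inl (Or.inl hβ)
  · rw [eq_neg_of_form_eq_neg_two hx.form_self hβ2 h]
    exact Or.inl (Or.inr (by rwa [neg_neg]))
  · exact Or.inr (Or.inr ⟨-β, Or.inr (by rwa [neg_neg]), by rw [form_neg_right, h]⟩)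
  · exact Or.inr (Or.inr ⟨β, Or.inl hβ, h⟩)

lemma smul_eq_eAdm {B : Adm M} {α β : Lat I} (hα : IsRoot M α) (hβ : Pm B.1 β)
    (h : form M α β = -1) : (reflW M β * reflW M α) • B = eAdm M α B := by
  rcases hβ with hβ | hβ
  · exact (eAdm_of_odd hα hβ (by rw [h]; decide)).symm
  · have hr : IsRoot M β := Pm.isRoot (B := B) (Or.inr hβ)
    rw [← reflW_neg hr]
    exact (eAdm_of_odd hα hβ (by rw [form_neg_right, h]; decide)).symm

end Mixed

section Brauer

variable {I : Type*} [Fintype I] {M : SimpleGraph I} [PosDef M] {X : Adm M} {B₀ : Orbit M X}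

/-! ### The action of the contractions -/

/-- `r_β r_α ξ_B` does not depend on `β`. -/
lemma wRep_reflW_mul_xi_eq (h₀ : IsHighest B₀) {B : Orbit M X} {α β γ : Lat I} (hα : IsRoot M α)
    (hβ : Pm B.1.1 β) (hγ : Pm B.1.1 γ) (hαβ : form M α β = -1) (hαγ : form M α γ = -1) :
    wRep h₀ (reflW M β * reflW M α) (xi M B₀ B) = wRep h₀ (reflW M γ * reflW M α) (xi M B₀ B) := by
  rcases hβ.form_cases hγ with rfl | rfl | hβγ
  · rfl
  · rw [form_neg_right] at hαβ
    omega
  have rβ := hβ.isRoot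
  have rγ := hγ.isRoot
  have fα := hα.form_self
  have fβ := rβ.form_self
  have fγ := rγ.form_self
  have fβα : form M β α = -1 := by rw [form_comm, hαβ]
  have fγα : form M γ α = -1 := by rw [form_comm, hαγ]
  have fγβ : form M γ β = 0 := by rw [form_comm, hβγ]
  -- This n is the product of the reflections in the orthogonal roots α + β and α + γ, and v is
  -- their sum, negated by n. On vectors orthogonal to B both roots have the same product, namely
  -- that with α.
  set n := reflW M α * (reflW M β * (reflW M γ * reflW M α)) with hn
  set v := (2 : ℤ) • α + β + γ with hv
  have hnv : geom M n v = -v := by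
    simp only [hn, hv, geom_mul_apply, geom_reflW hα, geom_reflW rβ, geom_reflW rγ, form_add_left,
      form_sub_left, form_smul_left, fα, fβ, fγ, hαβ, hαγ, fβα, fγα, fγβ, hβγ]
    module
  have hv4 : form M v v = 4 := by
    simp only [hv, form_add_left, form_add_right, form_smul_left, form_smul_right, fα, fβ, fγ, hαβ,
      hαγ, fβα, fγα, fγβ, hβγ]
    norm_num
  have hnx : ∀ x, Perp M x B.1.1 → geom M n x = x - form M x α • v := by
    intro x hx
    simp only [hn, hv, geom_mul_apply, geom_reflW hα, geom_reflW rβ, geom_reflW rγ,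
      form_sub_left, form_smul_left, fα, hαβ, hαγ, fβα, fγα, fγβ, hx.form_eq_zero hβ,
      hx.form_eq_zero hγ]
    module
  -- Both r_β r_α B and r_γ r_α B equal the contraction of B by α.
  have hnB : n • B.1 = B.1 := by
    have h1 : (reflW M γ * reflW M α) • B.1 = (reflW M β * reflW M α) • B.1 := by
      rw [smul_eq_eAdm hα hγ hαγ, smul_eq_eAdm hα hβ hαβ]
    rw [hn, mul_smul, mul_smul (reflW M β), h1, ← mul_smul, ← mul_smul, mul_assoc,
      ← mul_assoc (reflW M β), reflW_mul_self rβ, one_mul, reflW_mul_self hα, one_smul]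
  -- After conjugation by w, a positive root x orthogonal to wB moves to x - c · wv. Were the result
  -- negative, c · wv would be nonnegative, which for mixed signs of wv forces c = 0 and leaves x
  -- unchanged.
  obtain ⟨w, hw1, hw2⟩ := exists_geom_mixed hv4 hnv
  have hfix : wRep h₀ n (xi M B₀ B) = xi M B₀ B := by
    refine wRep_conj_xi h₀ w ?_
    have e : (w * n * w⁻¹) • w • B = w • B := by
      refine Subtype.ext ?_
      simp only [orbit_smul_val]
      rw [← mul_smul, inv_mul_cancel_right, mul_smul, hnB]
    rw [wRep_xi_of_preservesPos h₀, e]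
    intro x hx hp
    have hp' : Perp M (geom M w⁻¹ x) B.1.1 := by
      have := hp.geom_smul w⁻¹
      rwa [orbit_smul_val, inv_smul_smul] at this
    refine (isPosRoot_geom_or_neg _ hx.1).resolve_right fun hneg => ?_
    rw [geom_mul_apply, geom_mul_apply, hnx _ hp', map_sub, map_smul, geom_geom_inv] at hneg
    set c := form M (geom M w⁻¹ x) α
    have hc : 0 ≤ c • geom M w v := by
      have := add_nonneg hx.2 hneg.2
      rwa [neg_sub, add_sub_cancel] at this
    rcases lt_trichotomy c 0 with h | h | h
    · refine hw2 fun i => ?_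
      have := hc i
      simp only [Pi.smul_apply, Pi.zero_apply, smul_eq_mul] at this ⊢
      nlinarith
    · rw [h, zero_smul, sub_zero] at hneg
      exact hx.not_neg hneg
    · refine hw1 fun i => ?_
      have := hc i
      simp only [Pi.smul_apply, Pi.zero_apply, smul_eq_mul] at this ⊢
      nlinarith
  have := congrArg (wRep h₀ (reflW M β * reflW M α)) hfix
  rw [← wRep_mul_apply] at this
  rw [← this, hn]
  congr 2
  calc reflW M β * reflW M α * (reflW M α * (reflW M β * (reflW M γ * reflW M α)))
      = reflW M β * (reflW M α * reflW M α) * (reflW M β * (reflW M γ * reflW M α)) := by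
        simp only [mul_assoc]
    _ = reflW M γ * reflW M α := by
        rw [reflW_mul_self hα, mul_one, ← mul_assoc, reflW_mul_self rβ, one_mul]

/-- The homothety by a scalar. -/
def zOp (B₀ : Orbit M X) (r : ℤ[T;T⁻¹]) : EndV M B₀ where
  toFun v := v <• (MonoidAlgebra.single 1 r : Coeff M B₀.1.1)
  map_add' v v' := smul_add _ _ _
  map_smul' c v := by
    rw [RingHom.id_apply, smul_smul, smul_smul]
    congr 1
    refine MulOpposite.unop_injective ?_
    rw [MulOpposite.unop_mul, MulOpposite.unop_mul]
    exact MonoidAlgebra.single_one_comm r _ |>.symm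

lemma zOp_apply (r : ℤ[T;T⁻¹]) (v : V M B₀) :
    zOp B₀ r v = v <• (MonoidAlgebra.single 1 r : Coeff M B₀.1.1) := rfl

lemma map_zOp (f : EndV M B₀) (r : ℤ[T;T⁻¹]) (v : V M B₀) : f (zOp B₀ r v) = zOp B₀ r (f v) :=
  map_smul f _ v

open Classical in
/-- The operator by which the contraction of a root acts. -/
def eOp (h₀ : IsHighest B₀) (α : Lat I) : EndV M B₀ := endOfBasis B₀ fun B =>
  if Pm B.1.1 α then zOp B₀ (LaurentPolynomial.T 1) (xi M B₀ B)
  else if h : ∃ β, Pm B.1.1 β ∧ form M α β = -1 then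
    wRep h₀ (reflW M h.choose * reflW M α) (xi M B₀ B)
  else 0

lemma eOp_of_pm (h₀ : IsHighest B₀) {α : Lat I} {B : Orbit M X} (h : Pm B.1.1 α) :
    eOp h₀ α (xi M B₀ B) = zOp B₀ (LaurentPolynomial.T 1) (xi M B₀ B) := by
  rw [eOp, endOfBasis_xi, if_pos h]

lemma eOp_of_perp (h₀ : IsHighest B₀) {α : Lat I} (hα : IsRoot M α) {B : Orbit M X}
    (h : Perp M α B.1.1) : eOp h₀ α (xi M B₀ B) = 0 := by
  rw [eOp, endOfBasis_xi, if_neg, dif_neg]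
  · rintro ⟨β, hβ, h'⟩
    rw [h.form_eq_zero hβ] at h'
    omega
  · intro h'
    have := h.form_eq_zero h'
    rw [hα.form_self] at this
    omega

lemma eOp_of_form (h₀ : IsHighest B₀) {α β : Lat I} (hα : IsRoot M α) {B : Orbit M X}
    (hβ : Pm B.1.1 β) (h : form M α β = -1) :
    eOp h₀ α (xi M B₀ B) = wRep h₀ (reflW M β * reflW M α) (xi M B₀ B) := by
  have hex : ∃ β, Pm B.1.1 β ∧ form M α β = -1 := ⟨β, hβ, h⟩
  rw [eOp, endOfBasis_xi, if_neg, dif_pos hex]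
  · exact wRep_reflW_mul_xi_eq h₀ hα hex.choose_spec.1 hβ hex.choose_spec.2 h
  · intro hp
    rcases hp.form_cases hβ with rfl | rfl | h'
    · rw [hα.form_self] at h
      omega
    · rw [form_neg_left, hβ.isRoot.form_self] at h
      omega
    · omega

lemma eOp_neg (h₀ : IsHighest B₀) {α : Lat I} (hα : IsRoot M α) : eOp h₀ (-α) = eOp h₀ α := by
  refine endV_ext fun B => ?_
  rcases root_cases B.1 hα with h | h | ⟨β, hβ, h⟩
  · rw [eOp_of_pm h₀ h, eOp_of_pm h₀ h.neg]
  · rw [eOp_of_perp h₀ hα h, eOp_of_perp h₀ hα.neg h.neg]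
  · rw [eOp_of_form h₀ hα hβ h, eOp_of_form h₀ hα.neg hβ.neg
      (by rw [form_neg_left, form_neg_right, neg_neg, h]), reflW_neg hα, reflW_neg hβ.isRoot]

/-- Equivariance of the contractions. -/
lemma wRep_mul_eOp (h₀ : IsHighest B₀) (w : W M) {α : Lat I} (hα : IsRoot M α) :
    wRep h₀ w * eOp h₀ α = eOp h₀ (geom M w α) * wRep h₀ w := by
  refine endV_ext fun B => ?_
  obtain ⟨g, hg⟩ := exists_wRep_xi h₀ w B
  have hpm : ∀ {x}, Pm B.1.1 x → Pm (w • B).1.1 (geom M w x) := fun h => by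
    rwa [orbit_smul_val, pm_smul, geom_inv_geom]
  simp only [Module.End.mul_apply]
  rcases root_cases B.1 hα with h | h | ⟨β, hβ, h⟩
  · rw [eOp_of_pm h₀ h, map_zOp, hg, map_smul, map_smul, eOp_of_pm h₀ (hpm h)]
  · rw [eOp_of_perp h₀ hα h, hg, map_smul, eOp_of_perp h₀ (hα.geom w) (h.geom_smul w), map_zero,
      smul_zero]
  · rw [eOp_of_form h₀ hα hβ h, hg, map_smul, eOp_of_form h₀ (hα.geom w) (hpm hβ)
      (by rw [form_geom, h]), ← map_smul, ← hg, ← wRep_mul_apply, ← wRep_mul_apply,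
      reflW_geom hα, reflW_geom hβ.isRoot]
    congr 2
    group

lemma eOp_wRep (h₀ : IsHighest B₀) (w : W M) {α : Lat I} (hα : IsRoot M α) (v : V M B₀) :
    eOp h₀ α (wRep h₀ w v) = wRep h₀ w (eOp h₀ (geom M w⁻¹ α) v) := by
  have := LinearMap.congr_fun (wRep_mul_eOp h₀ w (hα.geom w⁻¹)) v
  rw [geom_geom_inv] at this
  exact this.symm

/-- Operators that agree on the `ξ_E` with `α ∈ ±E` agree on the image of the contraction by `α`. -/
lemma mul_eOp_congr (h₀ : IsHighest B₀) {α : Lat I} (hα : IsRoot M α) {f g : EndV M B₀}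
    (h : ∀ E : Orbit M X, Pm E.1.1 α → f (xi M B₀ E) = g (xi M B₀ E)) :
    f * eOp h₀ α = g * eOp h₀ α := by
  refine endV_ext fun B => ?_
  simp only [Module.End.mul_apply]
  rcases root_cases B.1 hα with h' | h' | ⟨β, hβ, h'⟩
  · rw [eOp_of_pm h₀ h', map_zOp, map_zOp, h B h']
  · rw [eOp_of_perp h₀ hα h', map_zero, map_zero]
  · rw [eOp_of_form h₀ hα hβ h']
    obtain ⟨c, hc⟩ := exists_wRep_xi h₀ (reflW M β * reflW M α) B
    rw [hc, map_smul, map_smul, h]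
    rw [orbit_smul_val, smul_eq_eAdm hα hβ h']
    exact pm_eAdm hα _

lemma reflW_mul_eOp (h₀ : IsHighest B₀) {α : Lat I} (hα : IsRoot M α) :
    wRep h₀ (reflW M α) * eOp h₀ α = eOp h₀ α := by
  conv_rhs => rw [← one_mul (eOp h₀ α)]
  exact mul_eOp_congr h₀ hα fun E hE => wRep_reflW_xi h₀ hE

lemma eOp_mul_self (h₀ : IsHighest B₀) {α : Lat I} (hα : IsRoot M α) :
    eOp h₀ α * eOp h₀ α = zOp B₀ (LaurentPolynomial.T 1) * eOp h₀ α :=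
  mul_eOp_congr h₀ hα fun _ hE => eOp_of_pm h₀ hE

lemma eOp_mul_eOp_of_form (h₀ : IsHighest B₀) {α β : Lat I} (hα : IsRoot M α) (hβ : IsRoot M β)
    (h : form M α β = -1) :
    wRep h₀ (reflW M β * reflW M α) * eOp h₀ β = eOp h₀ α * eOp h₀ β :=
  mul_eOp_congr h₀ hβ fun _ hE => (eOp_of_form h₀ hα hE h).symm

/-! ### Commutation of contractions -/

section Commute

variable (h₀ : IsHighest B₀) {B : Orbit M X} {α α' : Lat I} (hα : IsRoot M α) (hα' : IsRoot M α')
  (hαα' : form M α α' = 0)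

include hα hα' hαα'

/-- Here e_α multiplies ξ_B by δ or 0, and the group element computing e_α' ξ_B fixes α, so e_α acts
by the same scalar afterwards. -/
lemma eOp_comm_of_scalar {r : ℤ[T;T⁻¹]} (hr : eOp h₀ α (xi M B₀ B) = zOp B₀ r (xi M B₀ B))
    (h : ∀ β, Pm B.1.1 β → form M α' β = -1 → form M α β = 0) :
    eOp h₀ α (eOp h₀ α' (xi M B₀ B)) = eOp h₀ α' (eOp h₀ α (xi M B₀ B)) := by
  rw [hr, map_zOp]
  rcases root_cases B.1 hα' with h' | h' | ⟨β, hβ, h'⟩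
  · rw [eOp_of_pm h₀ h', map_zOp, hr, map_zOp]
  · rw [eOp_of_perp h₀ hα' h', map_zero, map_zero]
  · rw [eOp_of_form h₀ hα' hβ h', eOp_wRep h₀ _ hα]
    have e : geom M (reflW M β * reflW M α')⁻¹ α = α := by
      rw [mul_inv_rev, reflW_inv hβ.isRoot, reflW_inv hα', geom_mul_apply, geom_reflW hβ.isRoot,
        geom_reflW hα', h β hβ h', zero_smul, sub_zero, hαα', zero_smul, sub_zero]
    rw [e, hr, map_zOp]

/-- The element r_β r_α fixes α', and r_γ r_α' fixes β. The two orders of contraction thus differ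
only by a conjugation that leaves r_β unchanged. -/
lemma eOp_comm_of_form_eq_zero {β γ : Lat I} (hβ : Pm B.1.1 β) (hγ : Pm B.1.1 γ)
    (hαβ : form M α β = -1) (hα'β : form M α' β = 0) (hα'γ : form M α' γ = -1) :
    eOp h₀ α (eOp h₀ α' (xi M B₀ B)) = eOp h₀ α' (eOp h₀ α (xi M B₀ B)) := by
  have rβ := hβ.isRoot
  have rγ := hγ.isRoot
  have hβγ : form M β γ = 0 := by
    rcases hβ.form_cases hγ with rfl | rfl | h
    · omega
    · rw [form_neg_right] at hα'β
      omega
    · exact h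
  have hβα' : form M β α' = 0 := by rw [form_comm, hα'β]
  have hα'α : form M α' α = 0 := by rw [form_comm, hαα']
  set v := reflW M γ * reflW M α' with hv
  have hvβ : geom M v β = β := by
    rw [hv, geom_mul_apply, geom_reflW hα', hβα', zero_smul, sub_zero, geom_reflW rγ, hβγ,
      zero_smul, sub_zero]
  have e1 : geom M (reflW M β * reflW M α)⁻¹ α' = α' := by
    rw [mul_inv_rev, reflW_inv rβ, reflW_inv hα, geom_mul_apply, geom_reflW rβ, hα'β, zero_smul,
      sub_zero, geom_reflW hα, hα'α, zero_smul, sub_zero]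
  have e2 : form M (geom M v⁻¹ α) β = -1 := by rw [form_geom_left, inv_inv, hvβ, hαβ]
  have e3 : v * reflW M β * v⁻¹ = reflW M β := by rw [← reflW_geom rβ, hvβ]
  rw [eOp_of_form h₀ hα hβ hαβ, eOp_wRep h₀ _ hα', e1, eOp_of_form h₀ hα' hγ hα'γ, ← hv,
    eOp_wRep h₀ _ hα, eOp_of_form h₀ (hα.geom _) hβ e2, ← wRep_mul_apply, ← wRep_mul_apply,
    reflW_geom hα]
  congr 2
  conv_rhs => rw [← e3]
  group

end Commute

/-- When neither contraction is scalar and no member of ±B is moved by exactly one of the two nodes,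
the products with α_i and α_j have equal parity on B. The result then depends on whether α_i + α_j
lies in the lattice of B. -/
lemma eOp_simpleRoot_comm (h₀ : IsHighest B₀) {i j : I} (hij : ¬ M.Adj i j) :
    eOp h₀ (simpleRoot i) * eOp h₀ (simpleRoot j) =
      eOp h₀ (simpleRoot j) * eOp h₀ (simpleRoot i) := by
  rcases eq_or_ne i j with rfl | hne
  · rfl
  have hji : ¬ M.Adj j i := mt SimpleGraph.Adj.symm hij
  have ri := isRoot_simpleRoot (M := M) i
  have rj := isRoot_simpleRoot (M := M) j
  have fij := form_simpleRoot_of_not_adj hne hij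
  have fji := form_simpleRoot_of_not_adj hne.symm hji
  refine endV_ext fun B => ?_
  simp only [Module.End.mul_apply]
  have scalar : ∀ {i j : I}, form M (simpleRoot i) (simpleRoot j) = 0 →
      (Pm B.1.1 (simpleRoot i) ∨ Perp M (simpleRoot i) B.1.1) →
      eOp h₀ (simpleRoot i) (eOp h₀ (simpleRoot j) (xi M B₀ B)) =
        eOp h₀ (simpleRoot j) (eOp h₀ (simpleRoot i) (xi M B₀ B)) := by
    intro i j hij h
    have ri := isRoot_simpleRoot (M := M) i
    have rj := isRoot_simpleRoot (M := M) j
    rcases h with h | h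
    · refine eOp_comm_of_scalar h₀ ri rj hij (eOp_of_pm h₀ h) fun β hβ hjβ => ?_
      rcases h.form_cases hβ with h' | h' | h'
      · rw [← h', form_comm, hij] at hjβ
        omega
      · rw [← neg_eq_iff_eq_neg.mpr h', form_neg_right, form_comm, hij] at hjβ
        omega
      · exact h'
    · refine eOp_comm_of_scalar (r := 0) h₀ ri rj hij ?_ fun β hβ _ => h.form_eq_zero hβ
      rw [eOp_of_perp h₀ ri h, zOp_apply, MonoidAlgebra.single_zero, MulOpposite.op_zero, zero_smul]
  by_cases hi : Pm B.1.1 (simpleRoot i) ∨ Perp M (simpleRoot i) B.1.1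
  · exact scalar fij hi
  by_cases hj : Pm B.1.1 (simpleRoot j) ∨ Perp M (simpleRoot j) B.1.1
  · exact (scalar fji hj).symm
  rw [not_or] at hi hj
  obtain ⟨β, hβ, hiβ⟩ := ((root_cases B.1 ri).resolve_left hi.1).resolve_left hi.2
  obtain ⟨γ, hγ, hjγ⟩ := ((root_cases B.1 rj).resolve_left hj.1).resolve_left hj.2
  have range : ∀ {i : I}, ¬ Pm B.1.1 (simpleRoot i) → ∀ δ, Pm B.1.1 δ →
      form M (simpleRoot i) δ = 1 ∨ form M (simpleRoot i) δ = 0 ∨ form M (simpleRoot i) δ = -1 := by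
    intro i hi δ hδ
    rcases hδ with h | h
    · exact form_cases_of_not_mem (fun h' => hi (Or.inl h')) h
    · have := form_cases_of_not_mem (fun h' => hi (Or.inl h')) h
      rw [form_neg_right] at this
      omega
  by_cases h1 : ∃ δ, Pm B.1.1 δ ∧ form M (simpleRoot i) δ = -1 ∧ form M (simpleRoot j) δ = 0
  · obtain ⟨δ, hδ, h1, h2⟩ := h1
    exact eOp_comm_of_form_eq_zero h₀ ri rj fij hδ hγ h1 h2 hjγ
  by_cases h2 : ∃ δ, Pm B.1.1 δ ∧ form M (simpleRoot j) δ = -1 ∧ form M (simpleRoot i) δ = 0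
  · obtain ⟨δ, hδ, h2, h3⟩ := h2
    exact (eOp_comm_of_form_eq_zero h₀ rj ri fji hδ hβ h2 h3 hiβ).symm
  have par : ∀ δ, Pm B.1.1 δ →
      Even (form M (simpleRoot i) δ + form M (simpleRoot j) δ) := by
    intro δ hδ
    have n1 : ∀ δ, Pm B.1.1 δ → ¬ (form M (simpleRoot i) δ = -1 ∧ form M (simpleRoot j) δ = 0) :=
      fun δ hδ h => h1 ⟨δ, hδ, h⟩
    have n2 : ∀ δ, Pm B.1.1 δ → ¬ (form M (simpleRoot j) δ = -1 ∧ form M (simpleRoot i) δ = 0) :=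
      fun δ hδ h => h2 ⟨δ, hδ, h⟩
    have a1 := n1 δ hδ
    have a2 := n1 (-δ) hδ.neg
    have a3 := n2 δ hδ
    have a4 := n2 (-δ) hδ.neg
    rw [form_neg_right, form_neg_right] at a2 a4
    have c1 := range hi.1 δ hδ
    have c2 := range hj.1 δ hδ
    rw [Int.even_iff]
    omega
  -- In the lattice case r_i B = r_j B and e_i ξ_B = e_j ξ_B, so both orders give δ e_i ξ_B.
  -- Otherwise both vanish.
  by_cases hsum : simpleRoot i + simpleRoot j ∈ span2 B.1.1
  · have hB : s M i • B = s M j • B := Subtype.ext (s_smul_eq_s_smul hne hij hsum)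
    have hxi : wRep h₀ (s M i) (xi M B₀ B) = wRep h₀ (s M j) (xi M B₀ B) := by
      rw [wRep_s_xi h₀ hi.2, wRep_s_xi h₀ hj.2, hB]
    have he : eOp h₀ (simpleRoot i) (xi M B₀ B) = eOp h₀ (simpleRoot j) (xi M B₀ B) := by
      have hj' : eOp h₀ (simpleRoot j) (xi M B₀ B) =
          wRep h₀ (reflW M β * reflW M (simpleRoot j)) (xi M B₀ B) := by
        have p := par β hβ
        rw [hiβ, Int.even_iff] at p
        rcases range hj.1 β hβ with h | h | h
        · rw [eOp_of_form h₀ rj hβ.neg (by rw [form_neg_right, h]), reflW_neg hβ.isRoot]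
        · omega
        · exact eOp_of_form h₀ rj hβ h
      rw [hj', eOp_of_form h₀ ri hβ hiβ, wRep_mul_apply, wRep_mul_apply, reflW_simpleRoot,
        reflW_simpleRoot, hxi]
    have ei := LinearMap.congr_fun (eOp_mul_self h₀ ri) (xi M B₀ B)
    have ej := LinearMap.congr_fun (eOp_mul_self h₀ rj) (xi M B₀ B)
    simp only [Module.End.mul_apply] at ei ej
    conv_lhs => rw [← he, ei]
    conv_rhs => rw [he, ej]
    rw [he]
  -- Carrying α_j back through r_β r_i gives the root x = α_j - c(α_i + β) with c odd. It has even
  -- product with all of ±B, and membership in ±B would put α_i + α_j in the lattice, so x is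
  -- orthogonal to B.
  · have zero : ∀ {i j : I} {β : Lat I}, form M (simpleRoot i) (simpleRoot j) = 0 →
        Pm B.1.1 β → form M (simpleRoot i) β = -1 → ¬ Pm B.1.1 (simpleRoot j) →
        simpleRoot i + simpleRoot j ∉ span2 B.1.1 →
        (∀ δ, Pm B.1.1 δ → Even (form M (simpleRoot i) δ + form M (simpleRoot j) δ)) →
        eOp h₀ (simpleRoot j) (eOp h₀ (simpleRoot i) (xi M B₀ B)) = 0 := by
      intro i j β fij hβ hiβ hj hsum par
      have ri := isRoot_simpleRoot (M := M) i
      have rj := isRoot_simpleRoot (M := M) j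
      rw [eOp_of_form h₀ ri hβ hiβ, eOp_wRep h₀ _ rj]
      set c := form M (simpleRoot j) β with hc
      have hodd : c % 2 = 1 := by
        have := par β hβ
        rw [hiβ, ← hc, Int.even_iff] at this
        omega
      set x := geom M (reflW M β * reflW M (simpleRoot i))⁻¹ (simpleRoot j) with hx
      have e : x = simpleRoot j - c • (simpleRoot i + β) := by
        rw [hx, mul_inv_rev, reflW_inv hβ.isRoot, reflW_inv ri, geom_mul_apply,
          geom_reflW hβ.isRoot, geom_reflW ri, ← hc, form_sub_left, form_smul_left,
          form_comm _ (simpleRoot i), fij, form_comm β, hiβ]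
        module
      have rx : IsRoot M x := rj.geom _
      rcases root_cases B.1 rx with h | h | ⟨δ, hδ, h⟩
      · refine absurd ?_ hsum
        have h1 := pm_mem_span2 h
        have h2 := (span2 B.1.1).smul_mem c (pm_mem_span2 hβ)
        have h3 := even_smul_mem (two_smul_mem_span2 B.1.1) (c := c + 1)
          (by rw [Int.even_iff]; omega) (simpleRoot i)
        have e' : simpleRoot i + simpleRoot j = x + c • β + (c + 1) • simpleRoot i := by
          rw [e]; module
        rw [e']
        exact add_mem (add_mem h1 h2) h3
      · rw [eOp_of_perp h₀ rx h, map_zero]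
      · have h1 := par δ hδ
        have h2 := B.1.2.evenOn β (pm_mem_span2 hβ) δ (pm_mem_span2 hδ)
        rw [e, form_sub_left, form_smul_left, form_add_left] at h
        have : Even (-1 : ℤ) := by
          rw [← h]
          have e2 : form M (simpleRoot j) δ - c * (form M (simpleRoot i) δ + form M β δ) =
              (form M (simpleRoot i) δ + form M (simpleRoot j) δ) - c * form M β δ -
                (c + 1) * form M (simpleRoot i) δ := by ring
          rw [e2]
          exact (h1.sub (h2.mul_left c)).sub
            ((show Even (c + 1) by rw [Int.even_iff]; omega).mul_right _)
        exact absurd this (by decide)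
    rw [zero fij hβ hiβ hj.1 hsum par, zero fji hγ hjγ hi.1 (by rwa [add_comm]) fun δ hδ => by
      rw [add_comm]; exact par δ hδ]

/-! ### The representation of the Brauer algebra -/

lemma zOp_mul (r r' : ℤ[T;T⁻¹]) : zOp B₀ r * zOp B₀ r' = zOp B₀ (r * r') := by
  refine LinearMap.ext fun v => ?_
  rw [Module.End.mul_apply, zOp_apply, zOp_apply, zOp_apply, smul_smul, ← MulOpposite.op_mul,
    MonoidAlgebra.single_mul_single, one_mul, mul_comm r']

lemma zOp_one : zOp B₀ 1 = 1 := by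
  refine LinearMap.ext fun v => ?_
  rw [zOp_apply, ← MonoidAlgebra.one_def, MulOpposite.op_one, one_smul, Module.End.one_apply]

lemma zOp_comm (r : ℤ[T;T⁻¹]) (f : EndV M B₀) : zOp B₀ r * f = f * zOp B₀ r :=
  LinearMap.ext fun v => (map_zOp f r v).symm

/-- The operators by which the generators act. -/
def genOp (h₀ : IsHighest B₀) : Gen I → EndV M B₀
  | .r i => wRep h₀ (s M i)
  | .e i => eOp h₀ (simpleRoot i)
  | .delta => zOp B₀ (LaurentPolynomial.T 1)
  | .deltaInv => zOp B₀ (LaurentPolynomial.T (-1))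

/-- Equivariance, and the fact that the image of a contraction by α is carried by the ξ_E with α in
±E, give every relation involving e except the commutation of two contractions. -/
lemma exists_brRep (h₀ : IsHighest B₀) :
    ∃ φ : BrM M →* EndV M B₀, ∀ x, φ (gen M x) = genOp h₀ x := by
  have root := isRoot_simpleRoot (M := M)
  have re (i : I) : wRep h₀ (s M i) * eOp h₀ (simpleRoot i) = eOp h₀ (simpleRoot i) := by
    rw [← reflW_simpleRoot, reflW_mul_eOp h₀ (root i)]
  have er (i : I) : eOp h₀ (simpleRoot i) * wRep h₀ (s M i) = eOp h₀ (simpleRoot i) := by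
    have e : geom M (s M i) (simpleRoot i) = -simpleRoot i := by
      rw [geom_s_apply, form_simpleRoot_self]; module
    have := wRep_mul_eOp h₀ (s M i) (root i)
    rwa [e, eOp_neg h₀ (root i), re, eq_comm] at this
  refine exists_lift (genOp h₀) (fun x => zOp_comm _ _) ?_ (fun i => ?_) er re
    (fun i => eOp_mul_self h₀ (root i)) (fun i j hij => ?_) (fun i j hij => ?_)
    (fun i j hij => eOp_simpleRoot_comm h₀ hij) (fun i j hij => ?_) (fun i j hij => ?_)
    fun i j hij => ?_
  · simp only [genOp]
    rw [zOp_mul, ← LaurentPolynomial.T_add, add_neg_cancel, LaurentPolynomial.T_zero, zOp_one]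
  · simp only [genOp]
    rw [← map_mul, s_mul_s, map_one]
  · simp only [genOp]
    rw [← map_mul, s_comm hij, map_mul]
  · simp only [genOp]
    rcases eq_or_ne i j with rfl | hne
    · rw [er, re]
    · have := wRep_mul_eOp h₀ (s M j) (root i)
      rw [geom_s_apply, form_simpleRoot_of_not_adj hne hij, zero_smul, sub_zero] at this
      exact this.symm
  · simp only [genOp]
    rw [← map_mul, ← map_mul, mul_assoc, s_braid hij, ← mul_assoc, map_mul, map_mul]
  · simp only [genOp]
    have key : ∀ {i j : I}, M.Adj i j → wRep h₀ (s M j) * eOp h₀ (simpleRoot i) * wRep h₀ (s M j) =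
        eOp h₀ (simpleRoot i + simpleRoot j) := by
      intro i j hij
      have e : geom M (s M j) (simpleRoot i) = simpleRoot i + simpleRoot j := by
        rw [geom_s_apply, form_simpleRoot_of_adj hij]; module
      rw [wRep_mul_eOp h₀ _ (root i), e, mul_assoc, ← map_mul, s_mul_s, map_one, mul_one]
    rw [key hij, key hij.symm, add_comm]
  · simp only [genOp]
    have := eOp_mul_eOp_of_form h₀ (root i) (root j) (form_simpleRoot_of_adj hij)
    rwa [reflW_simpleRoot, reflW_simpleRoot, map_mul] at this

lemma ofW_s (i : I) : ofW M (s M i) = gen M (.r i) :=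
  CoxeterSystem.lift_apply_simple _ (isLiftable_gen M) i

/-- For uniqueness, the three cases for α_i relative to B exhaust all B, so every e_i is determined
on the basis; δ⁻¹ is determined as an inverse, and integer coefficients leave no freedom. -/
lemma existsUnique_isBrRep (h₀ : IsHighest B₀) :
    ∃! ρ : Br M →+* EndV M B₀, IsBrRep M B₀ (wRepGL h₀) ρ := by
  obtain ⟨φ, hφ⟩ := exists_brRep h₀
  have hρ (a : BrM M) :
      (MonoidAlgebra.lift ℤ (EndV M B₀) (BrM M) φ : Br M →+* EndV M B₀) (MonoidAlgebra.of ℤ _ a) =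
        φ a := MonoidAlgebra.lift_of φ a
  refine ⟨(MonoidAlgebra.lift ℤ (EndV M B₀) (BrM M) φ : Br M →+* EndV M B₀), ?_, fun ρ h => ?_⟩
  · have adj (i : I) (B : Orbit M X) (β : Lat I) (hβ : β ∈ B.1.1)
        (h : |form M (simpleRoot i) β| = 1) :
        eOp h₀ (simpleRoot i) (xi M B₀ B) = wRep h₀ (reflW M β * s M i) (xi M B₀ B) := by
      rw [← reflW_simpleRoot i]
      rcases (abs_eq zero_le_one).mp h with h | h
      · rw [← reflW_neg (B.1.2.pos β hβ).1]
        exact eOp_of_form h₀ (isRoot_simpleRoot i) (Or.inr (by rwa [neg_neg]))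
          (by rw [form_neg_right, h])
      · exact eOp_of_form h₀ (isRoot_simpleRoot i) (Or.inl hβ) h
    refine ⟨fun w => ?_, fun v => ?_, fun i B h => ?_, fun i B h => ?_, fun i B β hβ h t ht => ?_⟩
    · rw [hρ]
      have : φ.comp (ofW M) = wRep h₀ :=
        (coxeterMatrix M).toCoxeterSystem.ext_simple fun i => by
          change φ (ofW M (s M i)) = wRep h₀ (s M i)
          rw [ofW_s, hφ]
          rfl
      exact DFunLike.congr_fun this w
    · rw [hρ, hφ]
      rfl
    · rw [hρ, hφ]
      exact eOp_of_pm h₀ (Or.inl h)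
    · rw [hρ, hφ]
      exact eOp_of_perp h₀ (isRoot_simpleRoot i) h
    · rw [hρ, hφ, ht.eq_reflW]
      exact adj i B β hβ h
  · refine MonoidAlgebra.ringHom_ext (fun n => ?_) fun a => ?_
    · exact DFunLike.congr_fun (Subsingleton.elim
        (ρ.comp MonoidAlgebra.singleOneRingHom) (RingHom.comp _ MonoidAlgebra.singleOneRingHom)) n
    · change ρ (MonoidAlgebra.of ℤ (BrM M) a) = _
      refine Eq.trans ?_ (hρ a).symm
      suffices (ρ : Br M →* EndV M B₀).comp (MonoidAlgebra.of ℤ (BrM M)) = φ from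
        DFunLike.congr_fun this a
      have hd : ρ (MonoidAlgebra.of ℤ (BrM M) (gen M .delta)) = φ (gen M .delta) := by
        rw [hφ]
        exact LinearMap.ext h.delta
      refine brM_hom_ext fun x => ?_
      cases x with
      | r i =>
        rw [hφ, ← ofW_s]
        exact h.extends_W (s M i)
      | e i =>
        rw [hφ]
        refine endV_ext fun B => ?_
        change ρ (MonoidAlgebra.of ℤ (BrM M) (gen M (.e i))) (xi M B₀ B) = _
        rcases simpleRoot_mem_or i B.1 with h' | h' | ⟨β, hβ, h'⟩
        · rw [h.e_mem i B h']
          exact (eOp_of_pm h₀ (Or.inl h')).symm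
        · rw [h.e_perp i B h']
          exact (eOp_of_perp h₀ (isRoot_simpleRoot i) h').symm
        · rw [h.e_adj i B β hβ h' _ (isReflection_reflW (B.1.2.pos β hβ).1), wRepGL_apply,
            ← reflW_simpleRoot i]
          rcases (abs_eq zero_le_one).mp h' with h' | h'
          · rw [← reflW_neg (B.1.2.pos β hβ).1]
            exact (eOp_of_form h₀ (isRoot_simpleRoot i) (Or.inr (by rwa [neg_neg]))
              (by rw [form_neg_right, h'])).symm
          · exact (eOp_of_form h₀ (isRoot_simpleRoot i) (Or.inl hβ) h').symm
      | delta => exact hd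
      | deltaInv => exact map_deltaInv_unique hd

end Brauer

end

end BrauerADE

/-! ### The theorem -/

theorem mainTheorem7 {I : Type*} [Fintype I] (M : SimpleGraph I) (hM : BrauerADE.IsADE M) :
    ((∃! σ : BrauerADE.BrM M →* Function.End (BrauerADE.Adm M), BrauerADE.IsSigma M σ) ∧
      ∀ σ : BrauerADE.BrM M →* Function.End (BrauerADE.Adm M), BrauerADE.IsSigma M σ →
        ∀ (a : BrauerADE.BrM M) (Y X : BrauerADE.Adm M), Y.1 ⊆ X.1 → (σ a Y).1 ⊆ (σ a X).1) ∧
    ∀ X : BrauerADE.Adm M,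
      (∃! B₀ : BrauerADE.Orbit M X, BrauerADE.IsHighest B₀) ∧
      ∀ B₀ : BrauerADE.Orbit M X, BrauerADE.IsHighest B₀ →
        (∃! h, BrauerADE.IsH M B₀ h) ∧
        ∀ h, BrauerADE.IsH M B₀ h →
          (∃! ρW, BrauerADE.IsWRep M B₀ h ρW) ∧
          ∀ ρW, BrauerADE.IsWRep M B₀ h ρW →
            ∃! ρ : BrauerADE.Br M →+* BrauerADE.EndV M B₀, BrauerADE.IsBrRep M B₀ ρW ρ := by
  have := hM.posDef
  refine ⟨⟨BrauerADE.existsUnique_isSigma, fun σ hσ => hσ.mono⟩, fun X =>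
    ⟨BrauerADE.existsUnique_isHighest X, fun B₀ h₀ =>
      ⟨BrauerADE.existsUnique_isH h₀, fun h hh => ⟨⟨BrauerADE.wRepGL h₀,
        BrauerADE.isWRep_wRepGL h₀ hh, fun ρW hρ => hρ.eq_wRepGL h₀ hh⟩, fun ρW hρ => ?_⟩⟩⟩⟩
  rw [hρ.eq_wRepGL h₀ hh]
  exact BrauerADE.existsUnique_isBrRep h₀
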